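/- Let $k$ be an algebraically closed field and let $A$ be a finite-dimensional associative unital $k$-algebra which is connected (that is, $A\neq 0$ and $0,1$ are its only central idempotents) and basic (that is, as a left module $A$ is a direct sum of pairwise non-isomorphic indecomposable projective modules). Fix a complete set $\{e_1,\dots,e_n\}$ of pairwise orthogonal primitive idempotents of $A$, and regard $A$ as the $k$-linear category with objects $e_1,\dots,e_n$, with morphism spaces $\mathrm{Hom}(e_i,e_j)=e_jAe_i$, and with composition given by the product of $A$. *Presentations and fundamental groups.* For a quiver $Q$ with finitely many vertices and arrows, let $kQ$ be its path algebra and $kQ^+$ the two-sided ideal generated by the arrows. A two-sided ideal $I$ of $kQ$ is admissible if $(kQ^+)^m\subseteq I\subseteq (kQ^+)^2$ for some $m\ge 2$. An admissible presentation of $A$ is an isomorphism of $k$-algebras $kQ/I\cong A$ with $I$ admissible. A minimal relation is an element $r=\sum_{i=1}^s t_iu_i\in I$, where $s\geq 1$, $t_i\in k^*$ and the $u_i$ are distinct paths with the same source and the same target, such that $\sum_{i\in S}t_iu_i\notin I$ for every non-empty proper subset $S\subset\{1,\dots,s\}$. Let $\sim_I$ be the smallest equivalence relation on the walks of $Q$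 (the composable formal products of arrows and formal inverses of arrows, including the trivial walks $\varepsilon_x$ at the vertices $x$) which is compatible with concatenation and satisfies $\alpha\alpha^{-1}\sim_I \varepsilon_y$ and $\alpha^{-1}\alpha\sim_I \varepsilon_x$ for every arrow $\alpha\colon x\to y$, and $u_i\sim_I u_j$ whenever $u_i,u_j$ occur in the same minimal relation. Then $\pi_1(Q,I,x_0)$ is the group of $\sim_I$-classes of walks from $x_0$ to $x_0$. *Galois coverings.* A $k$-linear category $\mathcal C$ (with a non-empty set of objects) is locally bounded if distinct objects are non-isomorphic, all endomorphism algebras are local, and $\bigoplus_y\mathrm{Hom}(x,y)$ and $\bigoplus_y\mathrm{Hom}(y,x)$ are finite-dimensional for every object $x$. It is connected if any two objects are joined by a finite sequence of objects such that between consecutive terms there is a non-zero morphism in at least one direction. A $k$-linear functor $F\colon\mathcal C\to\mathcal B$ is a covering functor if it is surjective on objects and if, for all objects $x',y'$ of $\mathcal C$ and $x,y$ of $\mathcal B$, the maps induced by $F$ $$\bigoplus_{F(z)=y}\mathrm{Hom}_{\mathcal C}(x',z)\to\mathrm{Hom}_{\mathcal B}(F(x'),y),\qquad \bigoplus_{F(z)=x}\mathrm{Hom}_{\mathcal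 C}(z,y')\to\mathrm{Hom}_{\mathcal B}(x,F(y'))$$ are bijective. It is a Galois covering with group $G$ if it is a covering functor and $G$ acts on $\mathcal C$ by $k$-linear automorphisms, freely on the objects, so that $F\circ g=F$ for all $g\in G$ and $G$ acts transitively on each fibre of $F$ on objects (equivalently, $F$ is the projection $\mathcal C\to\mathcal C/G$ followed by an isomorphism $\mathcal C/G\cong\mathcal B$). It is proper if it is not an isomorphism of categories. Then the following two assertions are equivalent: 1. for every admissible presentation $kQ/I\cong A$ (and every vertex $x_0$ of $Q$), the group $\pi_1(Q,I,x_0)$ is trivial; 2. there is no proper Galois covering $\mathcal C\to A$, with any group, such that $\mathcal C$ is connected and locally bounded. -/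

import Mathlib

open CategoryTheory
open scoped DirectSum

universe u v w

/-! ### Algebras: connected, basic, primitive idempotents -/

/-- A ring is connected if it is nonzero and its only central idempotents are `0` and `1`. -/
def IsConnectedAlg (A : Type u) [Ring A] : Prop :=
  Nontrivial A ∧ ∀ z ∈ Subring.center A, IsIdempotentElem z → z = 0 ∨ z = 1

/-- A module is indecomposable if it is nonzero and is not the direct sum of two nonzero
submodules. -/
def IsIndecomposableModule (A : Type u) [Ring A] (M : Type v) [AddCommGroup M] [Module A M] :
    Prop :=
  Nontrivial M ∧ ∀ N N' : Submodule A M, IsCompl N N' → N = ⊥ ∨ N' = ⊥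

/-- `A` is basic if, as a left `A`-module, it is the direct sum of pairwise non-isomorphic
indecomposable projective left `A`-modules. (Direct summands of `A` are projective.) -/
def IsBasicAlg (A : Type u) [Ring A] : Prop :=
  ∃ (n : ℕ) (P : Fin n → Submodule A A), DirectSum.IsInternal P ∧
    (∀ i, IsIndecomposableModule A (P i)) ∧
    ∀ i j, i ≠ j → IsEmpty (P i ≃ₗ[A] P j)

/-- A primitive idempotent: a nonzero idempotent which is not the sum of two nonzero orthogonal
idempotents. -/
def IsPrimitiveIdempotent {A : Type u} [Ring A] (e : A) : Prop :=
  IsIdempotentElem e ∧ e ≠ 0 ∧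
    ∀ f f' : A, IsIdempotentElem f → IsIdempotentElem f' → f * f' = 0 → f' * f = 0 →
      f + f' = e → f = 0 ∨ f' = 0

/-! ### The algebra `A` as a `k`-category -/

section IdempotentCategory

variable (k : Type u) [Field k] {A : Type u} [Ring A] [Algebra k A] {ι : Type u} [Fintype ι]

/-- The subspace `b A a` of `A`. -/
def cornerSpace (a b : A) : Submodule k A :=
  LinearMap.range (LinearMap.mulLeft k b ∘ₗ LinearMap.mulRight k a)

theorem mem_cornerSpace {a b x : A} : x ∈ cornerSpace k a b ↔ ∃ y, b * (y * a) = x := by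
  simp [cornerSpace]

/-- The `k`-category attached to a complete family of orthogonal idempotents `e` of `A`: its
objects are (the indices of) the `e i`, and the morphisms `e i → e j` are the elements of
`e j * A * e i`. -/
@[nolint unusedArguments]
def IdemCat (_ : Type u) {e : ι → A} (_ : CompleteOrthogonalIdempotents e) : Type u := ι

variable {e : ι → A} (he : CompleteOrthogonalIdempotents e)

/-- The composite of `f : e i → e j` and `g : e j → e l` is the product `g * f` in `A`; the
identity of `e i` is `e i`. -/
instance IdemCat.category : Category.{u} (IdemCat k he) where
  Hom i j := cornerSpace k (e i) (e j)
  id i := ⟨e i, (mem_cornerSpace k).2 ⟨1, by rw [one_mul]; exact he.idem i⟩⟩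
  comp {i j l} f g := ⟨g.1 * f.1, by
    obtain ⟨a, ha⟩ := (mem_cornerSpace k).1 f.2
    obtain ⟨b, hb⟩ := (mem_cornerSpace k).1 g.2
    exact (mem_cornerSpace k).2 ⟨b * e j * e j * a, by rw [← ha, ← hb]; simp only [mul_assoc]⟩⟩
  id_comp {i j} f := by
    obtain ⟨a, ha⟩ := (mem_cornerSpace k).1 f.2
    apply Subtype.ext
    change f.1 * e i = f.1
    rw [← ha, mul_assoc, mul_assoc, (he.idem i).eq]
  comp_id {i j} f := by
    obtain ⟨a, ha⟩ := (mem_cornerSpace k).1 f.2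
    apply Subtype.ext
    change e j * f.1 = f.1
    rw [← ha, ← mul_assoc, (he.idem j).eq]
  assoc f g h := Subtype.ext (mul_assoc h.1 g.1 f.1).symm

instance IdemCat.preadditive : Preadditive (IdemCat k he) where
  homGroup i j := inferInstanceAs (AddCommGroup (cornerSpace k (e i) (e j)))
  add_comp _ _ _ f f' g := Subtype.ext (mul_add g.1 f.1 f'.1)
  comp_add _ _ _ f g g' := Subtype.ext (add_mul g.1 g'.1 f.1)

instance IdemCat.linear : Linear k (IdemCat k he) where
  homModule i j := inferInstanceAs (Module k (cornerSpace k (e i) (e j)))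
  smul_comp _ _ _ r f g := Subtype.ext (mul_smul_comm r g.1 f.1)
  comp_smul _ _ _ f r g := Subtype.ext (smul_mul_assoc r g.1 f.1)

end IdempotentCategory

/-! ### `k`-categories and Galois coverings -/

section LinearCategories

variable (k : Type u) [Field k]

/-- A locally bounded `k`-category. -/
structure IsLocallyBounded (C : Type v) [Category.{w} C] [Preadditive C] [Linear k C] : Prop where
  /-- distinct objects are not isomorphic -/
  eq_of_iso : ∀ x y : C, Nonempty (x ≅ y) → x = y
  /-- endomorphism algebras are local -/
  isLocal : ∀ x : C, IsLocalRing (End x)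
  finite_source : ∀ x : C, Module.Finite k (⨁ y : C, (x ⟶ y))
  finite_target : ∀ y : C, Module.Finite k (⨁ x : C, (x ⟶ y))

/-- A `k`-category is connected if any two of its objects are joined by a finite sequence of
objects in which there is a nonzero morphism, in one direction or the other, between any two
consecutive terms. (As for every `k`-category, the set of objects is not empty.) -/
def IsConnectedLinCat (C : Type v) [Category.{w} C] [Preadditive C] : Prop :=
  Nonempty C ∧ ∀ x y : C,
    Relation.ReflTransGen (fun a b : C => (∃ f : a ⟶ b, f ≠ 0) ∨ ∃ f : b ⟶ a, f ≠ 0) x y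

variable {E : Type v} [Category.{w} E] [Preadditive E] [Linear k E]
variable {B : Type*} [Category* B] [Preadditive B] [Linear k B]

/-- The map `⨁_{F y' = y} Hom (x', y') → Hom (F x', y)` induced by `F`. -/
noncomputable def coveringMapSource (F : E ⥤ B) [F.Additive] [F.Linear k] (x' : E) (y : B) :
    (⨁ y' : {y' : E // F.obj y' = y}, (x' ⟶ y'.1)) →ₗ[k] (F.obj x' ⟶ y) := by
  classical
  exact DirectSum.toModule k _ _ fun y' =>
    Linear.rightComp k (F.obj x') (eqToHom y'.2) ∘ₗ F.mapLinearMap k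

/-- The map `⨁_{F x' = x} Hom (x', y') → Hom (x, F y')` induced by `F`. -/
noncomputable def coveringMapTarget (F : E ⥤ B) [F.Additive] [F.Linear k] (x : B) (y' : E) :
    (⨁ x' : {x' : E // F.obj x' = x}, (x'.1 ⟶ y')) →ₗ[k] (x ⟶ F.obj y') := by
  classical
  exact DirectSum.toModule k _ _ fun x' =>
    Linear.leftComp k (F.obj y') (eqToHom x'.2.symm) ∘ₗ F.mapLinearMap k

/-- Covering functors between `k`-categories. -/
structure IsCoveringFunctor (F : E ⥤ B) [F.Additive] [F.Linear k] : Prop where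
  surjective : Function.Surjective F.obj
  bijective_source : ∀ (x' : E) (y : B), Function.Bijective (coveringMapSource k F x' y)
  bijective_target : ∀ (x : B) (y' : E), Function.Bijective (coveringMapTarget k F x y')

/-- An action of the group `G` on the `k`-category `E`, that is, a group morphism from `G` to the
group of `k`-linear automorphisms of `E`. -/
structure LinearCatAction (G : Type*) [Group G] (E : Type v) [Category.{w} E] [Preadditive E]
    [Linear k E] where
  toFunctor : G → E ⥤ E
  additive : ∀ g, (toFunctor g).Additive
  linear : ∀ g, (toFunctor g).Linear k
  map_one : toFunctor 1 = 𝟭 E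
  map_mul : ∀ g h, toFunctor (g * h) = toFunctor h ⋙ toFunctor g

/-- `F` is a Galois covering with group `G`: it is a covering functor, and `G` acts on `E` by
`k`-linear automorphisms, freely on the objects, in such a way that `F ∘ g = F` for all `g` and the
fibres of `F` on objects are orbits. Equivalently, `F` induces an isomorphism `E / G ≅ B`. -/
def IsGaloisCovering (G : Type*) [Group G] (F : E ⥤ B) [F.Additive] [F.Linear k] : Prop :=
  IsCoveringFunctor k F ∧ ∃ ρ : LinearCatAction k G E,
    (∀ (g : G) (x : E), (ρ.toFunctor g).obj x = x → g = 1) ∧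
    (∀ g, ρ.toFunctor g ⋙ F = F) ∧
    ∀ x y : E, F.obj x = F.obj y → ∃ g, (ρ.toFunctor g).obj x = y

/-- `F` is an isomorphism of categories: bijective on objects and on all morphism spaces. -/
def IsCatIsomorphism (F : E ⥤ B) : Prop :=
  Function.Bijective F.obj ∧
    ∀ x y : E, Function.Bijective (F.map : (x ⟶ y) → (F.obj x ⟶ F.obj y))

/-- The `k`-category `B` has a proper Galois covering `C → B` (one which is not an isomorphism)
with `C` connected and locally bounded. -/
def HasProperGaloisCovering (B : Type u) [Category.{u} B] [Preadditive B] [Linear k B] : Prop :=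
  ∃ (C : Type u) (_ : Category.{u} C) (_ : Preadditive C) (_ : Linear k C)
    (G : Type u) (_ : Group G) (F : C ⥤ B) (_ : F.Additive) (_ : F.Linear k),
    IsConnectedLinCat C ∧ IsLocallyBounded k C ∧ IsGaloisCovering k G F ∧ ¬ IsCatIsomorphism F

end LinearCategories

/-! ### Path algebras and admissible ideals -/

section PathAlgebra

variable (k : Type u) [Field k] {Q : Type u} [Quiver.{u} Q]

/-- The bilinear extension of concatenation of paths: first a path `x → y`, then a path `y → z`. -/
noncomputable def concat {x y z : Q} :
    (Quiver.Path x y →₀ k) →ₗ[k] (Quiver.Path y z →₀ k) →ₗ[k] (Quiver.Path x z →₀ k) :=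
  Finsupp.lift _ k _ fun p => Finsupp.lmapDomain k k fun q => p.comp q

theorem concat_single {x y z : Q} (p : Quiver.Path x y) (q : Quiver.Path y z) (a b : k) :
    concat k (Finsupp.single p a) (Finsupp.single q b) = Finsupp.single (p.comp q) (a * b) := by
  simp [concat]

theorem concat_assoc {x y z t : Q} (f : Quiver.Path x y →₀ k) (g : Quiver.Path y z →₀ k)
    (h : Quiver.Path z t →₀ k) : concat k (concat k f g) h = concat k f (concat k g h) := by
  induction f using Finsupp.induction_linear with
  | zero => simp
  | add f f' hf hf' => simp [hf, hf']
  | single p a =>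
    induction g using Finsupp.induction_linear with
    | zero => simp
    | add g g' hg hg' => simp [hg, hg']
    | single q b =>
      induction h using Finsupp.induction_linear with
      | zero => simp
      | add h h' hh hh' => simp [hh, hh']
      | single r c => simp only [concat_single, mul_assoc, Quiver.Path.comp_assoc]

theorem nil_concat {x y : Q} (f : Quiver.Path x y →₀ k) :
    concat k (Finsupp.single Quiver.Path.nil 1) f = f := by
  induction f using Finsupp.induction_linear with
  | zero => simp
  | add f f' hf hf' => simp [hf, hf']
  | single p a => rw [concat_single]; simp

theorem concat_nil {x y : Q} (f : Quiver.Path x y →₀ k) :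
    concat k f (Finsupp.single Quiver.Path.nil 1) = f := by
  induction f using Finsupp.induction_linear with
  | zero => simp
  | add f f' hf hf' => simp [hf, hf']
  | single p a => rw [concat_single]; simp

variable (Q) in
/-- The path algebra `kQ = ⨁_{x, y} kQ(x, y)` of a quiver with finitely many vertices, where
`kQ(x, y)` is the vector space with basis the oriented paths from `x` to `y`. -/
def PathAlgebra : Type u := ∀ x y : Q, Quiver.Path x y →₀ k

namespace PathAlgebra

noncomputable instance : AddCommGroup (PathAlgebra k Q) :=
  inferInstanceAs (AddCommGroup (∀ x y : Q, Quiver.Path x y →₀ k))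

noncomputable instance : Module k (PathAlgebra k Q) :=
  inferInstanceAs (Module k (∀ x y : Q, Quiver.Path x y →₀ k))

variable {k}

theorem add_apply (f g : PathAlgebra k Q) (x y : Q) : (f + g) x y = f x y + g x y := rfl
theorem zero_apply (x y : Q) : (0 : PathAlgebra k Q) x y = 0 := rfl
theorem smul_apply (a : k) (f : PathAlgebra k Q) (x y : Q) : (a • f) x y = a • f x y := rfl

@[ext]
theorem ext {f g : PathAlgebra k Q} (h : ∀ x y, f x y = g x y) : f = g :=
  funext fun x => funext fun y => h x y

open Classical in
/-- The inclusion of `kQ(x, y)` into the path algebra. -/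
noncomputable def incl {x y : Q} (r : Quiver.Path x y →₀ k) : PathAlgebra k Q :=
  Pi.single (M := fun x => ∀ y, Quiver.Path x y →₀ k) x
    (Pi.single (M := fun y => Quiver.Path x y →₀ k) y r)

/-- The element of the path algebra given by an arrow. -/
noncomputable def arrow {x y : Q} (α : x ⟶ y) : PathAlgebra k Q :=
  incl (Finsupp.single α.toPath 1)

open Classical in
/-- The unit is the sum of the trivial paths. -/
noncomputable instance : One (PathAlgebra k Q) :=
  ⟨fun x y => if h : x = y then h ▸ Finsupp.single Quiver.Path.nil 1 else 0⟩

open Classical in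
theorem one_apply_self (x : Q) :
    (1 : PathAlgebra k Q) x x = Finsupp.single Quiver.Path.nil 1 := by
  change (dite _ _ _) = _
  simp

open Classical in
theorem one_apply_of_ne {x y : Q} (h : x ≠ y) : (1 : PathAlgebra k Q) x y = 0 := by
  change (dite _ _ _) = _
  simp [h]

variable [Fintype Q]

/-- The product `v u` of two paths is: first `u`, then `v`. -/
noncomputable instance : Mul (PathAlgebra k Q) :=
  ⟨fun f g x z => ∑ y, concat k (g x y) (f y z)⟩

theorem mul_apply (f g : PathAlgebra k Q) (x z : Q) :
    (f * g) x z = ∑ y, concat k (g x y) (f y z) := rfl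

noncomputable instance : Ring (PathAlgebra k Q) :=
  { (inferInstance : AddCommGroup (PathAlgebra k Q)) with
    mul := (· * ·)
    one := 1
    left_distrib := fun f g h => by
      ext1 x z
      simp [mul_apply, add_apply, Finset.sum_add_distrib]
    right_distrib := fun f g h => by
      ext1 x z
      simp [mul_apply, add_apply, Finset.sum_add_distrib]
    zero_mul := fun f => by
      ext1 x z
      simp [mul_apply, zero_apply]
    mul_zero := fun f => by
      ext1 x z
      simp [mul_apply, zero_apply]
    mul_assoc := fun f g h => by
      ext1 x z
      simp only [mul_apply, map_sum, LinearMap.sum_apply, concat_assoc]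
      exact Finset.sum_comm
    one_mul := fun f => by
      ext1 x z
      rw [mul_apply, Finset.sum_eq_single z, one_apply_self, concat_nil]
      · intro y _ hy
        rw [one_apply_of_ne hy, map_zero]
      · simp
    mul_one := fun f => by
      ext1 x z
      rw [mul_apply, Finset.sum_eq_single x, one_apply_self, nil_concat]
      · intro y _ hy
        rw [one_apply_of_ne hy.symm, map_zero, LinearMap.zero_apply]
      · simp }

noncomputable instance : Algebra k (PathAlgebra k Q) :=
  Algebra.ofModule
    (fun a f g => by
      ext1 x z
      simp [mul_apply, smul_apply, Finset.smul_sum])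
    (fun a f g => by
      ext1 x z
      simp [mul_apply, smul_apply, Finset.smul_sum])

variable (k Q) in
/-- The two-sided ideal `kQ⁺` of the path algebra generated by the arrows. -/
noncomputable def arrowIdeal : Ideal (PathAlgebra k Q) :=
  (TwoSidedIdeal.span {a : PathAlgebra k Q | ∃ (x y : Q) (α : x ⟶ y), a = arrow α}).asIdeal

/-- Admissible (two-sided) ideals of the path algebra: `(kQ⁺)ⁿ ⊆ I ⊆ (kQ⁺)²` for some `n ≥ 2`. -/
def IsAdmissible (I : Ideal (PathAlgebra k Q)) : Prop :=
  ∃ n : ℕ, 2 ≤ n ∧ arrowIdeal k Q ^ n ≤ I ∧ I ≤ arrowIdeal k Q ^ 2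

end PathAlgebra

end PathAlgebra

/-! ### The fundamental group of a quiver with relations -/

section FundamentalGroup

variable {k : Type u} [Field k] {Q : Type u} [Quiver.{u} Q] [Fintype Q]

/-- The linear combination `r` of paths from `x` to `y` is a minimal relation of `I`: it is a
nonzero element of `I`, and for any nonempty proper subset `S` of its support the part of `r`
supported on `S` is not in `I`. -/
def IsMinimalRelation (I : Ideal (PathAlgebra k Q)) {x y : Q} (r : Quiver.Path x y →₀ k) : Prop :=
  r ≠ 0 ∧ PathAlgebra.incl r ∈ I ∧
    ∀ S : Finset (Quiver.Path x y), S.Nonempty → S ⊂ r.support →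
      PathAlgebra.incl (∑ p ∈ S, Finsupp.single p (r p)) ∉ I

variable (Q) in
/-- Walks in `Q`: paths formed of arrows and formal inverses of arrows. -/
abbrev Walk (x y : Quiver.Symmetrify Q) : Type u := Quiver.Path x y

/-- An oriented path, seen as a walk. -/
abbrev Quiver.Path.toWalk {x y : Q} (p : Quiver.Path x y) : Walk Q x y :=
  Quiver.Symmetrify.of.mapPath p

/-- The homotopy relation: the smallest equivalence relation on walks which is compatible with
concatenation, cancels an arrow with its formal inverse, and identifies any two paths occurring in
the same minimal relation. -/
inductive Homotopic (I : Ideal (PathAlgebra k Q)) :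
    ∀ {x y : Quiver.Symmetrify Q}, Walk Q x y → Walk Q x y → Prop
  | refl {x y : Quiver.Symmetrify Q} (p : Walk Q x y) : Homotopic I p p
  | symm {x y : Quiver.Symmetrify Q} {p q : Walk Q x y} : Homotopic I p q → Homotopic I q p
  | trans {x y : Quiver.Symmetrify Q} {p q r : Walk Q x y} : Homotopic I p q → Homotopic I q r → Homotopic I p r
  | comp {x y z : Quiver.Symmetrify Q} {p p' : Walk Q x y} {q q' : Walk Q y z} :
      Homotopic I p p' → Homotopic I q q' → Homotopic I (p.comp q) (p'.comp q')
  | arrow_inv {x y : Q} (α : x ⟶ y) :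
      Homotopic I (x := x) (y := x)
        ((Quiver.Hom.toPath α.toPos).comp (Quiver.Hom.toPath α.toNeg)) Quiver.Path.nil
  | inv_arrow {x y : Q} (α : x ⟶ y) :
      Homotopic I (x := y) (y := y)
        ((Quiver.Hom.toPath α.toNeg).comp (Quiver.Hom.toPath α.toPos)) Quiver.Path.nil
  | minimal {x y : Q} {r : Quiver.Path x y →₀ k} (hr : IsMinimalRelation I r)
      {p q : Quiver.Path x y} (hp : p ∈ r.support) (hq : q ∈ r.support) :
      Homotopic I p.toWalk q.toWalk

/-- Homotopy of walks from `x` to `y`. -/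
def homotopySetoid (I : Ideal (PathAlgebra k Q)) (x y : Quiver.Symmetrify Q) :
    Setoid (Walk Q x y) :=
  ⟨Homotopic I, ⟨Homotopic.refl, Homotopic.symm, Homotopic.trans⟩⟩

/-- The fundamental group `π₁(Q, I, x₀)`: homotopy classes of walks from `x₀` to `x₀`. -/
def FundamentalGrp (I : Ideal (PathAlgebra k Q)) (x₀ : Q) : Type u :=
  Quotient (homotopySetoid I (x₀ : Quiver.Symmetrify Q) x₀)

theorem Homotopic.comp_reverse (I : Ideal (PathAlgebra k Q)) {x y : Quiver.Symmetrify Q} (p : Walk Q x y) :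
    Homotopic I (p.comp p.reverse) (Quiver.Path.nil : Walk Q x x) := by
  induction p with
  | nil => exact Homotopic.refl _
  | @cons b c p e ih =>
    have key : Homotopic I
        ((Quiver.Hom.toPath e).comp (Quiver.Hom.toPath (Quiver.reverse e))) Quiver.Path.nil := by
      rcases e with α | α
      · exact Homotopic.arrow_inv α
      · exact Homotopic.inv_arrow α
    have h := Homotopic.comp (Homotopic.refl (I := I) p)
      (Homotopic.comp key (Homotopic.refl (I := I) p.reverse))
    have h' : (p.cons e).comp (p.cons e).reverse = p.comp (((Quiver.Hom.toPath e).comp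
        (Quiver.Hom.toPath (Quiver.reverse e))).comp p.reverse) := by
      change (p.comp (Quiver.Hom.toPath e)).comp
        ((Quiver.Hom.toPath (Quiver.reverse e)).comp p.reverse) = _
      simp only [Quiver.Path.comp_assoc]
    rw [h']
    refine h.trans ?_
    rw [Quiver.Path.nil_comp]
    exact ih

theorem Homotopic.reverse {I : Ideal (PathAlgebra k Q)} {x y : Quiver.Symmetrify Q} {p q : Walk Q x y}
    (h : Homotopic I p q) : Homotopic I p.reverse q.reverse := by
  have h1 : Homotopic I p.reverse (p.reverse.comp (q.comp q.reverse)) := by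
    have := Homotopic.comp (Homotopic.refl (I := I) p.reverse)
      (Homotopic.comp_reverse I q).symm
    rwa [Quiver.Path.comp_nil] at this
  have h2 : Homotopic I (p.reverse.comp (q.comp q.reverse))
      (p.reverse.comp (p.comp q.reverse)) :=
    Homotopic.comp (Homotopic.refl _) (Homotopic.comp h.symm (Homotopic.refl _))
  have h3 : Homotopic I (p.reverse.comp (p.comp q.reverse)) q.reverse := by
    have h4 := Homotopic.comp_reverse I p.reverse
    rw [Quiver.Path.reverse_reverse] at h4
    have := Homotopic.comp h4 (Homotopic.refl (I := I) q.reverse)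
    rwa [Quiver.Path.nil_comp, Quiver.Path.comp_assoc] at this
  exact h1.trans (h2.trans h3)

/-- The product `[v] [u]` is the class of the walk: first `u`, then `v`. -/
instance (I : Ideal (PathAlgebra k Q)) (x₀ : Q) : Group (FundamentalGrp I x₀) where
  mul := Quotient.map₂ (fun v u => u.comp v) fun _ _ h _ _ h' => Homotopic.comp h' h
  one := Quotient.mk _ Quiver.Path.nil
  inv := Quotient.map (fun u => u.reverse) fun _ _ h => Homotopic.reverse h
  mul_assoc := by
    rintro ⟨a⟩ ⟨b⟩ ⟨c⟩
    exact congrArg (Quotient.mk _) (Quiver.Path.comp_assoc c b a).symm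
  one_mul := by
    rintro ⟨a⟩
    exact congrArg (Quotient.mk _) (Quiver.Path.comp_nil a)
  mul_one := by
    rintro ⟨a⟩
    exact congrArg (Quotient.mk _) (Quiver.Path.nil_comp a)
  inv_mul_cancel := by
    rintro ⟨a⟩
    exact Quotient.sound (Homotopic.comp_reverse I a)

end FundamentalGroup

/-! Both implications go through gradings. A connected locally bounded Galois covering of `A` with
group `G` amounts to a `G`-grading of `A` in which the `e i` have degree `1`, components of degree
other than `1` lie in the radical, and the pairs `(i, g)` are linked by nonzero homogeneous elements
(`IsCoveringGrading`). From the grading one recovers the covering as a smash product with objects `ι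
× G`, where the morphisms `(i, g) → (j, h)` are the elements of degree `h * g⁻¹` in `e j * A * e i`
(`IsCoveringGrading.hasProperGaloisCovering`). From the covering one recovers the grading by
choosing one object over each `e i` and recording which translate of the chosen target a morphism
reaches (`HasProperGaloisCovering.exists_isCoveringGrading`).

Suppose a presentation has nontrivial fundamental group. Join every vertex to `x₀` by a walk, which
is possible because `A` is connected, and give each arrow the class of the loop it closes. Minimal
relations are then homogeneous. Every element of `I` breaks up into minimal relations, so `I`
contains the homogeneous components of its elements (`IsRelationWeight.incl_filter_mem`), and the
grading of the path algebra by weights descends to `A`. After conjugation by a unit the vertices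
become the `e i` (`SplitFamily.exists_conj`), and the smash product is a proper covering.

Conversely, let a proper covering be given, hence a covering grading by a nontrivial group. The
radical is spanned by homogeneous elements, so arrows can be chosen homogeneous, forming bases of
the corners of the radical modulo its square (`IsCoveringGrading.exists_isArrowSystem`). They define
an admissible presentation. Its minimal relations are homogeneous, since the homogeneous parts of a
relation are again relations. Weights therefore depend only on homotopy classes, and the
connectedness of the covering provides a closed walk of weight other than `1`; the fundamental group
of this presentation is not trivial.

That `A` is basic over an algebraically closed field enters only through `SplitFamily`: there are
characters `A → k` dual to the `e i` whose common kernel is nilpotent. This common kernel serves as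
the radical throughout. -/

/-! ### Fitting's lemma and local corners -/

section Corners

variable {k : Type*} [Field k] {A : Type*} [Ring A] [Algebra k A]

/-- Every element of the corner `f A f` is a scalar multiple of `f` up to a nilpotent element. -/
def HasScalarResidue (k : Type*) [Field k] {A : Type*} [Ring A] [Algebra k A] (f : A) : Prop :=
  ∀ a : A, f * a = a → a * f = a → ∃ c : k, IsNilpotent (a - c • f)

/-- Fitting's lemma for `φ - c`, where `c` is an eigenvalue of `φ`: for large `n` the module is the
direct sum of the kernel and the range of the `n`-th power, and the kernel contains an eigenvector.
The iterate is that of a plain function because scalars of `k` act on `A`-linear maps only through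
the instance `SMulCommClass A k M` derived in the proof. -/
theorem IsIndecomposableModule.exists_isNilpotent_sub [IsAlgClosed k] {A : Type u} [Ring A]
    [Algebra k A] {M : Type v} [AddCommGroup M]
    [Module k M] [Module A M] [IsScalarTower k A M] [FiniteDimensional k M]
    (hM : IsIndecomposableModule A M) (φ : M →ₗ[A] M) :
    ∃ c : k, ∃ n : ℕ, ∀ x, ((φ : M → M) - fun y => c • y)^[n] x = 0 := by
  have := hM.1
  have : SMulCommClass A k M := IsScalarTower.to_smulCommClass'
  have : IsNoetherian A M := isNoetherian_of_tower k inferInstance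
  have : IsArtinian A M := isArtinian_of_tower k inferInstance
  obtain ⟨c, hc⟩ := Module.End.exists_eigenvalue (φ.restrictScalars k)
  obtain ⟨v, hv⟩ := hc.exists_hasEigenvector
  let ψ : Module.End A M := φ - c • LinearMap.id
  have hψ : ∀ n x, ((φ : M → M) - fun y => c • y)^[n] x = (ψ ^ n) x := by
    intro n x
    rw [Module.End.pow_apply]
    rfl
  have hψv : ψ v = 0 := by
    have : φ v = c • v := hv.apply_eq_smul
    simp [ψ, this]
  -- The bound `1 ≤ n` puts the eigenvector into the kernel of `ψ ^ n`.
  obtain ⟨n, hn, hn0⟩ := ((ψ.eventually_isCompl_ker_pow_range_pow).and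
    (Filter.eventually_ge_atTop 1)).exists
  refine ⟨c, n, fun x => ?_⟩
  rw [hψ]
  rcases hM.2 _ _ hn with h | h
  · exfalso
    refine hv.2 ?_
    have : v ∈ LinearMap.ker (ψ ^ n) := by
      obtain ⟨m, rfl⟩ := Nat.exists_eq_add_of_le' hn0
      rw [LinearMap.mem_ker, pow_succ, Module.End.mul_apply, hψv, map_zero]
    rwa [h, Submodule.mem_bot] at this
  · rw [LinearMap.range_eq_bot.1 h, LinearMap.zero_apply]

/-- Right multiplication by an element of the corner is an endomorphism of `P`; Fitting's lemma
applies to it, and evaluation at `f` turns a nilpotent endomorphism into a nilpotent element. -/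
theorem hasScalarResidue_of_isIndecomposable [IsAlgClosed k] {A : Type u} [Ring A] [Algebra k A]
    [FiniteDimensional k A] {f : A}
    (P : Submodule A A) (hfP : f ∈ P) (hP : ∀ p ∈ P, p * f = p)
    (h : IsIndecomposableModule A P) : HasScalarResidue k f := by
  intro a hfa haf
  have hff : f * f = f := hP f hfP
  let φ : P →ₗ[A] P :=
    { toFun := fun x => ⟨x.1 * a, by
        rw [← hP x.1 x.2, mul_assoc, hfa, ← haf, ← mul_assoc]
        exact P.smul_mem _ hfP⟩
      map_add' := fun x y => Subtype.ext (add_mul _ _ _)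
      map_smul' := fun r x => Subtype.ext (mul_assoc _ _ _) }
  have : FiniteDimensional k P :=
    FiniteDimensional.finiteDimensional_submodule (P.restrictScalars k)
  obtain ⟨c, n, hn⟩ := h.exists_isNilpotent_sub (k := k) φ
  -- Evaluation at `f` only gives `f * (a - c • f) ^ n = 0`; one more factor `a - c • f` absorbs the
  -- `f`.
  refine ⟨c, n + 1, ?_⟩
  have key : ∀ m (x : P), (((φ : P → P) - fun y => c • y)^[m] x).1 = x.1 * (a - c • f) ^ m := by
    intro m
    induction m with
    | zero => intro x; simp
    | succ m ih =>
      intro x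
      rw [Function.iterate_succ_apply, ih, pow_succ', ← mul_assoc]
      congr 1
      change x.1 * a - c • x.1 = _
      rw [mul_sub, mul_smul_comm, hP x.1 x.2]
  have := key n ⟨f, hfP⟩
  rw [hn] at this
  have h2 : (a - c • f) * f = a - c • f := by rw [sub_mul, haf, smul_mul_assoc, hff]
  rw [pow_succ', ← h2, mul_assoc]
  rw [h2, ← this]
  simp

/-- The components of `e` in a decomposition of `A e` are orthogonal idempotents with sum `e`. By
primitivity one of them vanishes; the other is then `e`, so its summand is everything. -/
theorem IsPrimitiveIdempotent.isIndecomposable {A : Type u} [Ring A] {e : A}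
    (he : IsPrimitiveIdempotent e) :
    IsIndecomposableModule A (Ideal.span {e} : Submodule A A) := by
  obtain ⟨hidem, hne, hprim⟩ := he
  have hmem : ∀ p ∈ (Ideal.span {e} : Submodule A A), p * e = p := by
    intro p hp
    obtain ⟨r, rfl⟩ := Ideal.mem_span_singleton'.1 hp
    rw [mul_assoc, hidem.eq]
  have heP : e ∈ (Ideal.span {e} : Submodule A A) := Ideal.mem_span_singleton_self e
  refine ⟨⟨⟨⟨e, heP⟩, 0, fun h => hne (congrArg Subtype.val h)⟩⟩, fun N N' hc => ?_⟩
  obtain ⟨n, hn, n', hn', hsum⟩ := Submodule.mem_sup.1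
    (hc.sup_eq_top ▸ Submodule.mem_top : (⟨e, heP⟩ : (Ideal.span {e} : Submodule A A)) ∈ N ⊔ N')
  have hs : n.1 + n'.1 = e := congrArg Subtype.val hsum
  have aux : ∀ (N N' : Submodule A (Ideal.span {e} : Submodule A A)), IsCompl N N' →
      ∀ n ∈ N, ∀ n' ∈ N', n.1 + n'.1 = e → n.1 * n.1 = n.1 ∧ n.1 * n'.1 = 0 := by
    intro N N' hc n hn n' hn' hs
    -- The left side lies in `N'` and the right side in `N`, so both are zero.
    have h0 : n.1 • n' = n - n.1 • n := by
      apply Subtype.ext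
      change n.1 * n'.1 = n.1 - n.1 * n.1
      rw [eq_sub_iff_add_eq', ← mul_add]
      exact (congrArg (n.1 * ·) hs).trans (hmem n.1 n.2)
    have h1 : n.1 • n' ∈ N ⊓ N' :=
      ⟨h0 ▸ N.sub_mem hn (N.smul_mem _ hn), N'.smul_mem _ hn'⟩
    rw [hc.inf_eq_bot, Submodule.mem_bot] at h1
    rw [h1] at h0
    exact ⟨(sub_eq_zero.1 (congrArg Subtype.val h0).symm).symm, congrArg Subtype.val h1⟩
  have fin : ∀ (N N' : Submodule A (Ideal.span {e} : Submodule A A)), IsCompl N N' →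
      ∀ n' ∈ N', n'.1 = e → N = ⊥ := by
    intro N N' hc n' hn' hs
    have : N' = ⊤ := by
      rw [eq_top_iff]
      rintro ⟨x, hx⟩ -
      obtain ⟨r, rfl⟩ := Ideal.mem_span_singleton'.1 hx
      have : (⟨r * e, hx⟩ : (Ideal.span {e} : Submodule A A)) = r • n' :=
        Subtype.ext (by change r * e = r * n'.1; rw [hs])
      rw [this]
      exact N'.smul_mem _ hn'
    have h2 := hc.inf_eq_bot
    rwa [this, inf_top_eq] at h2
  have h1 := aux N N' hc n hn n' hn' hs
  have h2 := aux N' N hc.symm n' hn' n hn (by rw [add_comm, hs])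
  rcases hprim n.1 n'.1 h1.1 h2.1 h1.2 h2.2 hs with h | h
  · left
    exact fin N N' hc n' hn' (by rwa [h, zero_add] at hs)
  · right
    exact fin N' N hc.symm n hn (by rwa [h, add_zero] at hs)

theorem IsPrimitiveIdempotent.hasScalarResidue [IsAlgClosed k] {A : Type u} [Ring A] [Algebra k A]
    [FiniteDimensional k A] {e : A} (he : IsPrimitiveIdempotent e) : HasScalarResidue k e := by
  refine hasScalarResidue_of_isIndecomposable _ (Ideal.mem_span_singleton_self e) ?_
    he.isIndecomposable
  intro p hp
  obtain ⟨r, rfl⟩ := Ideal.mem_span_singleton'.1 hp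
  rw [mul_assoc, he.1.eq]

/-- An element `b` of the corner at `f` is either nilpotent or invertible in the corner. -/
theorem HasScalarResidue.isNilpotent_or_invertible {f : A} (hf : HasScalarResidue k f)
    (hff : f * f = f) {b : A} (h1 : f * b = b) (h2 : b * f = b) :
    IsNilpotent b ∨ ∃ c, f * c = c ∧ c * f = c ∧ b * c = f ∧ c * b = f := by
  obtain ⟨c, hc⟩ := hf b h1 h2
  by_cases h0 : c = 0
  · left; simpa [h0] using hc
  right
  -- A nonzero scalar plus a nilpotent element is a unit of the whole algebra; its truncation by `f`
  -- is `b`, and truncating its inverse inverts `b` in the corner.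
  have hu : IsUnit (algebraMap k A c + (b - c • f)) := by
    refine IsNilpotent.isUnit_add_left_of_commute hc ((IsUnit.mk0 c h0).map _) ?_
    exact (Algebra.commutes c _).symm
  obtain ⟨w, hw⟩ := hu
  have hcf : (w : A) * f = b := by
    rw [hw, add_mul, sub_mul, h2, smul_mul_assoc, hff, Algebra.smul_def]; abel
  have hfc : f * (w : A) = b := by
    rw [hw, mul_add, mul_sub, h1, mul_smul_comm, hff, Algebra.smul_def, ← Algebra.commutes]; abel
  have hcomm : (↑w⁻¹ : A) * f = f * ↑w⁻¹ := by
    rw [Units.inv_mul_eq_iff_eq_mul, ← mul_assoc, hcf, ← hfc, mul_assoc, Units.mul_inv, mul_one]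
  refine ⟨↑w⁻¹ * f, ?_, ?_, ?_, ?_⟩
  · rw [← mul_assoc, ← hcomm, mul_assoc, hff]
  · rw [mul_assoc, hff]
  · rw [hcomm, ← mul_assoc, h2, ← hfc, mul_assoc, Units.mul_inv, mul_one]
  · rw [mul_assoc, h1, ← hcf, ← mul_assoc, Units.inv_mul, one_mul]

theorem mem_jacobson_of_forall_isNilpotent {A : Type*} [Ring A] {x : A}
    (h : ∀ r, IsNilpotent (r * x)) : x ∈ Ring.jacobson A := by
  rw [← Ideal.jacobson_bot, Ideal.mem_jacobson_iff]
  intro y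
  obtain ⟨z, hz⟩ := (h y).isUnit_add_one
  refine ⟨↑z⁻¹, ?_⟩
  rw [Submodule.mem_bot, sub_eq_zero, mul_assoc]
  calc (↑z⁻¹ : A) * (y * x) + ↑z⁻¹ = ↑z⁻¹ * (y * x + 1) := by rw [mul_add, mul_one]
    _ = 1 := by rw [← hz, Units.inv_mul]

/-- The identity `(r * x) ^ (m + 1) = r * (x * r * f) ^ m * x` reduces nilpotency of all `r * x` to
nilpotency inside the corner at `f`. -/
theorem mem_jacobson_of_corner {A : Type*} [Ring A] {f x : A} (hfx : f * x = x)
    (h : ∀ r, IsNilpotent (x * r * f)) : x ∈ Ring.jacobson A := by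
  refine mem_jacobson_of_forall_isNilpotent fun r => ?_
  obtain ⟨n, hn⟩ := h r
  refine ⟨n + 1, ?_⟩
  have key : ∀ m, (r * x) ^ (m + 1) = r * (x * r * f) ^ m * x := by
    intro m
    induction m with
    | zero => simp
    | succ m ih =>
      rw [pow_succ, ih, pow_succ]
      simp only [mul_assoc, hfx]
  rw [key, hn]
  simp

end Corners

/-! ### Split families of idempotents -/

section SplitFamilies

/-- A family of idempotents `e` of a `k`-algebra `A` is split by characters `χ i : A → k` if the
`χ i` are dual to the `e i` and the intersection of their kernels is nilpotent. -/
structure SplitFamily (k : Type*) [Field k] {A : Type*} [Ring A] [Algebra k A] {ι : Type*}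
    (e : ι → A) where
  char : ι → A →ₐ[k] k
  char_self : ∀ i, char i (e i) = 1
  char_of_ne : ∀ i j, i ≠ j → char i (e j) = 0
  isNilpotent_iInf_ker : IsNilpotent (⨅ i, RingHom.ker (char i) : Ideal A)

variable {k : Type*} [Field k] {A : Type*} [Ring A] [Algebra k A] {ι : Type*} {e : ι → A}

namespace SplitFamily

variable (χ : SplitFamily k e)

/-- The intersection of the kernels of the characters. -/
def rad : Ideal A := ⨅ i, RingHom.ker (χ.char i)

theorem mem_rad {a : A} : a ∈ χ.rad ↔ ∀ i, χ.char i a = 0 := by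
  simp [rad, RingHom.mem_ker]

instance : χ.rad.IsTwoSided :=
  ⟨fun b ha => χ.mem_rad.2 fun i => by rw [map_mul, χ.mem_rad.1 ha i, zero_mul]⟩

theorem exists_rad_pow_eq_bot : ∃ n, χ.rad ^ n = ⊥ := χ.isNilpotent_iInf_ker

theorem isNilpotent_of_mem_rad {a : A} (ha : a ∈ χ.rad) : IsNilpotent a := by
  obtain ⟨n, hn⟩ := χ.exists_rad_pow_eq_bot
  refine ⟨n, ?_⟩
  have : a ^ n ∈ χ.rad ^ n := Ideal.pow_mem_pow ha n
  rwa [hn, Submodule.mem_bot] at this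

theorem idem_notMem_rad (i : ι) : e i ∉ χ.rad := fun h => by
  have := χ.mem_rad.1 h i
  rw [χ.char_self] at this
  exact one_ne_zero this

theorem corner_mem_rad {i j : ι} (h : i ≠ j) {a : A} (h1 : e j * a = a) (h2 : a * e i = a) :
    a ∈ χ.rad := by
  rw [χ.mem_rad]
  intro l
  by_cases hl : l = i
  · rw [← h1, map_mul, χ.char_of_ne l j (hl ▸ h), zero_mul]
  · rw [← h2, map_mul, χ.char_of_ne l i hl, mul_zero]

theorem char_corner_of_ne {i l : ι} (h : l ≠ i) {a : A} (h2 : a * e i = a) : χ.char l a = 0 := by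
  rw [← h2, map_mul, χ.char_of_ne l i h, mul_zero]

theorem corner_sub_mem_rad {i : ι} {a : A} (h2 : a * e i = a) :
    a - χ.char i a • e i ∈ χ.rad := by
  rw [χ.mem_rad]
  intro l
  rw [map_sub, map_smul]
  by_cases hl : l = i
  · subst hl; rw [χ.char_self, smul_eq_mul, mul_one, sub_self]
  · rw [χ.char_corner_of_ne hl h2, χ.char_of_ne l i hl, smul_zero, sub_zero]

theorem hasScalarResidue (χ : SplitFamily k e) (i : ι) : HasScalarResidue k (e i) := fun a _ h2 =>
  ⟨χ.char i a, χ.isNilpotent_of_mem_rad (χ.corner_sub_mem_rad h2)⟩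

/-- An element of the corner at `e i` which is not in the radical is invertible in the corner. -/
theorem exists_inverse {i : ι} (he : IsIdempotentElem (e i)) {b : A} (h1 : e i * b = b) (h2 : b * e i = b)
    (hb : χ.char i b ≠ 0) :
    ∃ c, e i * c = c ∧ c * e i = c ∧ b * c = e i ∧ c * b = e i := by
  refine ((χ.hasScalarResidue i).isNilpotent_or_invertible he.eq h1 h2).resolve_left fun h => hb ?_
  exact (h.map (χ.char i)).eq_zero

theorem sub_sum_mem_rad [Fintype ι] (a : A) : a - ∑ i, χ.char i a • e i ∈ χ.rad := by
  classical
  rw [χ.mem_rad]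
  intro l
  rw [map_sub, map_sum, Finset.sum_eq_single l, map_smul, χ.char_self, smul_eq_mul, mul_one,
    sub_self]
  · intro i _ hi
    rw [map_smul, χ.char_of_ne l i hi.symm, smul_zero]
  · simp

theorem map_eq_zero_of_mem_rad (ψ : A →ₐ[k] k) {a : A} (ha : a ∈ χ.rad) : ψ a = 0 :=
  ((χ.isNilpotent_of_mem_rad ha).map ψ).eq_zero

/-- Every character of `A` is one of the `χ i`. -/
theorem exists_eq_char [Fintype ι] (he : CompleteOrthogonalIdempotents e) (ψ : A →ₐ[k] k) :
    ∃ i, ψ = χ.char i := by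
  obtain ⟨i, hi⟩ : ∃ i, ψ (e i) ≠ 0 := by
    by_contra! h
    have := congrArg ψ he.complete
    rw [map_sum, Finset.sum_eq_zero fun i _ => h i, map_one] at this
    exact zero_ne_one this
  have h1 : ψ (e i) = 1 := by
    have := congrArg ψ (he.idem i).eq
    rw [map_mul] at this
    exact mul_right_cancel₀ hi (this.trans (one_mul _).symm)
  have h0 : ∀ l, l ≠ i → ψ (e l) = 0 := fun l hl => by
    have := congrArg ψ (he.ortho hl)
    rwa [map_mul, h1, mul_one, map_zero] at this
  refine ⟨i, AlgHom.ext fun a => ?_⟩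
  -- A character kills nilpotent elements, so it is determined by its values on the `e i`.
  have := χ.map_eq_zero_of_mem_rad ψ (χ.sub_sum_mem_rad a)
  rw [map_sub, sub_eq_zero, map_sum, Finset.sum_eq_single i] at this
  · rw [this, map_smul, h1, smul_eq_mul, mul_one]
  · intro l _ hl
    rw [map_smul, h0 l hl, smul_zero]
  · simp

theorem char_injective : Function.Injective χ.char := fun i j h => by
  by_contra hij
  have h1 := χ.char_of_ne i j hij
  rw [h, χ.char_self] at h1
  exact one_ne_zero h1

/-- Two complete families of orthogonal idempotents which are split by characters are conjugate. -/
theorem exists_conj (χ : SplitFamily k e) [Fintype ι] (he : CompleteOrthogonalIdempotents e) {κ : Type*} [Fintype κ]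
    {f : κ → A} (hf : CompleteOrthogonalIdempotents f) (ψ : SplitFamily k f) :
    ∃ (σ : κ ≃ ι) (u : Aˣ), ∀ x, (u : A) * f x = e (σ x) * u := by
  classical
  choose σ hσ using fun x => χ.exists_eq_char he (ψ.char x)
  have hbij : Function.Bijective σ := by
    refine ⟨fun x y h => ψ.char_injective (by rw [hσ, hσ, h]), fun i => ?_⟩
    obtain ⟨x, hx⟩ := ψ.exists_eq_char hf (χ.char i)
    exact ⟨x, χ.char_injective (by rw [hx, hσ])⟩
  -- This element is congruent to `1` modulo the nilpotent radical, hence a unit, and it intertwines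
  -- the two families.
  let w : A := ∑ x, e (σ x) * f x
  have hw : IsUnit w := by
    have hmem : w - 1 ∈ χ.rad := by
      rw [χ.mem_rad]
      intro i
      obtain ⟨x, rfl⟩ := hbij.2 i
      rw [map_sub, map_one, map_sum, Finset.sum_eq_single x, map_mul, χ.char_self, ← hσ,
        ψ.char_self, one_mul, sub_self]
      · intro y _ hy
        rw [map_mul, χ.char_of_ne _ _ fun h => hy (hbij.1 h).symm, zero_mul]
      · simp
    have := (χ.isNilpotent_of_mem_rad hmem).isUnit_add_one
    rwa [sub_add_cancel] at this
  obtain ⟨u, hu⟩ := hw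
  refine ⟨Equiv.ofBijective σ hbij, u, fun x => ?_⟩
  have h1 : w * f x = e (σ x) * f x := by
    rw [Finset.sum_mul, Finset.sum_eq_single x, mul_assoc, (hf.idem x).eq]
    · intro y _ hy
      rw [mul_assoc, hf.ortho hy, mul_zero]
    · simp
  have h2 : e (σ x) * w = e (σ x) * f x := by
    rw [Finset.mul_sum, Finset.sum_eq_single x, ← mul_assoc, (he.idem _).eq]
    · intro y _ hy
      rw [← mul_assoc, he.ortho fun h => hy (hbij.1 h).symm, zero_mul]
    · simp
  rw [hu, h1, Equiv.ofBijective_apply, h2]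

end SplitFamily

/-- A complete family of orthogonal idempotents with scalar residues and no two of them equivalent
is split. -/
theorem exists_splitFamily [FiniteDimensional k A] [Fintype ι]
    (he : CompleteOrthogonalIdempotents e) (hne : ∀ i, e i ≠ 0)
    (hres : ∀ i, HasScalarResidue k (e i))
    (hiso : ∀ i j, i ≠ j → ∀ x y, e i * x = x → x * e j = x → e j * y = y → y * e i = y →
      x * y = e i → y * x = e j → False) :
    Nonempty (SplitFamily k e) := by
  classical
  have : IsArtinianRing A := IsArtinianRing.of_finite k A
  obtain ⟨n, hn⟩ : IsNilpotent (Ring.jacobson A) := IsSemiprimaryRing.isNilpotent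
  set J := Ring.jacobson A with hJ
  have idem_notMem : ∀ i, e i ∉ J := fun i hi => hne i <| by
    have h1 : e i ^ n ∈ J ^ n := Ideal.pow_mem_pow hi n
    rw [hn, Submodule.zero_eq_bot, Submodule.mem_bot] at h1
    rcases Nat.eq_zero_or_pos n with rfl | hpos
    · rw [pow_zero] at h1
      rw [← mul_one (e i), h1, mul_zero]
    · rwa [(he.idem i).pow_eq (Nat.pos_iff_ne_zero.1 hpos)] at h1
  have eq_of_idem : ∀ i b, e i * b = b → b * e i = b → b * b = b → b = 0 ∨ b = e i := by
    intro i b h1 h2 hb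
    rcases (hres i).isNilpotent_or_invertible (he.idem i).eq h1 h2 with ⟨m, hm⟩ | ⟨c, -, -, -, hc⟩
    · left
      rcases Nat.eq_zero_or_pos m with rfl | hpos
      · rw [pow_zero] at hm
        rw [← mul_one b, hm, mul_zero]
      · rwa [IsIdempotentElem.pow_eq hb (Nat.pos_iff_ne_zero.1 hpos)] at hm
    · right
      calc b = c * b * b := by rw [hc, h1]
        _ = e i := by rw [mul_assoc, hb, hc]
  -- Otherwise `x` has a right inverse `y` with `x * y = e i`. Then `y * x` is an idempotent of the
  -- corner at `e j`: it is not `0` because `e i ≠ 0`, and it is not `e j` by `hiso`.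
  have off : ∀ i j, i ≠ j → ∀ x, e i * x = x → x * e j = x → x ∈ J := by
    intro i j hij x h1 h2
    refine mem_jacobson_of_corner h1 fun r => ?_
    refine ((hres i).isNilpotent_or_invertible (he.idem i).eq
      (by rw [← mul_assoc, ← mul_assoc, h1]) (by rw [mul_assoc, (he.idem i).eq])).resolve_right ?_
    rintro ⟨c, hc1, hc2, hc3, -⟩
    have hxy : x * (e j * r * c) = e i := by
      rw [← hc3, ← mul_assoc, ← mul_assoc, h2, mul_assoc (x * r), hc1]
    have hyx := eq_of_idem j ((e j * r * c) * x)
      (by simp only [← mul_assoc, (he.idem j).eq]) (by rw [mul_assoc, h2])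
      (by rw [mul_assoc, ← mul_assoc x, hxy, h1])
    rcases hyx with h0 | h0
    · refine hne i ?_
      rw [← (he.idem i).eq]
      nth_rw 1 [← hxy]
      rw [← hxy, mul_assoc, ← mul_assoc (e j * r * c), h0, zero_mul, mul_zero]
    · exact hiso i j hij x _ h1 h2 (by simp only [← mul_assoc, (he.idem j).eq])
        (by rw [mul_assoc, hc2]) hxy h0
  -- Otherwise `x` has a right inverse in the corner at `e i`, which a nilpotent element cannot have
  -- as `e i ≠ 0`.
  have nil : ∀ i x, e i * x = x → x * e i = x → IsNilpotent x → x ∈ J := by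
    rintro i x h1 h2 ⟨m, hm⟩
    refine mem_jacobson_of_corner h1 fun r => ?_
    refine ((hres i).isNilpotent_or_invertible (he.idem i).eq
      (by rw [← mul_assoc, ← mul_assoc, h1]) (by rw [mul_assoc, (he.idem i).eq])).resolve_right ?_
    rintro ⟨c, hc1, hc2, hc3, -⟩
    have hxy : x * (e i * r * c) = e i := by
      rw [← mul_assoc, ← mul_assoc, h2, ← hc1, ← mul_assoc, hc3]
    have key : ∀ l, x ^ l * e i = 0 → e i = 0 := by
      intro l
      induction l with
      | zero => simp
      | succ l ih =>
        intro h
        refine ih ?_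
        calc x ^ l * e i = x ^ (l + 1) * (e i * r * c) := by rw [pow_succ, mul_assoc, hxy]
          _ = x ^ (l + 1) * e i * (r * c) := by simp only [mul_assoc]
          _ = 0 := by rw [h, zero_mul]
    exact hne i (key m (by rw [hm, zero_mul]))
  have ex : ∀ i a, ∃ c : k, e i * a * e i - c • e i ∈ J := by
    intro i a
    have h1 : e i * (e i * a * e i) = e i * a * e i := by simp only [← mul_assoc, (he.idem i).eq]
    have h2 : (e i * a * e i) * e i = e i * a * e i := by rw [mul_assoc, (he.idem i).eq]
    obtain ⟨c, hc⟩ := hres i _ h1 h2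
    refine ⟨c, nil i _ ?_ ?_ hc⟩
    · rw [mul_sub, h1, mul_smul_comm, (he.idem i).eq]
    · rw [sub_mul, h2, smul_mul_assoc, (he.idem i).eq]
  choose c hc using ex
  have uniq : ∀ i a d, e i * a * e i - d • e i ∈ J → c i a = d := by
    intro i a d hd
    by_contra hne'
    refine idem_notMem i ?_
    have h1 := J.sub_mem hd (hc i a)
    rw [sub_sub_sub_cancel_left, ← sub_smul] at h1
    have h2 := J.mul_mem_left (algebraMap k A (c i a - d)⁻¹) h1
    rwa [← Algebra.smul_def, smul_smul, inv_mul_cancel₀ (sub_ne_zero.2 hne'), one_smul] at h2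
  have hmulc : ∀ i a b, c i (a * b) = c i a * c i b := by
    intro i a b
    refine uniq _ _ _ ?_
    -- Insert `1 = ∑ l, e l` between `a` and `b`: the terms with `l ≠ i` lie in `J` by `off`.
    have h1 : e i * (a * b) * e i - (e i * a * e i) * (e i * b * e i) ∈ J := by
      have h3 : e i * (a * b) * e i = ∑ l, e i * a * e l * (e l * b * e i) := by
        calc e i * (a * b) * e i = e i * a * 1 * (b * e i) := by simp only [mul_assoc, one_mul]
          _ = ∑ l, e i * a * e l * (b * e i) := by
            rw [← he.complete, Finset.mul_sum, Finset.sum_mul]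
          _ = _ := by
            refine Finset.sum_congr rfl fun l _ => ?_
            conv_lhs => rw [← (he.idem l).eq]
            simp only [mul_assoc]
      rw [h3, ← Finset.add_sum_erase _ _ (Finset.mem_univ i), add_sub_cancel_left]
      refine J.sum_mem fun l hl => J.mul_mem_right _ ?_
      refine off i l (Finset.ne_of_mem_erase hl).symm _ ?_ ?_
      · simp only [← mul_assoc, (he.idem i).eq]
      · rw [mul_assoc, (he.idem l).eq]
    have h2 : (e i * a * e i) * (e i * b * e i) - (c i a * c i b) • e i ∈ J := by
      have : (e i * a * e i) * (e i * b * e i) - (c i a * c i b) • e i =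
          (e i * a * e i - c i a • e i) * (e i * b * e i) +
            (c i a • e i) * (e i * b * e i - c i b • e i) := by
        rw [sub_mul, mul_sub, smul_mul_smul_comm, (he.idem i).eq]
        abel
      rw [this]
      exact J.add_mem (J.mul_mem_right _ (hc i a)) (J.mul_mem_left _ (hc i b))
    have := J.add_mem h1 h2
    rwa [sub_add_sub_cancel] at this
  have halg : ∀ i r, c i (algebraMap k A r) = r := by
    intro i r
    refine uniq _ _ _ ?_
    rw [← Algebra.commutes, mul_assoc, (he.idem i).eq, Algebra.smul_def, sub_self]
    exact J.zero_mem
  have haddc : ∀ i a b, c i (a + b) = c i a + c i b := by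
    intro i a b
    refine uniq _ _ _ ?_
    have := J.add_mem (hc i a) (hc i b)
    rwa [sub_add_sub_comm, ← add_mul, ← mul_add, ← add_smul] at this
  let χ : ι → A →ₐ[k] k := fun i =>
    { toFun := c i
      map_one' := by simpa using halg i 1
      map_mul' := hmulc i
      map_zero' := by simpa using halg i 0
      map_add' := haddc i
      commutes' := halg i }
  refine ⟨⟨χ, fun i => ?_, fun i j hij => ?_, n, ?_⟩⟩
  · refine uniq _ _ _ ?_
    rw [(he.idem i).eq, (he.idem i).eq, one_smul, sub_self]
    exact J.zero_mem
  · refine uniq _ _ _ ?_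
    rw [he.ortho hij, zero_mul, zero_smul, sub_self]
    exact J.zero_mem
  · have hle : (⨅ i, RingHom.ker (χ i) : Ideal A) ≤ J := by
      intro a ha
      rw [Ideal.mem_iInf] at ha
      have h0 : ∀ i, e i * a * e i ∈ J := fun i => by
        have h1 : c i a = 0 := ha i
        have := hc i a
        rwa [h1, zero_smul, sub_zero] at this
      have h3 : a = ∑ i, ∑ j, e i * a * e j := by
        simp_rw [← Finset.mul_sum, ← Finset.sum_mul, he.complete, mul_one, one_mul]
      rw [h3]
      refine J.sum_mem fun i _ => J.sum_mem fun j _ => ?_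
      by_cases hij : i = j
      · exact hij ▸ h0 i
      · refine off i j hij _ ?_ ?_
        · simp only [← mul_assoc, (he.idem i).eq]
        · rw [mul_assoc, (he.idem j).eq]
    exact le_bot_iff.1 ((Ideal.pow_right_mono hle n).trans hn.le)

/-- The property of being split passes to any other complete family of orthogonal idempotents with
scalar residues. -/
theorem SplitFamily.transfer (χ : SplitFamily k e) {κ : Type*} [Fintype κ] {f : κ → A}
    (hf : CompleteOrthogonalIdempotents f) (hne : ∀ i, f i ≠ 0)
    (hres : ∀ i, HasScalarResidue k (f i)) : Nonempty (SplitFamily k f) := by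
  have h01 : ∀ i x, χ.char i (f x) ≠ 0 → χ.char i (f x) = 1 := by
    intro i x h
    have := congrArg (χ.char i) (hf.idem x).eq
    rw [map_mul] at this
    exact mul_right_cancel₀ h (this.trans (one_mul _).symm)
  have ex : ∀ x, ∃ i, χ.char i (f x) = 1 := by
    intro x
    by_contra! h
    have hmem : f x ∈ χ.rad := χ.mem_rad.2 fun i => by
      by_contra h0
      exact h i (h01 i x h0)
    obtain ⟨m, hm⟩ := χ.isNilpotent_of_mem_rad hmem
    refine hne x ?_
    rcases Nat.eq_zero_or_pos m with rfl | hpos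
    · rw [pow_zero] at hm
      rw [← mul_one (f x), hm, mul_zero]
    · rwa [(hf.idem x).pow_eq (Nat.pos_iff_ne_zero.1 hpos)] at hm
  have uniq : ∀ x i j, χ.char i (f x) = 1 → χ.char j (f x) = 1 → i = j := by
    intro x i j hi hj
    by_contra hij
    -- This element has value `1` under `χ.char i` and `0` under `χ.char j`, while its scalar
    -- residue would have to equal both.
    obtain ⟨c, hc⟩ := hres x (f x * e i * f x) (by simp only [← mul_assoc, (hf.idem x).eq])
      (by rw [mul_assoc, (hf.idem x).eq])
    have h1 := (hc.map (χ.char i)).eq_zero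
    have h2 := (hc.map (χ.char j)).eq_zero
    simp only [map_sub, map_mul, map_smul, hi, hj, χ.char_self, χ.char_of_ne j i (Ne.symm hij),
      smul_eq_mul, mul_one, mul_zero, zero_sub, neg_eq_zero] at h1 h2
    rw [h2, sub_zero] at h1
    exact one_ne_zero h1
  have orth : ∀ i x y, x ≠ y → χ.char i (f x) = 1 → χ.char i (f y) = 0 := by
    intro i x y hxy hx
    have := congrArg (χ.char i) (hf.ortho hxy)
    rwa [map_mul, hx, one_mul, map_zero] at this
  choose σ hσ using ex
  refine ⟨⟨fun x => χ.char (σ x), hσ, fun x y hxy => orth _ _ _ hxy (hσ x), ?_⟩⟩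
  -- Every character of `χ` is nonzero on some `f x`, by completeness, hence occurs among the
  -- `χ.char (σ x)`.
  have hle : (⨅ x, RingHom.ker (χ.char (σ x)) : Ideal A) ≤ χ.rad := by
    intro a ha
    rw [Ideal.mem_iInf] at ha
    rw [χ.mem_rad]
    intro i
    obtain ⟨x, hx⟩ : ∃ x, χ.char i (f x) ≠ 0 := by
      by_contra! h
      have := congrArg (χ.char i) hf.complete
      rw [map_sum, Finset.sum_eq_zero fun x _ => h x, map_one] at this
      exact zero_ne_one this
    rw [uniq x i (σ x) (h01 i x hx) (hσ x)]
    exact ha x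
  obtain ⟨n, hn⟩ := χ.exists_rad_pow_eq_bot
  exact ⟨n, le_bot_iff.1 ((Ideal.pow_right_mono hle n).trans hn.le)⟩

end SplitFamilies

/-- A complete family of primitive orthogonal idempotents of a basic algebra is split. -/
theorem IsBasicAlg.exists_splitFamily {k : Type u} [Field k] [IsAlgClosed k] {A : Type u} [Ring A]
    [Algebra k A] [FiniteDimensional k A] (hbasic : IsBasicAlg A) {ι : Type*} [Fintype ι]
    {e : ι → A} (he : CompleteOrthogonalIdempotents e) (hprim : ∀ i, IsPrimitiveIdempotent (e i)) :
    Nonempty (SplitFamily k e) := by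
  classical
  obtain ⟨n, P, hP, hind, hiso⟩ := hbasic
  let _ : DirectSum.Decomposition P := hP.chooseDecomposition
  have hf := DirectSum.completeOrthogonalIdempotents_idempotent P
  set f := DirectSum.idempotent P with hfdef
  have hfP : ∀ i, f i ∈ P i := fun i => SetLike.coe_mem _
  have hPf : ∀ i, ∀ p ∈ P i, p * f i = p := by
    intro i p hp
    rw [← DirectSum.decompose_eq_mul_idempotent, DirectSum.decompose_of_mem_same P hp]
  have hPf' : ∀ i a, a * f i = a → a ∈ P i := fun i a h => h ▸ (P i).smul_mem a (hfP i)
  obtain ⟨χ⟩ := _root_.exists_splitFamily (k := k) hf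
    (fun i h0 => by
      obtain ⟨x, hx⟩ := @exists_ne _ (hind i).1 (0 : P i)
      refine hx (Subtype.ext ?_)
      rw [← hPf i x.1 x.2, h0, mul_zero]
      rfl)
    (fun i => hasScalarResidue_of_isIndecomposable (P i) (hfP i) (hPf i) (hind i))
    -- Equivalent idempotents generate isomorphic left ideals, by right multiplication with `x` and
    -- `y`.
    (fun i j hij x y h1 h2 h3 h4 h5 h6 => (hiso i j hij).false
      { toFun := fun p => ⟨p.1 * x, hPf' j _ (by rw [mul_assoc, h2])⟩
        map_add' := fun p q => Subtype.ext (add_mul _ _ _)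
        map_smul' := fun r p => Subtype.ext (mul_assoc _ _ _)
        invFun := fun p => ⟨p.1 * y, hPf' i _ (by rw [mul_assoc, h4])⟩
        left_inv := fun p => Subtype.ext (by
          change p.1 * x * y = p.1
          rw [mul_assoc, h5, hPf i p.1 p.2])
        right_inv := fun p => Subtype.ext (by
          change p.1 * y * x = p.1
          rw [mul_assoc, h6, hPf j p.1 p.2]) })
  exact χ.transfer he (fun i => (hprim i).2.1) fun i => (hprim i).hasScalarResidue

/-! ### Gradings by groups -/

section Gradings

/-- `D` is a grading of the `k`-algebra `A` by the group `G`. -/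
structure IsGroupGrading {k : Type*} [Field k] {A : Type*} [Ring A] [Algebra k A] {G : Type*}
    [Group G] (D : G → Submodule k A) : Prop where
  mul_mem : ∀ {g h : G} {a b : A}, a ∈ D g → b ∈ D h → a * b ∈ D (g * h)
  iSup_eq_top : ⨆ g, D g = ⊤
  indep : iSupIndep D

/-- There is a nonzero element of degree `q.2 * p.2⁻¹` in `e q.1 * A * e p.1`. -/
def GradingAdj {k : Type*} [Field k] {A : Type*} [Ring A] [Algebra k A] {G : Type*} [Group G]
    {ι : Type*} (e : ι → A) (D : G → Submodule k A) (p q : ι × G) : Prop :=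
  ∃ a ∈ D (q.2 * p.2⁻¹), e q.1 * a = a ∧ a * e p.1 = a ∧ a ≠ 0

/-- A grading of `A`, with homogeneous idempotents `e i`, which defines a connected locally bounded
Galois covering of `A`. -/
structure IsCoveringGrading {k : Type*} [Field k] {A : Type*} [Ring A] [Algebra k A] {G : Type*}
    [Group G] {ι : Type*} {e : ι → A} (χ : SplitFamily k e) (D : G → Submodule k A) : Prop
    extends IsGroupGrading D where
  idem_mem : ∀ i, e i ∈ D 1
  mem_rad : ∀ {g : G}, g ≠ 1 → ∀ {a : A}, a ∈ D g → a ∈ χ.rad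
  connected : ∀ p q : ι × G,
    Relation.ReflTransGen (fun p q => GradingAdj e D p q ∨ GradingAdj e D q p) p q

variable {k : Type*} [Field k] {A : Type*} [Ring A] [Algebra k A] {G : Type*} [Group G]
  {D : G → Submodule k A}

namespace IsGroupGrading

theorem exists_sum (hD : IsGroupGrading D) (a : A) :
    ∃ c : G →₀ A, (∀ g, c g ∈ D g) ∧ ∑ g ∈ c.support, c g = a :=
  (Submodule.mem_iSup_iff_exists_finsupp D a).1 (hD.iSup_eq_top ▸ Submodule.mem_top)

/-- Independence of the components, reindexed so that it applies to sums over the objects of a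
fibre, on which the degree is injective. -/
theorem eq_zero_of_sum (hD : IsGroupGrading D) {κ : Type*} {t : κ → G}
    (ht : Function.Injective t) (s : Finset κ) (c : κ → A) (hc : ∀ z ∈ s, c z ∈ D (t z))
    (h : ∑ z ∈ s, c z = 0) : ∀ z ∈ s, c z = 0 := by
  classical
  have key := (iSupIndep_iff_finsetSum_eq_zero_imp_eq_zero D).1 hD.indep (s.map ⟨t, ht⟩)
    (Function.extend t c 0) (by simpa [ht.extend_apply] using hc)
    (by simpa [ht.extend_apply] using h)
  simpa [ht.extend_apply] using key

theorem eq_zero_of_sum_injOn (hD : IsGroupGrading D) {κ : Type*} {t : κ → G} (s : Finset κ)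
    (ht : Set.InjOn t s) (c : κ → A) (hc : ∀ z ∈ s, c z ∈ D (t z))
    (h : ∑ z ∈ s, c z = 0) : ∀ z ∈ s, c z = 0 := fun z hz =>
  hD.eq_zero_of_sum (t := fun z : s => t z) ht.injective Finset.univ (fun z => c z)
    (fun z _ => hc z z.2) (by rwa [Finset.sum_coe_sort s c]) ⟨z, hz⟩ (Finset.mem_univ _)

/-- If two finite sums of homogeneous elements are equal, the second one being homogeneous of
degree `h`, then it is the component of degree `h` of the first. -/
theorem eq_of_sum_eq (hD : IsGroupGrading D) {κ : Type*} {t : κ → G}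
    (ht : Function.Injective t) (s : Finset κ) (c : κ → A) (hc : ∀ z ∈ s, c z ∈ D (t z))
    {x : A} {h : G} (hx : x ∈ D h) (hsum : ∑ z ∈ s, c z = x) (hx0 : x ≠ 0) :
    ∃ z ∈ s, t z = h ∧ c z = x := by
  classical
  have hz : ∃ z ∈ s, t z = h := by
    by_contra! hne
    refine hx0 ((Submodule.disjoint_def.1 (hD.indep h)) x hx ?_)
    rw [← hsum]
    refine Submodule.sum_mem _ fun z hz => ?_
    exact (le_iSup₂_of_le (f := fun g (_ : g ≠ h) => D g) (t z) (hne z hz) le_rfl) (hc z hz)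
  obtain ⟨z, hz, rfl⟩ := hz
  refine ⟨z, hz, rfl, ?_⟩
  -- Subtracting `x` from the term of its own degree gives a sum of homogeneous elements which is
  -- zero.
  have := hD.eq_zero_of_sum ht s (fun y => if y = z then c z - x else c y)
    (fun y hy => by
      split_ifs with hyz
      · exact hyz ▸ (D (t z)).sub_mem (hc z hz) hx
      · exact hc y hy)
    (by
      rw [← Finset.add_sum_erase _ _ hz, if_pos rfl, Finset.sum_congr rfl
        fun y hy => if_neg (Finset.ne_of_mem_erase hy), sub_add_eq_add_sub,
        Finset.add_sum_erase _ _ hz, hsum, sub_self]) z hz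
  rwa [if_pos rfl, sub_eq_zero] at this

/-- The inverse, in the corner at the idempotent `e`, of an element of degree `g` has degree
`g⁻¹`. -/
theorem inverse_mem (hD : IsGroupGrading D) {e f b : A} (he : e ∈ D 1) (he0 : e ≠ 0) {g : G}
    (hf : f ∈ D g) (h1 : f * b = e) (h2 : b * f = e) (h3 : b * e = b) : b ∈ D g⁻¹ := by
  obtain ⟨c, hc, hsum⟩ := hD.exists_sum b
  -- Since `f * b = e` has degree `1`, a single component `c t` of `b`, with `g * t = 1`, satisfies
  -- `f * c t = e`; then `b = b * f * c t = e * c t`.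
  obtain ⟨t, -, ht, hft⟩ := hD.eq_of_sum_eq (mul_right_injective g) c.support
    (fun t => f * c t) (fun t _ => hD.mul_mem hf (hc t)) he
    (by rw [← Finset.mul_sum, hsum, h1]) he0
  have hct : c t ∈ D g⁻¹ := eq_inv_of_mul_eq_one_right ht ▸ hc t
  have : e * c t = b := by rw [← h2, mul_assoc, hft, h3]
  rw [← this, ← one_mul g⁻¹]
  exact hD.mul_mem he hct

end IsGroupGrading

end Gradings

/-! ### Functors to the category of a family of idempotents -/

section IdemCatFunctors

variable {k : Type u} [Field k] {A : Type u} [Ring A] [Algebra k A] {ι : Type u} [Fintype ι]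
  {e : ι → A} {he : CompleteOrthogonalIdempotents e}

theorem mem_cornerSpace_iff (he : CompleteOrthogonalIdempotents e) {i j : ι} {x : A} :
    x ∈ cornerSpace k (e i) (e j) ↔ e j * x = x ∧ x * e i = x := by
  rw [mem_cornerSpace]
  constructor
  · rintro ⟨y, rfl⟩
    constructor
    · rw [← mul_assoc, (he.idem j).eq]
    · rw [mul_assoc, mul_assoc, (he.idem i).eq]
  · rintro ⟨h1, h2⟩
    exact ⟨x, by rw [h2, h1]⟩

namespace IdemCat

/-- The inclusion of a space of morphisms into the algebra. -/
def val (X Y : IdemCat k he) : (X ⟶ Y) →ₗ[k] A := (cornerSpace k (e X) (e Y)).subtype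

theorem val_injective (X Y : IdemCat k he) : Function.Injective (val X Y) :=
  Subtype.val_injective

theorem val_comp {X Y Z : IdemCat k he} (f : X ⟶ Y) (g : Y ⟶ Z) :
    val X Z (f ≫ g) = val Y Z g * val X Y f := rfl

theorem val_id (X : IdemCat k he) : val X X (𝟙 X) = e X := rfl

theorem val_comp_eqToHom {X Y Z : IdemCat k he} (f : X ⟶ Y) (h : Y = Z) :
    val X Z (f ≫ eqToHom h) = val X Y f := by
  subst h; simp

theorem val_eqToHom_comp {X Y Z : IdemCat k he} (h : X = Y) (f : Y ⟶ Z) :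
    val X Z (eqToHom h ≫ f) = val Y Z f := by
  subst h; simp

theorem idem_mul_val {X Y : IdemCat k he} (f : X ⟶ Y) : e Y * val X Y f = val X Y f :=
  ((mem_cornerSpace_iff (k := k) he).1 f.2).1

theorem val_mul_idem {X Y : IdemCat k he} (f : X ⟶ Y) : val X Y f * e X = val X Y f :=
  ((mem_cornerSpace_iff (k := k) he).1 f.2).2

/-- The morphism given by an element of a corner. -/
def homOf {X Y : IdemCat k he} (a : A) (h1 : e Y * a = a) (h2 : a * e X = a) : X ⟶ Y :=
  ⟨a, (mem_cornerSpace_iff (k := k) he).2 ⟨h1, h2⟩⟩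

theorem val_homOf {X Y : IdemCat k he} (a : A) (h1 : e Y * a = a) (h2 : a * e X = a) :
    val X Y (homOf a h1 h2) = a := rfl

end IdemCat

variable {E : Type v} [Category.{w} E] [Preadditive E] [Linear k E]
  (F : E ⥤ IdemCat k he) [F.Additive] [F.Linear k]

/-- Read inside `A`, the transport along `F y' = y` disappears, and the covering maps become mere
sums of elements of `A`. -/
theorem val_coveringMapSource_of (x' : E) (y : IdemCat k he)
    [DecidableEq {y' : E // F.obj y' = y}] (y' : {y' : E // F.obj y' = y}) (f : x' ⟶ y'.1) :
    IdemCat.val _ _ (coveringMapSource k F x' y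
      (DirectSum.of (fun y' : {y' : E // F.obj y' = y} => (x' ⟶ y'.1)) y' f)) =
      IdemCat.val _ _ (F.map f) := by
  classical
  rw [coveringMapSource]
  erw [DirectSum.toModule_lof]
  exact IdemCat.val_comp_eqToHom _ _

theorem val_coveringMapTarget_of (x : IdemCat k he) (y' : E)
    [DecidableEq {x' : E // F.obj x' = x}] (x' : {x' : E // F.obj x' = x}) (f : x'.1 ⟶ y') :
    IdemCat.val _ _ (coveringMapTarget k F x y'
      (DirectSum.of (fun x' : {x' : E // F.obj x' = x} => (x'.1 ⟶ y')) x' f)) =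
      IdemCat.val _ _ (F.map f) := by
  classical
  rw [coveringMapTarget]
  erw [DirectSum.toModule_lof]
  exact IdemCat.val_eqToHom_comp _ _

open Classical in
theorem val_coveringMapSource (x' : E) (y : IdemCat k he)
    (d : ⨁ y' : {y' : E // F.obj y' = y}, (x' ⟶ y'.1)) :
    IdemCat.val _ _ (coveringMapSource k F x' y d) =
      ∑ y' ∈ DFinsupp.support d, IdemCat.val _ _ (F.map (d y')) := by
  conv_lhs => rw [← DirectSum.sum_support_of d]
  rw [map_sum, map_sum]
  exact Finset.sum_congr rfl fun y' _ => val_coveringMapSource_of F x' y y' (d y')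

open Classical in
theorem val_coveringMapTarget (x : IdemCat k he) (y' : E)
    (d : ⨁ x' : {x' : E // F.obj x' = x}, (x'.1 ⟶ y')) :
    IdemCat.val _ _ (coveringMapTarget k F x y' d) =
      ∑ x' ∈ DFinsupp.support d, IdemCat.val _ _ (F.map (d x')) := by
  conv_lhs => rw [← DirectSum.sum_support_of d]
  rw [map_sum, map_sum]
  exact Finset.sum_congr rfl fun x' _ => val_coveringMapTarget_of F x y' x' (d x')

end IdemCatFunctors

/-! ### The covering attached to a grading -/

section SmashCategory

variable {k : Type u} [Field k] {A : Type u} [Ring A] [Algebra k A] {ι : Type u} [Fintype ι]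
  {e : ι → A} {χ : SplitFamily k e} {G : Type u} [Group G] {D : G → Submodule k A}

/-- The objects of the covering of `A` attached to a grading by `G` are the pairs formed of an
idempotent `e i` and an element of `G`. -/
@[nolint unusedArguments]
def SmashCat (_ : CompleteOrthogonalIdempotents e) (_ : IsCoveringGrading χ D) : Type u := ι × G

variable (he : CompleteOrthogonalIdempotents e) (hD : IsCoveringGrading χ D)

namespace SmashCat

/-- The space of morphisms `(i, g) → (j, h)` is the part of degree `h * g⁻¹` of
`e j * A * e i`. -/
def homSpace (k : Type u) [Field k] {A : Type u} [Ring A] [Algebra k A] {ι : Type u} (e : ι → A)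
    {G : Type u} [Group G] (D : G → Submodule k A) (p q : ι × G) : Submodule k A :=
  cornerSpace k (e p.1) (e q.1) ⊓ D (q.2 * p.2⁻¹)

variable {he hD} in
theorem mem_homSpace (he : CompleteOrthogonalIdempotents e) {p q : ι × G} {a : A} :
    a ∈ homSpace k e D p q ↔ (e q.1 * a = a ∧ a * e p.1 = a) ∧ a ∈ D (q.2 * p.2⁻¹) := by
  rw [homSpace, Submodule.mem_inf, mem_cornerSpace_iff he]

instance category : Category.{u} (SmashCat he hD) where
  Hom p q := homSpace k e D p q
  id p := ⟨e p.1, (mem_homSpace he).2 ⟨⟨(he.idem _).eq, (he.idem _).eq⟩, by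
    rw [mul_inv_cancel]; exact hD.idem_mem _⟩⟩
  comp {p q r} f g := ⟨g.1 * f.1, by
    obtain ⟨⟨hf1, hf2⟩, hf3⟩ := (mem_homSpace he).1 f.2
    obtain ⟨⟨hg1, hg2⟩, hg3⟩ := (mem_homSpace he).1 g.2
    refine (mem_homSpace he).2 ⟨⟨by rw [← mul_assoc, hg1], by rw [mul_assoc, hf2]⟩, ?_⟩
    have := hD.mul_mem hg3 hf3
    rwa [← mul_assoc, inv_mul_cancel_right] at this⟩
  id_comp {p q} f := Subtype.ext ((mem_homSpace he).1 f.2).1.2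
  comp_id {p q} f := Subtype.ext ((mem_homSpace he).1 f.2).1.1
  assoc f g h := Subtype.ext (mul_assoc h.1 g.1 f.1).symm

instance preadditive : Preadditive (SmashCat he hD) where
  homGroup p q := inferInstanceAs (AddCommGroup (homSpace k e D p q))
  add_comp _ _ _ f f' g := Subtype.ext (mul_add g.1 f.1 f'.1)
  comp_add _ _ _ f g g' := Subtype.ext (add_mul g.1 g'.1 f.1)

instance linear : Linear k (SmashCat he hD) where
  homModule p q := inferInstanceAs (Module k (homSpace k e D p q))
  smul_comp _ _ _ r f g := Subtype.ext (mul_smul_comm r g.1 f.1)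
  comp_smul _ _ _ f r g := Subtype.ext (smul_mul_assoc r g.1 f.1)

variable {he hD}

/-- The inclusion of a space of morphisms into the algebra. -/
def val (p q : SmashCat he hD) : (p ⟶ q) →ₗ[k] A := (homSpace k e D p q).subtype

theorem val_injective (p q : SmashCat he hD) : Function.Injective (val p q) :=
  Subtype.val_injective

theorem val_comp {p q r : SmashCat he hD} (f : p ⟶ q) (g : q ⟶ r) :
    val p r (f ≫ g) = val q r g * val p q f := rfl

theorem val_id (p : SmashCat he hD) : val p p (𝟙 p) = e p.1 := rfl

theorem val_comp_eqToHom {p q r : SmashCat he hD} (f : p ⟶ q) (h : q = r) :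
    val p r (f ≫ eqToHom h) = val p q f := by
  subst h; simp

theorem val_eqToHom_comp {p q r : SmashCat he hD} (h : p = q) (f : q ⟶ r) :
    val p r (eqToHom h ≫ f) = val q r f := by
  subst h; simp

theorem idem_mul_val {p q : SmashCat he hD} (f : p ⟶ q) : e q.1 * val p q f = val p q f :=
  ((mem_homSpace he).1 f.2).1.1

theorem val_mul_idem {p q : SmashCat he hD} (f : p ⟶ q) : val p q f * e p.1 = val p q f :=
  ((mem_homSpace he).1 f.2).1.2

theorem val_mem {p q : SmashCat he hD} (f : p ⟶ q) : val p q f ∈ D (q.2 * p.2⁻¹) :=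
  ((mem_homSpace he).1 f.2).2

/-- The morphism given by a homogeneous element. -/
def homOf {p q : SmashCat he hD} (a : A) (h1 : e q.1 * a = a) (h2 : a * e p.1 = a)
    (h3 : a ∈ D (q.2 * p.2⁻¹)) : p ⟶ q :=
  ⟨a, (mem_homSpace he).2 ⟨⟨h1, h2⟩, h3⟩⟩

variable (he hD) in
/-- The projection of the covering to `A`. -/
def proj : SmashCat he hD ⥤ IdemCat k he where
  obj p := p.1
  map {p q} f := IdemCat.homOf (val p q f) (idem_mul_val f) (val_mul_idem f)

instance : (proj he hD).Additive where

instance : (proj he hD).Linear k where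

variable (he hD) in
/-- The element `t` of `G` maps `(i, g)` to `(i, g * t⁻¹)`. -/
def translate (t : G) : SmashCat he hD ⥤ SmashCat he hD where
  obj p := (p.1, p.2 * t⁻¹)
  map {p q} f := homOf (val p q f) (idem_mul_val f) (val_mul_idem f) (by
    rw [mul_inv_rev, inv_inv, mul_assoc, inv_mul_cancel_left]
    exact val_mem f)

theorem functor_ext {F F' : SmashCat he hD ⥤ SmashCat he hD} (hobj : ∀ p, F.obj p = F'.obj p)
    (hmap : ∀ p q (f : p ⟶ q), val _ _ (F.map f) = val _ _ (F'.map f)) : F = F' := by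
  refine CategoryTheory.Functor.ext hobj fun p q f => val_injective _ _ ?_
  rw [val_eqToHom_comp, val_comp_eqToHom, hmap]

variable (he hD) in
/-- The action of `G` on the covering. -/
def action : LinearCatAction k G (SmashCat he hD) where
  toFunctor := translate he hD
  additive t := { }
  linear t := { }
  map_one := functor_ext (fun p => Prod.ext rfl (by
      change p.2 * 1⁻¹ = p.2
      rw [inv_one, mul_one]))
    fun p q f => rfl
  map_mul s t := functor_ext (fun p => Prod.ext rfl (by
      change p.2 * (s * t)⁻¹ = p.2 * t⁻¹ * s⁻¹
      rw [mul_inv_rev, mul_assoc]))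
    fun p q f => rfl

/-- Each fibre is a copy of `G` on which the degree takes every value once. The two bijections thus
express that a corner of `A` is the direct sum of its homogeneous parts. -/
theorem isCoveringFunctor_proj : IsCoveringFunctor k (proj he hD) where
  surjective i := ⟨((i : ι), (1 : G)), rfl⟩
  bijective_source p j := by
    classical
    constructor
    · rw [injective_iff_map_eq_zero]
      intro d hd
      have h := val_coveringMapSource (proj he hD) p j d
      rw [hd, map_zero] at h
      have hz := hD.eq_zero_of_sum
        (t := fun z : {q : SmashCat he hD // (proj he hD).obj q = j} => z.1.2 * p.2⁻¹)
        (fun z z' hzz => Subtype.ext (Prod.ext (z.2.trans z'.2.symm) (mul_right_cancel hzz)))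
        (DFinsupp.support d) (fun z => val _ _ (d z)) (fun z _ => val_mem _) h.symm
      refine DFinsupp.ext fun z => ?_
      by_contra hne
      exact hne (val_injective _ _ (hz z (DFinsupp.mem_support_iff.2 hne)))
    · intro b
      obtain ⟨c, hc, hsum⟩ := hD.exists_sum (IdemCat.val _ _ b)
      refine ⟨∑ g ∈ c.support, DirectSum.of
        (fun q : {q : SmashCat he hD // (proj he hD).obj q = j} => (p ⟶ q.1))
        -- The object over `j` for which morphisms from `p` have degree `g`; truncation by
        -- idempotents of degree `1` preserves the degree.
        ⟨((j : ι), g * p.2), rfl⟩ (homOf (e j * c g * e p.1)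
          (by simp only [← mul_assoc]; rw [(he.idem j).eq]) (by rw [mul_assoc, (he.idem _).eq])
          (by
            rw [mul_inv_cancel_right]
            simpa using hD.mul_mem (hD.mul_mem (hD.idem_mem j) (hc g)) (hD.idem_mem p.1))),
        IdemCat.val_injective _ _ ?_⟩
      rw [map_sum, map_sum]
      refine (Finset.sum_congr rfl fun g _ => val_coveringMapSource_of _ _ _ _ _).trans ?_
      change ∑ g ∈ c.support, e j * c g * e p.1 = _
      rw [← Finset.sum_mul, ← Finset.mul_sum, hsum, IdemCat.idem_mul_val b]
      exact IdemCat.val_mul_idem b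
  bijective_target i q := by
    classical
    constructor
    · rw [injective_iff_map_eq_zero]
      intro d hd
      have h := val_coveringMapTarget (proj he hD) i q d
      rw [hd, map_zero] at h
      have hz := hD.eq_zero_of_sum
        (t := fun z : {p : SmashCat he hD // (proj he hD).obj p = i} => q.2 * z.1.2⁻¹)
        (fun z z' hzz => Subtype.ext (Prod.ext (z.2.trans z'.2.symm)
          (inv_injective (mul_left_cancel hzz))))
        (DFinsupp.support d) (fun z => val _ _ (d z)) (fun z _ => val_mem _) h.symm
      refine DFinsupp.ext fun z => ?_
      by_contra hne
      exact hne (val_injective _ _ (hz z (DFinsupp.mem_support_iff.2 hne)))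
    · intro b
      obtain ⟨c, hc, hsum⟩ := hD.exists_sum (IdemCat.val _ _ b)
      refine ⟨∑ g ∈ c.support, DirectSum.of
        (fun p : {p : SmashCat he hD // (proj he hD).obj p = i} => (p.1 ⟶ q))
        -- The object over `i` for which morphisms to `q` have degree `g`.
        ⟨((i : ι), g⁻¹ * q.2), rfl⟩ (homOf (e q.1 * c g * e i)
          (by simp only [← mul_assoc]; rw [(he.idem _).eq])
          ((mul_assoc _ _ _).trans (congrArg (e q.1 * c g * ·) (he.idem i).eq))
          (by
            rw [mul_inv_rev, inv_inv, mul_inv_cancel_left]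
            simpa using hD.mul_mem (hD.mul_mem (hD.idem_mem q.1) (hc g)) (hD.idem_mem i))),
        IdemCat.val_injective _ _ ?_⟩
      rw [map_sum, map_sum]
      refine (Finset.sum_congr rfl fun g _ => val_coveringMapTarget_of _ _ _ _ _).trans ?_
      change ∑ g ∈ c.support, e q.1 * c g * e i = _
      rw [← Finset.sum_mul, ← Finset.mul_sum, hsum]
      exact (congrArg (· * e i) (IdemCat.idem_mul_val b)).trans (IdemCat.val_mul_idem b)

theorem isGaloisCovering_proj : IsGaloisCovering k G (proj he hD) := by
  refine ⟨isCoveringFunctor_proj, action he hD, fun t p h => ?_, fun t => rfl, fun p q h => ?_⟩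
  · have : p.2 * t⁻¹ = p.2 := congrArg Prod.snd h
    simpa using this
  · refine ⟨q.2⁻¹ * p.2, Prod.ext h ?_⟩
    change p.2 * (q.2⁻¹ * p.2)⁻¹ = q.2
    rw [mul_inv_rev, inv_inv, mul_inv_cancel_left]

theorem isConnectedLinCat [Nonempty ι] : IsConnectedLinCat (SmashCat he hD) := by
  refine ⟨⟨(Classical.arbitrary ι, (1 : G))⟩, fun p q => ?_⟩
  have key : ∀ p q : SmashCat he hD, GradingAdj e D p q → ∃ f : p ⟶ q, f ≠ 0 := by
    rintro p q ⟨a, ha, h1, h2, h0⟩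
    exact ⟨homOf a h1 h2 ha, fun h => h0 (congrArg (val p q) h)⟩
  induction hD.connected p q with
  | refl => exact .refl
  | tail _ h ih => exact ih.tail (h.imp (key _ _) (key _ _))

/-- The inverse in the corner of an element of degree `1` again has degree `1`, hence is a morphism
of the covering. -/
theorem isUnit_of_inverse {p : SmashCat he hD} (f : End p) {b : A}
    (h1 : e p.1 * b = b) (h2 : b * e p.1 = b) (h3 : val p p f * b = e p.1)
    (h4 : b * val p p f = e p.1) : IsUnit f := by
  have hf := val_mem (show p ⟶ p from f)
  have hb : b ∈ D (p.2 * p.2⁻¹) := by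
    have := hD.inverse_mem (hD.idem_mem _)
      (fun h => χ.idem_notMem_rad p.1 (h ▸ χ.rad.zero_mem)) hf h3 h4 h2
    rwa [mul_inv_rev, inv_inv] at this
  refine ⟨⟨f, (homOf b h1 h2 hb : p ⟶ p), ?_, ?_⟩, rfl⟩
  · exact val_injective _ _ h3
  · exact val_injective _ _ h4

/-- An isomorphism is not in the radical, whereas elements of off-diagonal corners and elements of
degree other than `1` are; this separates the objects. The character at `p.1` detects the units of
`End p`, and the sums of morphism spaces embed in `A`. -/
theorem isLocallyBounded [FiniteDimensional k A] : IsLocallyBounded k (SmashCat he hD) where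
  eq_of_iso := by
    rintro p q ⟨f⟩
    have h : val q q (f.inv ≫ f.hom) = e q.1 := by rw [f.inv_hom_id, val_id]
    rw [val_comp] at h
    have hnot : val p q f.hom ∉ χ.rad := fun hmem =>
      χ.idem_notMem_rad q.1 (h ▸ χ.rad.mul_mem_right _ hmem)
    refine Prod.ext ?_ ?_
    · by_contra hne
      exact hnot (χ.corner_mem_rad hne (idem_mul_val _) (val_mul_idem _))
    · by_contra hne
      exact hnot (hD.mem_rad (fun h1 => hne (mul_inv_eq_one.1 h1).symm) (val_mem _))
  isLocal p := by
    have hne : (1 : End p) ≠ 0 := fun h => by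
      have h0 : e p.1 = 0 := congrArg (val p p) h
      exact χ.idem_notMem_rad p.1 (h0 ▸ χ.rad.zero_mem)
    have : Nontrivial (End p) := ⟨⟨_, _, hne⟩⟩
    have key : ∀ f : End p, χ.char p.1 (val p p f) ≠ 0 → IsUnit f := by
      intro f hf
      obtain ⟨b, h1, h2, h3, h4⟩ := χ.exists_inverse (he.idem p.1)
        (idem_mul_val (show p ⟶ p from f)) (val_mul_idem (show p ⟶ p from f)) hf
      exact isUnit_of_inverse f h1 h2 h3 h4
    refine IsLocalRing.of_isUnit_or_isUnit_one_sub_self fun f => ?_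
    by_cases hf : χ.char p.1 (val p p f) = 0
    · right
      refine key _ ?_
      have : val p p (1 - f : End p) = e p.1 - val p p f := map_sub (val p p) (𝟙 p) f
      rw [this, map_sub, hf, χ.char_self, sub_zero]
      exact one_ne_zero
    · exact Or.inl (key f hf)
  finite_source p := by
    classical
    refine Module.Finite.of_injective (DirectSum.toModule k _ A fun q => val p q) ?_
    rw [injective_iff_map_eq_zero]
    intro d hd
    have h : ∑ q ∈ DFinsupp.support d, val p q (d q) = 0 := by
      rw [← hd]
      conv_rhs => rw [← DirectSum.sum_support_of d, map_sum]
      refine Finset.sum_congr rfl fun q _ => ?_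
      erw [DirectSum.toModule_lof]
    refine DFinsupp.ext fun q => ?_
    by_contra hne
    refine hne (val_injective _ _ ?_)
    refine hD.eq_zero_of_sum_injOn (t := fun z : SmashCat he hD => z.2 * p.2⁻¹)
      ((DFinsupp.support d).filter fun z => z.1 = q.1) ?_ (fun z => val p z (d z))
      (fun z _ => val_mem _) ?_ q
      (Finset.mem_filter.2 ⟨DFinsupp.mem_support_iff.2 hne, rfl⟩)
    · intro z hz z' hz' hzz
      exact Prod.ext ((Finset.mem_filter.1 hz).2.trans (Finset.mem_filter.1 hz').2.symm)
        (mul_right_cancel hzz)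
    -- Multiplication by the idempotent keeps the objects over `q.1`, and among these the degree
    -- determines the object.
    · have h2 := congrArg (e q.1 * ·) h
      simp only [Finset.mul_sum, mul_zero] at h2
      refine (Finset.sum_filter _ _).trans ((Finset.sum_congr rfl fun z _ => ?_).trans h2)
      split_ifs with hz
      · rw [← hz, idem_mul_val]
      · rw [← idem_mul_val (d z), ← mul_assoc, he.ortho (Ne.symm hz), zero_mul]
  finite_target q := by
    classical
    refine Module.Finite.of_injective (DirectSum.toModule k _ A fun p => val p q) ?_
    rw [injective_iff_map_eq_zero]
    intro d hd
    have h : ∑ p ∈ DFinsupp.support d, val p q (d p) = 0 := by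
      rw [← hd]
      conv_rhs => rw [← DirectSum.sum_support_of d, map_sum]
      refine Finset.sum_congr rfl fun p _ => ?_
      erw [DirectSum.toModule_lof]
    refine DFinsupp.ext fun p => ?_
    by_contra hne
    refine hne (val_injective _ _ ?_)
    refine hD.eq_zero_of_sum_injOn (t := fun z : SmashCat he hD => q.2 * z.2⁻¹)
      ((DFinsupp.support d).filter fun z => z.1 = p.1) ?_ (fun z => val z q (d z))
      (fun z _ => val_mem _) ?_ p
      (Finset.mem_filter.2 ⟨DFinsupp.mem_support_iff.2 hne, rfl⟩)
    · intro z hz z' hz' hzz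
      exact Prod.ext ((Finset.mem_filter.1 hz).2.trans (Finset.mem_filter.1 hz').2.symm)
        (inv_injective (mul_left_cancel hzz))
    · have h2 := congrArg (· * e p.1) h
      simp only [Finset.sum_mul, zero_mul] at h2
      refine (Finset.sum_filter _ _).trans ((Finset.sum_congr rfl fun z _ => ?_).trans h2)
      split_ifs with hz
      · rw [← hz, val_mul_idem]
      · rw [← val_mul_idem (d z), mul_assoc, he.ortho hz, mul_zero]

end SmashCat

/-- A covering grading by a nontrivial group defines a proper Galois covering. -/
theorem IsCoveringGrading.hasProperGaloisCovering [FiniteDimensional k A] [Nonempty ι]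
    [Nontrivial G] (he : CompleteOrthogonalIdempotents e) (hD : IsCoveringGrading χ D) :
    HasProperGaloisCovering k (IdemCat k he) := by
  refine ⟨SmashCat he hD, inferInstance, inferInstance, inferInstance, G, inferInstance,
    SmashCat.proj he hD, inferInstance, inferInstance, SmashCat.isConnectedLinCat,
    SmashCat.isLocallyBounded, SmashCat.isGaloisCovering_proj, fun h => ?_⟩
  obtain ⟨g, hg⟩ := exists_ne (1 : G)
  let i : ι := Classical.arbitrary ι
  have h1 : ((i, g) : ι × G) = (i, 1) := h.1.1 (a₁ := (i, g)) (a₂ := (i, 1)) rfl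
  exact hg (congrArg Prod.snd h1)

end SmashCategory

/-! ### The grading attached to a Galois covering -/

section CoveringGrading

variable {k : Type u} [Field k] {A : Type u} [Ring A] [Algebra k A] {ι : Type u} [Fintype ι]
  {e : ι → A} {he : CompleteOrthogonalIdempotents e}
  {C : Type v} [Category.{w} C] [Preadditive C] [Linear k C]

/-- The subspace of `A` formed of the images of the morphisms `x ⟶ y`. -/
def imageSpace (F : C ⥤ IdemCat k he) [F.Additive] [F.Linear k] (x y : C) : Submodule k A :=
  LinearMap.range (IdemCat.val (F.obj x) (F.obj y) ∘ₗ F.mapLinearMap k (X := x) (Y := y))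

theorem mem_imageSpace {F : C ⥤ IdemCat k he} [F.Additive] [F.Linear k] {x y : C} {a : A} :
    a ∈ imageSpace F x y ↔ ∃ f : x ⟶ y, IdemCat.val _ _ (F.map f) = a := Iff.rfl

theorem mul_mem_imageSpace {F : C ⥤ IdemCat k he} [F.Additive] [F.Linear k] {x y z : C} {a b : A}
    (ha : a ∈ imageSpace F y z) (hb : b ∈ imageSpace F x y) : a * b ∈ imageSpace F x z := by
  obtain ⟨f, rfl⟩ := mem_imageSpace.1 ha
  obtain ⟨g, rfl⟩ := mem_imageSpace.1 hb
  exact mem_imageSpace.2 ⟨g ≫ f, by rw [F.map_comp, IdemCat.val_comp]⟩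

theorem idem_mem_imageSpace (F : C ⥤ IdemCat k he) [F.Additive] [F.Linear k] (x : C) :
    e (F.obj x) ∈ imageSpace F x x :=
  mem_imageSpace.2 ⟨𝟙 x, by rw [F.map_id, IdemCat.val_id]⟩

/-- Covering functors are faithful: restrict the injective covering map to one summand. -/
theorem IsCoveringFunctor.val_map_injective {F : C ⥤ IdemCat k he} [F.Additive] [F.Linear k]
    (hF : IsCoveringFunctor k F) {x y : C} {f f' : x ⟶ y}
    (h : IdemCat.val _ _ (F.map f) = IdemCat.val _ _ (F.map f')) : f = f' := by
  classical
  have key := (hF.bijective_source x (F.obj y)).1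
    (a₁ := DirectSum.of (fun y' : {y' : C // F.obj y' = F.obj y} => (x ⟶ y'.1)) ⟨y, rfl⟩ f)
    (a₂ := DirectSum.of (fun y' : {y' : C // F.obj y' = F.obj y} => (x ⟶ y'.1)) ⟨y, rfl⟩ f')
    (IdemCat.val_injective _ _ (by
      rw [val_coveringMapSource_of, val_coveringMapSource_of]
      exact h))
  exact DirectSum.of_injective (β := fun y' : {y' : C // F.obj y' = F.obj y} => (x ⟶ y'.1))
    ⟨y, rfl⟩ key

theorem IsCoveringFunctor.mem_iSup_imageSpace {F : C ⥤ IdemCat k he} [F.Additive] [F.Linear k]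
    (hF : IsCoveringFunctor k F) (x : C) (j : IdemCat k he) {a : A} (h1 : e j * a = a)
    (h2 : a * e (F.obj x) = a) :
    a ∈ ⨆ y' : {y' : C // F.obj y' = j}, imageSpace F x y'.1 := by
  classical
  obtain ⟨d, hd⟩ := (hF.bijective_source x j).2 (IdemCat.homOf a h1 h2)
  have h := val_coveringMapSource F x j d
  rw [hd, IdemCat.val_homOf] at h
  rw [h]
  exact Submodule.sum_mem _ fun y' _ =>
    Submodule.mem_iSup_of_mem y' (mem_imageSpace.2 ⟨_, rfl⟩)

theorem IsCoveringFunctor.eq_zero_of_sum_eq_zero {F : C ⥤ IdemCat k he} [F.Additive] [F.Linear k]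
    (hF : IsCoveringFunctor k F) (x : C) (j : IdemCat k he) {κ : Type*}
    (z : κ → {y' : C // F.obj y' = j}) (hz : Function.Injective z) (T : Finset κ)
    (m : ∀ g, x ⟶ (z g).1) (hsum : ∑ g ∈ T, IdemCat.val _ _ (F.map (m g)) = 0) :
    ∀ g ∈ T, m g = 0 := by
  classical
  intro g hg
  let d : ⨁ y' : {y' : C // F.obj y' = j}, (x ⟶ y'.1) :=
    ∑ g ∈ T, DirectSum.of (fun y' : {y' : C // F.obj y' = j} => (x ⟶ y'.1)) (z g) (m g)
  have hd : d = 0 := by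
    refine (hF.bijective_source x j).1 (IdemCat.val_injective _ _ ?_)
    rw [map_zero, map_zero, map_sum, map_sum]
    exact (Finset.sum_congr rfl fun g _ =>
      val_coveringMapSource_of F x j (z g) (m g)).trans hsum
  have h1 : d (z g) = m g := by
    rw [DFinsupp.finsetSum_apply, Finset.sum_eq_single g]
    · exact DirectSum.of_eq_same _ _
    · intro h _ hh
      exact DirectSum.of_eq_of_ne _ _ _ fun h' => hh (hz h'.symm)
    · exact fun h => absurd hg h
  rw [← h1, hd]
  rfl

variable (k) in
/-- A Galois covering of the category attached to `e`, with a section on objects. -/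
structure SectionedGaloisCovering (G : Type*) [Group G] (F : C ⥤ IdemCat k he) [F.Additive]
    [F.Linear k] where
  covering : IsCoveringFunctor k F
  action : LinearCatAction k G C
  free : ∀ (g : G) (x : C), (action.toFunctor g).obj x = x → g = 1
  comp_eq : ∀ g, action.toFunctor g ⋙ F = F
  transitive : ∀ x y : C, F.obj x = F.obj y → ∃ g, (action.toFunctor g).obj x = y
  lift : ι → C
  obj_lift : ∀ i, F.obj (lift i) = i

namespace SectionedGaloisCovering

variable {G : Type*} [Group G] {F : C ⥤ IdemCat k he} [F.Additive] [F.Linear k]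
  (S : SectionedGaloisCovering k G F)

/-- The action of the group on the objects. -/
def act (g : G) (x : C) : C := (S.action.toFunctor g).obj x

theorem act_one (x : C) : S.act 1 x = x := by rw [act, S.action.map_one]; rfl

theorem act_mul (g h : G) (x : C) : S.act (g * h) x = S.act g (S.act h x) := by
  rw [act, S.action.map_mul]; rfl

theorem obj_act (g : G) (x : C) : F.obj (S.act g x) = F.obj x :=
  Functor.congr_obj (S.comp_eq g) x

theorem act_left_injective {g h : G} {x : C} (heq : S.act g x = S.act h x) : g = h := by
  have h1 : S.act (h⁻¹ * g) x = x := by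
    rw [S.act_mul, heq, ← S.act_mul, inv_mul_cancel, S.act_one]
  exact (inv_mul_eq_one.1 (S.free _ _ h1)).symm

theorem exists_act_inv_lift (x : C) (i : ι) (h : F.obj x = i) : ∃ g, x = S.act g⁻¹ (S.lift i) := by
  obtain ⟨g, hg⟩ := S.transitive (S.lift i) x (by rw [S.obj_lift, h])
  exact ⟨g⁻¹, by rw [inv_inv]; exact hg.symm⟩

/-- Since `F ∘ g = F`, a morphism and its translate have the same image in `A`. -/
theorem mem_imageSpace_act (g : G) {x y : C} {a : A} (ha : a ∈ imageSpace F x y) :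
    a ∈ imageSpace F (S.act g x) (S.act g y) := by
  obtain ⟨f, rfl⟩ := mem_imageSpace.1 ha
  refine mem_imageSpace.2 ⟨(S.action.toFunctor g).map f, ?_⟩
  have := Functor.congr_hom (S.comp_eq g) f
  rw [Functor.comp_map] at this
  erw [this, IdemCat.val_eqToHom_comp, IdemCat.val_comp_eqToHom]

theorem idem_mul {i j : ι} {g : G} {a : A}
    (ha : a ∈ imageSpace F (S.lift i) (S.act g (S.lift j))) : e j * a = a := by
  obtain ⟨f, rfl⟩ := mem_imageSpace.1 ha
  have h : F.obj (S.act g (S.lift j)) = j := (S.obj_act g _).trans (S.obj_lift j)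
  have h2 := IdemCat.idem_mul_val (F.map f)
  generalize IdemCat.val _ _ (F.map f) = b at h2 ⊢
  rwa [h] at h2

theorem mul_idem {i j : ι} {g : G} {a : A}
    (ha : a ∈ imageSpace F (S.lift i) (S.act g (S.lift j))) : a * e i = a := by
  obtain ⟨f, rfl⟩ := mem_imageSpace.1 ha
  have h : F.obj (S.lift i) = i := S.obj_lift i
  have h2 := IdemCat.val_mul_idem (F.map f)
  generalize IdemCat.val _ _ (F.map f) = b at h2 ⊢
  rwa [h] at h2

/-- The part of degree `g` of `A`. -/
def degree (g : G) : Submodule k A where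
  carrier := {a | ∀ i j, e j * a * e i ∈ imageSpace F (S.lift i) (S.act g⁻¹ (S.lift j))}
  add_mem' ha hb i j := by
    rw [mul_add, add_mul]; exact Submodule.add_mem _ (ha i j) (hb i j)
  zero_mem' i j := by
    rw [mul_zero, zero_mul]; exact Submodule.zero_mem _
  smul_mem' c a ha i j := by
    rw [mul_smul_comm, smul_mul_assoc]; exact Submodule.smul_mem _ c (ha i j)

theorem mem_degree_of_mem_imageSpace {g : G} {i j : ι} {a : A}
    (ha : a ∈ imageSpace F (S.lift i) (S.act g⁻¹ (S.lift j))) : a ∈ S.degree g := by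
  intro i' j'
  have h1 := S.idem_mul ha
  have h2 := S.mul_idem ha
  by_cases hi : i' = i
  · by_cases hj : j' = j
    · subst hi hj
      rwa [h1, h2]
    · rw [← h1, ← mul_assoc, he.ortho hj, zero_mul, zero_mul]
      exact Submodule.zero_mem _
  · rw [← h2, mul_assoc, mul_assoc a, he.ortho (Ne.symm hi), mul_zero, mul_zero]
    exact Submodule.zero_mem _

theorem sum_corners (he : CompleteOrthogonalIdempotents e) (a : A) :
    ∑ i, ∑ j, e j * a * e i = a := by
  simp_rw [← Finset.sum_mul, he.complete, one_mul, ← Finset.mul_sum, he.complete, mul_one]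

/-- If `b` leads from `lift i` to `h⁻¹ · lift l` and `a` from `lift l` to `g⁻¹ · lift j`, translate
`a` by `h⁻¹`: the product ends at `(g * h)⁻¹ · lift j`. The inverse in `degree` is there for this
order of multiplication. Spanning and independence are the surjectivity and injectivity of the
covering map at `lift i`. -/
theorem isGroupGrading : IsGroupGrading S.degree where
  mul_mem {g h a b} ha hb i j := by
    have : e j * (a * b) * e i = ∑ l, (e j * a * e l) * (e l * b * e i) := by
      calc e j * (a * b) * e i = e j * a * 1 * (b * e i) := by simp only [mul_assoc, one_mul]
        _ = ∑ l, e j * a * e l * (b * e i) := by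
          rw [← he.complete, Finset.mul_sum, Finset.sum_mul]
        _ = _ := by
          refine Finset.sum_congr rfl fun l _ => ?_
          conv_lhs => rw [← (he.idem l).eq]
          simp only [mul_assoc]
    rw [this]
    refine Submodule.sum_mem _ fun l _ => ?_
    refine mul_mem_imageSpace ?_ (hb i l)
    rw [mul_inv_rev, S.act_mul]
    exact S.mem_imageSpace_act _ (ha l j)
  iSup_eq_top := by
    classical
    rw [eq_top_iff]
    intro a _
    rw [← sum_corners he a]
    refine Submodule.sum_mem _ fun i _ => Submodule.sum_mem _ fun j _ => ?_
    have hmem := S.covering.mem_iSup_imageSpace (a := e j * a * e i) (S.lift i) j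
      (by simp only [← mul_assoc]; rw [(he.idem j).eq])
      (by rw [S.obj_lift, mul_assoc, (he.idem i).eq])
    refine (iSup_le fun y' b hb => ?_ : _ ≤ ⨆ g, S.degree g) hmem
    obtain ⟨g, hg⟩ := S.exists_act_inv_lift y'.1 j y'.2
    refine Submodule.mem_iSup_of_mem g (S.mem_degree_of_mem_imageSpace (i := i) (j := j) ?_)
    rwa [← hg]
  indep := by
    classical
    rw [iSupIndep_iff_finsetSum_eq_zero_imp_eq_zero]
    intro T c hc hsum g hg
    rw [← sum_corners he (c g)]
    refine Finset.sum_eq_zero fun i _ => Finset.sum_eq_zero fun j _ => ?_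
    choose! m hm using fun g (hg : g ∈ T) => mem_imageSpace.1 (hc g hg i j)
    have hmg : m g = 0 := by
      refine S.covering.eq_zero_of_sum_eq_zero (S.lift i) j
        (fun g => ⟨S.act g⁻¹ (S.lift j), (S.obj_act _ _).trans (S.obj_lift j)⟩)
        (fun g h hgh => inv_injective (S.act_left_injective (congrArg Subtype.val hgh))) T m ?_ g hg
      rw [Finset.sum_congr rfl hm, ← Finset.sum_mul, ← Finset.mul_sum, hsum, mul_zero, zero_mul]
    rw [← hm g hg, hmg, F.map_zero, map_zero]

theorem idem_mem_degree (l : ι) : e l ∈ S.degree 1 := by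
  refine S.mem_degree_of_mem_imageSpace (i := l) (j := l) ?_
  rw [inv_one, S.act_one]
  have := idem_mem_imageSpace F (S.lift l)
  rwa [S.obj_lift] at this

/-- Otherwise the component of `a` at `e i` is invertible in its corner, with an inverse of degree
`g⁻¹`. This makes `lift i` isomorphic, hence equal, to `g⁻¹ · lift i`, against the freeness of the
action. -/
theorem char_eq_zero (hloc : IsLocallyBounded k C) (χ : SplitFamily k e) {g : G} (hg : g ≠ 1)
    {a : A} (ha : a ∈ S.degree g) : a ∈ χ.rad := by
  rw [χ.mem_rad]
  intro i
  by_contra h0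
  have hb := ha i i
  have hb0 : χ.char i (e i * a * e i) ≠ 0 := by
    rwa [map_mul, map_mul, χ.char_self, one_mul, mul_one]
  obtain ⟨c, hc1, hc2, hc3, hc4⟩ :=
    χ.exists_inverse (he.idem i) (S.idem_mul hb) (S.mul_idem hb) hb0
  have hc : c ∈ S.degree g⁻¹ := S.isGroupGrading.inverse_mem (S.idem_mem_degree i)
    (fun h => χ.idem_notMem_rad i (h ▸ χ.rad.zero_mem)) (S.mem_degree_of_mem_imageSpace hb)
    hc3 hc4 hc2
  have hc' := S.mem_imageSpace_act g⁻¹ (hc i i)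
  rw [← S.act_mul, inv_inv, inv_mul_cancel, S.act_one, hc1, hc2] at hc'
  obtain ⟨m, hm⟩ := mem_imageSpace.1 hb
  obtain ⟨m', hm'⟩ := mem_imageSpace.1 hc'
  have hiso : Nonempty (S.lift i ≅ S.act g⁻¹ (S.lift i)) := by
    refine ⟨⟨m, m', S.covering.val_map_injective ?_, S.covering.val_map_injective ?_⟩⟩
    · rw [F.map_comp, IdemCat.val_comp, hm, hm', hc4, F.map_id, IdemCat.val_id, S.obj_lift]
    · rw [F.map_comp, IdemCat.val_comp, hm, hm', hc3, F.map_id, IdemCat.val_id, S.obj_act,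
        S.obj_lift]
  have := hloc.eq_of_iso _ _ hiso
  exact hg (inv_eq_one.1 (S.free _ _ this.symm))

/-- The pair `(i, g)` stands for the object `g⁻¹ · lift i`. Translating `f` by `g` makes it start at
`lift i`, and there its degree is `h * g⁻¹`. -/
theorem gradingAdj {x y : C} (f : x ⟶ y) (hf : f ≠ 0) {i j : ι} {g h : G}
    (hx : x = S.act g⁻¹ (S.lift i)) (hy : y = S.act h⁻¹ (S.lift j)) :
    GradingAdj e S.degree (i, g) (j, h) := by
  have ha := S.mem_imageSpace_act g (mem_imageSpace.2 ⟨f, rfl⟩)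
  have hx' : S.act g x = S.lift i := by rw [hx, ← S.act_mul, mul_inv_cancel, S.act_one]
  have hy' : S.act g y = S.act (g * h⁻¹) (S.lift j) := by rw [hy, ← S.act_mul]
  rw [hx', hy'] at ha
  have hgh : g * h⁻¹ = (h * g⁻¹)⁻¹ := by rw [mul_inv_rev, inv_inv]
  rw [hgh] at ha
  refine ⟨IdemCat.val _ _ (F.map f), S.mem_degree_of_mem_imageSpace ha, S.idem_mul ha,
    S.mul_idem ha, fun h0 => hf (S.covering.val_map_injective ?_)⟩
  rw [h0, F.map_zero, map_zero]

theorem connected (hconn : IsConnectedLinCat C) (p q : ι × G) :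
    Relation.ReflTransGen
      (fun p q => GradingAdj e S.degree p q ∨ GradingAdj e S.degree q p) p q := by
  have key : ∀ x y : C,
      Relation.ReflTransGen (fun a b : C => (∃ f : a ⟶ b, f ≠ 0) ∨ ∃ f : b ⟶ a, f ≠ 0) x y →
      ∀ q : ι × G, x = S.act p.2⁻¹ (S.lift p.1) → y = S.act q.2⁻¹ (S.lift q.1) →
      Relation.ReflTransGen
        (fun p q => GradingAdj e S.degree p q ∨ GradingAdj e S.degree q p) p q := by
    intro x y hxy
    induction hxy with
    | refl =>
      intro q hx hy
      have h1 : p.1 = q.1 := by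
        have := congrArg F.obj (hx.symm.trans hy)
        rwa [S.obj_act, S.obj_act, S.obj_lift, S.obj_lift] at this
      have h2 : p.2 = q.2 := by
        rw [hx, h1] at hy
        exact inv_injective (S.act_left_injective hy)
      rw [Prod.ext h1 h2]
    | @tail y z _ hyz ih =>
      intro q hx hz
      obtain ⟨g, hg⟩ := S.exists_act_inv_lift y (F.obj y) rfl
      refine (ih (F.obj y, g) hx hg).tail ?_
      rcases hyz with ⟨f, hf⟩ | ⟨f, hf⟩
      · exact Or.inl (S.gradingAdj f hf hg hz)
      · exact Or.inr (S.gradingAdj f hf hz hg)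
  exact key _ _ (hconn.2 _ _) q rfl rfl

theorem isCoveringGrading (hconn : IsConnectedLinCat C) (hloc : IsLocallyBounded k C)
    (χ : SplitFamily k e) : IsCoveringGrading χ S.degree where
  toIsGroupGrading := S.isGroupGrading
  idem_mem := S.idem_mem_degree
  mem_rad hg _ ha := S.char_eq_zero hloc χ hg ha
  connected := S.connected hconn

/-- The fibres are single points, so each covering map has a single summand. -/
theorem isCatIsomorphism_of_subsingleton [Subsingleton G]
    (S : SectionedGaloisCovering k G F) : IsCatIsomorphism F := by
  have hinj : Function.Injective F.obj := fun x y h => by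
    obtain ⟨g, hg⟩ := S.transitive x y h
    have h1 : S.act g x = y := hg
    rw [← h1, Subsingleton.elim g 1, S.act_one]
  refine ⟨⟨hinj, S.covering.surjective⟩, fun x y => ⟨fun f f' h =>
    S.covering.val_map_injective (congrArg _ h), fun b => ?_⟩⟩
  have h2 : IdemCat.val _ _ b ∈ imageSpace F x y := by
    refine (iSup_le fun y' => ?_ : _ ≤ imageSpace F x y) (S.covering.mem_iSup_imageSpace x (F.obj y)
      (IdemCat.idem_mul_val b) (IdemCat.val_mul_idem b))
    rw [hinj y'.2]
  obtain ⟨f, hf⟩ := mem_imageSpace.1 h2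
  exact ⟨f, IdemCat.val_injective _ _ hf⟩

end SectionedGaloisCovering

/-- A proper Galois covering defines a covering grading by a nontrivial group. -/
theorem HasProperGaloisCovering.exists_isCoveringGrading (χ : SplitFamily k e)
    (h : HasProperGaloisCovering k (IdemCat k he)) :
    Nonempty ι ∧ ∃ (G : Type u) (_ : Group G) (_ : Nontrivial G) (D : G → Submodule k A),
      IsCoveringGrading χ D := by
  obtain ⟨C, _, _, _, G, _, F, _, _, hconn, hloc, ⟨hcov, ρ, hfree, hcomp, htrans⟩, hiso⟩ := h
  choose s hs using hcov.surjective
  let S : SectionedGaloisCovering k G F := ⟨hcov, ρ, hfree, hcomp, htrans, s, hs⟩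
  refine ⟨hconn.1.map F.obj, G, inferInstance, ?_, S.degree, S.isCoveringGrading hconn hloc χ⟩
  by_contra hG
  rw [not_nontrivial_iff_subsingleton] at hG
  exact hiso S.isCatIsomorphism_of_subsingleton

end CoveringGrading

/-! ### Path algebras -/

section PathAlgebraLemmas

variable {k : Type u} [Field k] {Q : Type u} [Quiver.{u} Q]

theorem concat_eq_sum {x y z : Q} (f : Quiver.Path x y →₀ k) (g : Quiver.Path y z →₀ k) :
    concat k f g = f.sum fun p a => g.sum fun q b => Finsupp.single (p.comp q) (a * b) := by
  conv_lhs => rw [← Finsupp.sum_single f, ← Finsupp.sum_single g]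
  simp only [Finsupp.sum, map_sum, LinearMap.sum_apply, concat_single]
  exact Finset.sum_comm

theorem exists_of_concat_ne_zero {x y z : Q} {f : Quiver.Path x y →₀ k}
    {g : Quiver.Path y z →₀ k} {p : Quiver.Path x z} (h : concat k f g p ≠ 0) :
    ∃ p₁ p₂, f p₁ ≠ 0 ∧ g p₂ ≠ 0 ∧ p = p₁.comp p₂ := by
  classical
  rw [concat_eq_sum, Finsupp.sum, Finsupp.finsetSum_apply] at h
  obtain ⟨p₁, hp₁, h⟩ := Finset.exists_ne_zero_of_sum_ne_zero h
  rw [Finsupp.sum, Finsupp.finsetSum_apply] at h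
  obtain ⟨p₂, hp₂, h⟩ := Finset.exists_ne_zero_of_sum_ne_zero h
  refine ⟨p₁, p₂, Finsupp.mem_support_iff.1 hp₁, Finsupp.mem_support_iff.1 hp₂, ?_⟩
  by_contra hne
  exact h (Finsupp.single_eq_of_ne hne)

/-- A trivial path factors only into trivial paths; this makes `nilCoeff` multiplicative. -/
theorem concat_nil_apply {x : Q} (f g : Quiver.Path x x →₀ k) :
    concat k f g Quiver.Path.nil = f Quiver.Path.nil * g Quiver.Path.nil := by
  classical
  induction f using Finsupp.induction_linear with
  | zero => simp
  | add f f' hf hf' => simp [hf, hf', add_mul]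
  | single p a =>
    induction g using Finsupp.induction_linear with
    | zero => simp
    | add g g' hg hg' => simp [hg, hg', mul_add]
    | single q b =>
      rw [concat_single]
      by_cases hp : p = Quiver.Path.nil
      · by_cases hq : q = Quiver.Path.nil
        · subst hp hq
          simp
        · subst hp
          simp [hq]
      · have : p.comp q ≠ Quiver.Path.nil := fun h => hp (Quiver.Path.eq_nil_of_length_zero _ (by
          have := congrArg Quiver.Path.length h
          rw [Quiver.Path.length_comp, Quiver.Path.length_nil] at this
          omega))
        simp [Finsupp.single_apply, hp, this]

namespace PathAlgebra

theorem incl_apply_self {x y : Q} (r : Quiver.Path x y →₀ k) : incl r x y = r := by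
  classical
  simp [incl]

theorem incl_apply_of_ne {x y x' y' : Q} (r : Quiver.Path x y →₀ k) (h : ¬ (x' = x ∧ y' = y)) :
    incl r x' y' = 0 := by
  classical
  by_cases hx : x' = x
  · subst hx
    have hy : y' ≠ y := fun hy => h ⟨rfl, hy⟩
    simp [incl, hy]
  · simp [incl, hx]

/-- `incl` as a linear map. -/
noncomputable def inclₗ (x y : Q) : (Quiver.Path x y →₀ k) →ₗ[k] PathAlgebra k Q where
  toFun := incl
  map_add' r s := by
    ext1 x' y'
    by_cases h : x' = x ∧ y' = y
    · obtain ⟨rfl, rfl⟩ := h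
      simp only [add_apply, incl_apply_self]
    · simp only [add_apply, incl_apply_of_ne _ h, add_zero]
  map_smul' c r := by
    ext1 x' y'
    by_cases h : x' = x ∧ y' = y
    · obtain ⟨rfl, rfl⟩ := h
      simp only [smul_apply, incl_apply_self, RingHom.id_apply]
    · simp only [smul_apply, incl_apply_of_ne _ h, RingHom.id_apply, smul_zero]

theorem inclₗ_apply {x y : Q} (r : Quiver.Path x y →₀ k) : inclₗ x y r = incl r := rfl

variable (k) in
/-- A path, as an element of the path algebra. -/
noncomputable def ofPath {x y : Q} (p : Quiver.Path x y) : PathAlgebra k Q :=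
  incl (Finsupp.single p 1)

/-- Evaluation at `(x, y)` as a linear map. -/
def evalₗ (x y : Q) : PathAlgebra k Q →ₗ[k] (Quiver.Path x y →₀ k) where
  toFun f := f x y
  map_add' _ _ := rfl
  map_smul' _ _ := rfl

theorem evalₗ_apply (x y : Q) (f : PathAlgebra k Q) : evalₗ x y f = f x y := rfl

theorem ofPath_apply_ne_zero {x y x' y' : Q} {p : Quiver.Path x y} {q : Quiver.Path x' y'}
    (h : ofPath k p x' y' q ≠ 0) : q.length = p.length := by
  classical
  by_cases hxy : x' = x ∧ y' = y
  · obtain ⟨rfl, rfl⟩ := hxy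
    rw [ofPath, incl_apply_self] at h
    by_contra hne
    exact h (Finsupp.single_eq_of_ne fun h' => hne (congrArg _ h'))
  · rw [ofPath, incl_apply_of_ne _ hxy] at h
    exact absurd rfl h

theorem arrow_eq_ofPath {x y : Q} (α : x ⟶ y) : arrow α = ofPath k α.toPath := rfl

variable [Fintype Q]

theorem sum_incl (f : PathAlgebra k Q) : ∑ x, ∑ y, incl (f x y) = f := by
  classical
  ext1 x' y'
  change evalₗ x' y' (∑ x, ∑ y, incl (f x y)) = _
  rw [map_sum, Finset.sum_eq_single x']
  · rw [map_sum, Finset.sum_eq_single y']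
    · rw [evalₗ_apply, incl_apply_self]
    · intro y _ hy
      rw [evalₗ_apply, incl_apply_of_ne _ fun h => hy h.2.symm]
    · simp
  · intro x _ hx
    rw [map_sum]
    exact Finset.sum_eq_zero fun y _ => by
      rw [evalₗ_apply, incl_apply_of_ne _ fun h => hx h.1.symm]
  · simp

theorem incl_eq_sum {x y : Q} (r : Quiver.Path x y →₀ k) :
    incl r = r.sum fun p c => c • ofPath k p := by
  conv_lhs => rw [← Finsupp.sum_single r]
  rw [← inclₗ_apply, map_finsuppSum]
  refine Finsupp.sum_congr fun p _ => ?_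
  rw [ofPath, ← inclₗ_apply, ← map_smul, Finsupp.smul_single, smul_eq_mul, mul_one]

/-- The path algebra is spanned by the paths. -/
theorem mem_of_forall_ofPath (N : Submodule k (PathAlgebra k Q)) (f : PathAlgebra k Q)
    (h : ∀ x y (p : Quiver.Path x y), f x y p ≠ 0 → ofPath k p ∈ N) : f ∈ N := by
  rw [← sum_incl f]
  refine N.sum_mem fun x _ => N.sum_mem fun y _ => ?_
  rw [incl_eq_sum]
  exact N.sum_mem fun p hp => N.smul_mem _ (h x y p (Finsupp.mem_support_iff.1 hp))

theorem incl_mul_incl {x y z : Q} (g : Quiver.Path x y →₀ k) (f : Quiver.Path y z →₀ k) :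
    (incl f * incl g : PathAlgebra k Q) = incl (concat k g f) := by
  classical
  ext1 x' z'
  rw [mul_apply]
  by_cases h : x' = x ∧ z' = z
  · obtain ⟨rfl, rfl⟩ := h
    rw [incl_apply_self, Finset.sum_eq_single y, incl_apply_self, incl_apply_self]
    · intro y' _ hy
      rw [incl_apply_of_ne g fun h => hy h.2, map_zero, LinearMap.zero_apply]
    · simp
  · rw [incl_apply_of_ne _ h]
    refine Finset.sum_eq_zero fun y' _ => ?_
    by_cases hx : x' = x
    · rw [incl_apply_of_ne f fun h' => h ⟨hx, h'.2⟩, map_zero]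
    · rw [incl_apply_of_ne g fun h' => hx h'.1, map_zero, LinearMap.zero_apply]

theorem ofPath_mul_ofPath {x y z : Q} (p : Quiver.Path x y) (q : Quiver.Path y z) :
    ofPath k q * ofPath k p = ofPath k (p.comp q) := by
  rw [ofPath, ofPath, incl_mul_incl, concat_single, mul_one, ofPath]

theorem incl_mul_incl_of_ne {x y y' z : Q} (g : Quiver.Path x y →₀ k) (f : Quiver.Path y' z →₀ k)
    (h : y ≠ y') : (incl f * incl g : PathAlgebra k Q) = 0 := by
  classical
  ext1 x₁ z₁
  rw [mul_apply]
  refine Finset.sum_eq_zero fun y₁ _ => ?_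
  by_cases hy : y₁ = y
  · rw [incl_apply_of_ne f fun h' => h (hy.symm.trans h'.1), map_zero]
  · rw [incl_apply_of_ne g fun h' => hy h'.2, map_zero, LinearMap.zero_apply]

theorem completeOrthogonalIdempotents_nil :
    CompleteOrthogonalIdempotents fun x : Q => ofPath k (Quiver.Path.nil : Quiver.Path x x) where
  idem x := by
    rw [IsIdempotentElem, ofPath_mul_ofPath]; rfl
  ortho x y hxy := by
    exact incl_mul_incl_of_ne _ _ hxy.symm
  complete := by
    conv_rhs => rw [← sum_incl (1 : PathAlgebra k Q)]
    refine Finset.sum_congr rfl fun x _ => ?_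
    rw [Finset.sum_eq_single x, one_apply_self, ofPath]
    · intro y _ hy
      rw [one_apply_of_ne hy.symm, ← inclₗ_apply, map_zero]
    · simp

/-- Consequently a two-sided ideal contains the `(x, y)`-parts of its elements. -/
theorem ofPath_nil_mul_mul_ofPath_nil (f : PathAlgebra k Q) (x y : Q) :
    ofPath k (Quiver.Path.nil : Quiver.Path y y) * f *
      ofPath k (Quiver.Path.nil : Quiver.Path x x) = incl (f x y) := by
  classical
  conv_lhs => rw [← sum_incl f]
  rw [Finset.mul_sum, Finset.sum_mul, Finset.sum_eq_single x]
  · rw [Finset.mul_sum, Finset.sum_mul, Finset.sum_eq_single y]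
    · rw [ofPath, incl_mul_incl, ofPath, incl_mul_incl, concat_nil, nil_concat]
    · intro y' _ hy
      rw [ofPath, incl_mul_incl_of_ne _ _ hy, zero_mul]
    · simp
  · intro x' _ hx
    rw [Finset.mul_sum, Finset.sum_mul]
    refine Finset.sum_eq_zero fun y' _ => ?_
    rw [mul_assoc, ofPath, ofPath, incl_mul_incl_of_ne _ _ hx.symm, mul_zero]
  · simp

/-! The filtration of the path algebra by the length of paths. -/

variable (k Q) in
/-- The ideal of combinations of paths of length at least `n`. -/
def lengthIdeal (n : ℕ) : Ideal (PathAlgebra k Q) where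
  carrier := {f | ∀ x y (p : Quiver.Path x y), f x y p ≠ 0 → n ≤ p.length}
  add_mem' {f g} hf hg x y p h := by
    by_contra hn
    refine h ?_
    rw [add_apply, Finsupp.add_apply, not_not.1 (mt (hf x y p) hn),
      not_not.1 (mt (hg x y p) hn), add_zero]
  zero_mem' x y p h := absurd rfl h
  smul_mem' f g hg x y p h := by
    rw [smul_eq_mul, mul_apply, Finsupp.finsetSum_apply] at h
    obtain ⟨z, -, h⟩ := Finset.exists_ne_zero_of_sum_ne_zero h
    obtain ⟨p₁, p₂, h₁, -, rfl⟩ := exists_of_concat_ne_zero h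
    rw [Quiver.Path.length_comp]
    exact (hg _ _ _ h₁).trans (Nat.le_add_right _ _)

theorem mul_mem_lengthIdeal {m n : ℕ} {f g : PathAlgebra k Q} (hf : f ∈ lengthIdeal k Q m)
    (hg : g ∈ lengthIdeal k Q n) : f * g ∈ lengthIdeal k Q (m + n) := by
  intro x y p h
  rw [mul_apply, Finsupp.finsetSum_apply] at h
  obtain ⟨z, -, h⟩ := Finset.exists_ne_zero_of_sum_ne_zero h
  obtain ⟨p₁, p₂, h₁, h₂, rfl⟩ := exists_of_concat_ne_zero h
  rw [Quiver.Path.length_comp]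
  have := hg _ _ _ h₁
  have := hf _ _ _ h₂
  omega

instance (n : ℕ) : (lengthIdeal k Q n).IsTwoSided where
  mul_mem_of_left {a} b ha := by
    have : b ∈ lengthIdeal k Q 0 := fun _ _ _ _ => Nat.zero_le _
    exact mul_mem_lengthIdeal ha this

theorem ofPath_mem_lengthIdeal {x y : Q} {n : ℕ} {p : Quiver.Path x y} (h : n ≤ p.length) :
    ofPath k p ∈ lengthIdeal k Q n := fun _ _ _ hq => h.trans (ofPath_apply_ne_zero hq).ge

theorem arrow_mem_arrowIdeal {x y : Q} (α : x ⟶ y) : arrow α ∈ arrowIdeal k Q :=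
  TwoSidedIdeal.mem_asIdeal.2 (TwoSidedIdeal.subset_span ⟨x, y, α, rfl⟩)

instance : (arrowIdeal k Q).IsTwoSided := by
  unfold arrowIdeal; infer_instance

theorem arrowIdeal_le {J : Ideal (PathAlgebra k Q)} [J.IsTwoSided]
    (h : ∀ (x y : Q) (α : x ⟶ y), arrow α ∈ J) : arrowIdeal k Q ≤ J := by
  have h1 : TwoSidedIdeal.span {a : PathAlgebra k Q | ∃ (x y : Q) (α : x ⟶ y), a = arrow α} ≤
      J.toTwoSided := by
    rw [TwoSidedIdeal.span_le]
    rintro a ⟨x, y, α, rfl⟩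
    exact Ideal.mem_toTwoSided.2 (h x y α)
  intro a ha
  exact Ideal.mem_toTwoSided.1 (h1 (TwoSidedIdeal.mem_asIdeal.1 ha))

theorem ofPath_mem_arrowIdeal {x y : Q} {p : Quiver.Path x y} (h : 1 ≤ p.length) :
    ofPath k p ∈ arrowIdeal k Q := by
  cases p with
  | nil => simp at h
  | cons p α =>
    have : ofPath k (p.cons α) = arrow α * ofPath k p := by
      rw [arrow_eq_ofPath, ofPath_mul_ofPath]; rfl
    rw [this]
    exact Ideal.mul_mem_right _ _ (arrow_mem_arrowIdeal α)

theorem arrowIdeal_eq : arrowIdeal k Q = lengthIdeal k Q 1 := by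
  refine le_antisymm (arrowIdeal_le fun x y α => ofPath_mem_lengthIdeal le_rfl) fun f hf => ?_
  exact mem_of_forall_ofPath ((arrowIdeal k Q).restrictScalars k) f fun x y p hp =>
    ofPath_mem_arrowIdeal (hf x y p hp)

/-- A path of length at least `2` is its last arrow times a path of length at least `1`. -/
theorem arrowIdeal_sq_eq : arrowIdeal k Q ^ 2 = lengthIdeal k Q 2 := by
  have hsq : arrowIdeal k Q ^ 2 = arrowIdeal k Q * arrowIdeal k Q := by
    rw [← one_add_one_eq_two, Submodule.pow_succ, Submodule.pow_one]
  rw [hsq]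
  refine le_antisymm ?_ fun f hf => ?_
  · rw [Ideal.mul_le, arrowIdeal_eq]
    exact fun f hf g hg => mul_mem_lengthIdeal hf hg
  · refine mem_of_forall_ofPath ((arrowIdeal k Q * arrowIdeal k Q).restrictScalars k) f
      fun x y p hp => ?_
    have hlen := hf x y p hp
    cases p with
    | nil => simp at hlen
    | cons p α =>
      have : ofPath k (p.cons α) = arrow α * ofPath k p := by
        rw [arrow_eq_ofPath, ofPath_mul_ofPath]; rfl
      rw [this]
      exact Ideal.mul_mem_mul (arrow_mem_arrowIdeal α) (ofPath_mem_arrowIdeal (by simpa using hlen))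

variable (k) in
/-- The character of the path algebra given by the coefficient of the trivial path at `x`. -/
noncomputable def nilCoeff (x : Q) : PathAlgebra k Q →ₐ[k] k :=
  AlgHom.ofLinearMap (Finsupp.lapply Quiver.Path.nil ∘ₗ evalₗ x x)
    (by
      change (1 : PathAlgebra k Q) x x Quiver.Path.nil = 1
      rw [one_apply_self, Finsupp.single_eq_same])
    (fun f g => by
      change (f * g) x x Quiver.Path.nil = f x x Quiver.Path.nil * g x x Quiver.Path.nil
      rw [mul_apply, Finsupp.finsetSum_apply, Finset.sum_eq_single x, concat_nil_apply, mul_comm]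
      · intro y _ hy
        by_contra hne
        obtain ⟨p₁, p₂, -, -, h⟩ := exists_of_concat_ne_zero hne
        have := congrArg Quiver.Path.length h
        rw [Quiver.Path.length_comp, Quiver.Path.length_nil] at this
        exact hy (p₂.eq_of_length_zero (by omega))
      · simp)

theorem nilCoeff_apply (x : Q) (f : PathAlgebra k Q) :
    nilCoeff k x f = f x x Quiver.Path.nil := rfl

theorem mem_arrowIdeal_iff {f : PathAlgebra k Q} :
    f ∈ arrowIdeal k Q ↔ ∀ x, nilCoeff k x f = 0 := by
  rw [arrowIdeal_eq]
  constructor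
  · intro hf x
    by_contra h
    simpa using hf x x _ h
  · intro h x y p hp
    cases p with
    | nil => exact absurd (h x) hp
    | cons p α => simp

/-! Morphisms from a path algebra. -/

section Lift

variable {A : Type*} [Ring A] [Algebra k A] {e : Q → A}

/-- The product of the elements of `A` associated with the arrows of a path. -/
def pathValue (e : Q → A) (a : ∀ {x y : Q}, (x ⟶ y) → A) {x : Q} :
    ∀ {y : Q}, Quiver.Path x y → A
  | _, .nil => e x
  | _, .cons p α => a α * pathValue e a p

variable {a : ∀ {x y : Q}, (x ⟶ y) → A}

theorem idem_mul_pathValue (he : CompleteOrthogonalIdempotents e)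
    (h1 : ∀ {x y : Q} (α : x ⟶ y), e y * a α = a α) {x y : Q} (p : Quiver.Path x y) :
    e y * pathValue e a p = pathValue e a p := by
  cases p with
  | nil => exact (he.idem x).eq
  | cons p α => rw [pathValue, ← mul_assoc, h1]

theorem pathValue_mul_idem (he : CompleteOrthogonalIdempotents e) {x y : Q}
    (p : Quiver.Path x y) : pathValue e a p * e x = pathValue e a p := by
  induction p with
  | nil => exact (he.idem x).eq
  | cons p α ih => rw [pathValue, mul_assoc, ih]

theorem pathValue_comp (he : CompleteOrthogonalIdempotents e)
    (h1 : ∀ {x y : Q} (α : x ⟶ y), e y * a α = a α) {x y z : Q} (p : Quiver.Path x y)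
    (q : Quiver.Path y z) :
    pathValue e a (p.comp q) = pathValue e a q * pathValue e a p := by
  induction q with
  | nil => rw [Quiver.Path.comp_nil, pathValue, idem_mul_pathValue he h1]
  | cons q α ih => rw [Quiver.Path.comp_cons, pathValue, ih, pathValue, mul_assoc]

/-- The morphism from the path algebra of `Q` given by idempotents and by elements associated with
the arrows. -/
noncomputable def liftHom (he : CompleteOrthogonalIdempotents e)
    (h1 : ∀ {x y : Q} (α : x ⟶ y), e y * a α = a α) : PathAlgebra k Q →ₐ[k] A :=
  AlgHom.ofLinearMap
    (∑ x, ∑ y, Finsupp.linearCombination k (pathValue e a (x := x) (y := y)) ∘ₗ evalₗ x y)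
    (by
      simp only [LinearMap.sum_apply, LinearMap.comp_apply, evalₗ_apply]
      rw [← he.complete]
      refine Finset.sum_congr rfl fun x _ => ?_
      rw [Finset.sum_eq_single x, one_apply_self, Finsupp.linearCombination_single, one_smul,
        pathValue]
      · intro y _ hy
        rw [one_apply_of_ne hy.symm, map_zero]
      · simp)
    (fun f g => by
      have hc : ∀ {x y z : Q} (r : Quiver.Path x y →₀ k) (s : Quiver.Path y z →₀ k),
          Finsupp.linearCombination k (pathValue e a) (concat k r s) =
            Finsupp.linearCombination k (pathValue e a) s *
              Finsupp.linearCombination k (pathValue e a) r := by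
        intro x y z r s
        induction r using Finsupp.induction_linear with
        | zero => simp
        | add r r' hr hr' => simp [hr, hr', mul_add]
        | single p c =>
          induction s using Finsupp.induction_linear with
          | zero => simp
          | add s s' hs hs' => simp [hs, hs', add_mul]
          | single q d =>
            rw [concat_single, Finsupp.linearCombination_single, Finsupp.linearCombination_single,
              Finsupp.linearCombination_single, pathValue_comp he h1, smul_mul_smul_comm,
              mul_comm c d]
      have hl : ∀ {x y : Q} (r : Quiver.Path x y →₀ k),
          e y * Finsupp.linearCombination k (pathValue e a) r =
            Finsupp.linearCombination k (pathValue e a) r := by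
        intro x y r
        rw [Finsupp.linearCombination_apply, Finsupp.mul_sum]
        exact Finsupp.sum_congr fun p _ => by
          rw [mul_smul_comm, idem_mul_pathValue he h1]
      have hr : ∀ {x y : Q} (r : Quiver.Path x y →₀ k),
          Finsupp.linearCombination k (pathValue e a) r * e x =
            Finsupp.linearCombination k (pathValue e a) r := by
        intro x y r
        rw [Finsupp.linearCombination_apply, Finsupp.sum_mul]
        exact Finsupp.sum_congr fun p _ => by
          rw [smul_mul_assoc, pathValue_mul_idem he]
      simp only [LinearMap.sum_apply, LinearMap.comp_apply, evalₗ_apply, mul_apply, map_sum, hc]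
      calc ∑ x, ∑ z, ∑ y, Finsupp.linearCombination k (pathValue e a) (f y z) *
            Finsupp.linearCombination k (pathValue e a) (g x y)
          = ∑ y, ∑ z, ∑ x, ∑ y', Finsupp.linearCombination k (pathValue e a) (f y z) *
            Finsupp.linearCombination k (pathValue e a) (g x y') := by
            rw [Finset.sum_comm]
            conv_rhs => rw [Finset.sum_comm]
            refine Finset.sum_congr rfl fun z _ => ?_
            rw [Finset.sum_comm]
            refine Finset.sum_congr rfl fun y _ => Finset.sum_congr rfl fun x _ => ?_
            -- The terms with `y' ≠ y` vanish because `e y * e y' = 0`; adding them lets the sum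
            -- factor as a product.
            rw [Finset.sum_eq_single y]
            · intro y' _ hy'
              rw [← hr (f y z), ← hl (g x y'), mul_assoc, ← mul_assoc (e y), he.ortho hy'.symm,
                zero_mul, mul_zero]
            · simp
        _ = _ := by
            simp_rw [← Finset.mul_sum, ← Finset.sum_mul])

theorem liftHom_incl (he : CompleteOrthogonalIdempotents e)
    (h1 : ∀ {x y : Q} (α : x ⟶ y), e y * a α = a α) {x y : Q} (r : Quiver.Path x y →₀ k) :
    liftHom (k := k) he h1 (incl r) = Finsupp.linearCombination k (pathValue e a) r := by
  classical
  change (∑ x, ∑ y, Finsupp.linearCombination k (pathValue e a (x := x) (y := y)) ∘ₗ evalₗ x y :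
    PathAlgebra k Q →ₗ[k] A) (incl r) = _
  simp only [LinearMap.sum_apply, LinearMap.comp_apply, evalₗ_apply]
  rw [Finset.sum_eq_single x]
  · rw [Finset.sum_eq_single y, incl_apply_self]
    · intro y' _ hy
      rw [incl_apply_of_ne _ fun h => hy h.2, map_zero]
    · simp
  · intro x' _ hx
    exact Finset.sum_eq_zero fun y' _ => by
      rw [incl_apply_of_ne _ fun h => hx h.1, map_zero]
  · simp

theorem liftHom_ofPath (he : CompleteOrthogonalIdempotents e)
    (h1 : ∀ {x y : Q} (α : x ⟶ y), e y * a α = a α) {x y : Q} (p : Quiver.Path x y) :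
    liftHom (k := k) he h1 (ofPath k p) = pathValue e a p := by
  rw [ofPath, liftHom_incl, Finsupp.linearCombination_single, one_smul]

end Lift

end PathAlgebra

end PathAlgebraLemmas

/-! ### Weights -/

section Weights

variable {Q : Type*} [Quiver Q] {G : Type*} [Group G]

/-- The weight of a path, for a weight function on the arrows. -/
def pathWeight (w : ∀ {x y : Q}, (x ⟶ y) → G) {x : Q} : ∀ {y : Q}, Quiver.Path x y → G
  | _, .nil => 1
  | _, .cons p α => w α * pathWeight w p

theorem pathWeight_comp (w : ∀ {x y : Q}, (x ⟶ y) → G) {x y z : Q} (p : Quiver.Path x y)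
    (q : Quiver.Path y z) : pathWeight w (p.comp q) = pathWeight w q * pathWeight w p := by
  induction q with
  | nil => rw [Quiver.Path.comp_nil, pathWeight, one_mul]
  | cons q α ih => rw [Quiver.Path.comp_cons, pathWeight, ih, pathWeight, mul_assoc]

/-- The weight of an arrow or of the formal inverse of an arrow. -/
def symmWeight (w : ∀ {x y : Q}, (x ⟶ y) → G) {x y : Quiver.Symmetrify Q} : (x ⟶ y) → G :=
  Sum.elim (fun α => w α) (fun α => (w α)⁻¹)

end Weights

section HomotopyWeights

variable {k : Type u} [Field k] {Q : Type u} [Quiver.{u} Q] {G : Type*} [Group G]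

/-- The weight of a walk. -/
abbrev walkWeight (w : ∀ {x y : Q}, (x ⟶ y) → G) {x y : Quiver.Symmetrify Q}
    (p : Walk Q x y) : G :=
  pathWeight (Q := Quiver.Symmetrify Q) (symmWeight w) p

theorem walkWeight_toWalk (w : ∀ {x y : Q}, (x ⟶ y) → G) {x y : Q} (p : Quiver.Path x y) :
    walkWeight w p.toWalk = pathWeight w p := by
  induction p with
  | nil => rfl
  | cons p α ih =>
    change _ * walkWeight w p.toWalk = _
    rw [ih]
    rfl

/-- Weights that are constant on minimal relations respect every generator of the homotopy relation,
so they are defined on homotopy classes. -/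
theorem Homotopic.walkWeight_eq [Fintype Q] {I : Ideal (PathAlgebra k Q)} {w : ∀ {x y : Q}, (x ⟶ y) → G}
    (hw : ∀ {x y : Q} {r : Quiver.Path x y →₀ k}, IsMinimalRelation I r →
      ∀ p ∈ r.support, ∀ q ∈ r.support, pathWeight w p = pathWeight w q)
    {x y : Quiver.Symmetrify Q} {p q : Walk Q x y} (h : Homotopic I p q) :
    walkWeight w p = walkWeight w q := by
  induction h with
  | refl p => rfl
  | symm _ ih => exact ih.symm
  | trans _ _ ih ih' => exact ih.trans ih'
  | comp _ _ ih ih' =>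
    exact (pathWeight_comp _ _ _).trans
      ((congrArg₂ (· * ·) ih' ih).trans (pathWeight_comp _ _ _).symm)
  | arrow_inv α =>
    change (w α)⁻¹ * (w α * 1) = 1
    rw [mul_one, inv_mul_cancel]
  | inv_arrow α =>
    change w α * ((w α)⁻¹ * 1) = 1
    rw [mul_one, mul_inv_cancel]
  | minimal hr hp hq => rw [walkWeight_toWalk, walkWeight_toWalk, hw hr _ hp _ hq]

end HomotopyWeights

/-! ### Weight spaces of a path algebra -/

section WeightSpaces

open PathAlgebra

/-- The elements of the path algebra all of whose paths have weight `g`. -/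
def weightSpace (k : Type u) [Field k] {Q : Type u} [Quiver.{u} Q] {G : Type*} [Group G]
    (w : ∀ {x y : Q}, (x ⟶ y) → G) (g : G) : Submodule k (PathAlgebra k Q) where
  carrier := {f | ∀ x y (p : Quiver.Path x y), f x y p ≠ 0 → pathWeight w p = g}
  add_mem' {f f'} hf hf' x y p h := by
    by_contra hn
    refine h ?_
    rw [PathAlgebra.add_apply, Finsupp.add_apply, not_not.1 (mt (hf x y p) hn),
      not_not.1 (mt (hf' x y p) hn), add_zero]
  zero_mem' x y p h := absurd rfl h
  smul_mem' c f hf x y p h := by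
    refine hf x y p fun h0 => h ?_
    rw [PathAlgebra.smul_apply, Finsupp.smul_apply, h0, smul_zero]

theorem ofPath_mem_weightSpace {k : Type u} [Field k] {Q : Type u} [Quiver.{u} Q] {G : Type*}
    [Group G] (w : ∀ {x y : Q}, (x ⟶ y) → G) {x y : Q} (p : Quiver.Path x y) :
    ofPath k p ∈ weightSpace k w (pathWeight w p) := by
  classical
  intro x' y' q hq
  by_cases h : x' = x ∧ y' = y
  · obtain ⟨rfl, rfl⟩ := h
    rw [ofPath, incl_apply_self] at hq
    by_contra hne
    exact hq (Finsupp.single_eq_of_ne fun h' => hne (by rw [h']))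
  · rw [ofPath, incl_apply_of_ne _ h] at hq
    exact absurd rfl hq

end WeightSpaces

/-! ### The grading attached to a presentation and a weight function -/

section Presentations

variable {k : Type u} [Field k] {Q : Type u} [Quiver.{u} Q] [Fintype Q]
  {A : Type u} [Ring A] [Algebra k A]

/-- `π` presents `A` as the quotient of the path algebra of `Q` by `I`. -/
structure IsPresentation (I : Ideal (PathAlgebra k Q)) (π : PathAlgebra k Q →ₐ[k] A) : Prop where
  surjective : Function.Surjective π
  map_eq_zero_iff : ∀ f, π f = 0 ↔ f ∈ I

namespace PathAlgebra

theorem IsAdmissible.le_lengthIdeal {I : Ideal (PathAlgebra k Q)} (hI : IsAdmissible I) :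
    I ≤ lengthIdeal k Q 2 := by
  obtain ⟨n, -, -, h⟩ := hI
  rwa [arrowIdeal_sq_eq] at h

theorem IsAdmissible.nilCoeff_eq_zero {I : Ideal (PathAlgebra k Q)} (hI : IsAdmissible I)
    {f : PathAlgebra k Q} (hf : f ∈ I) (x : Q) : nilCoeff k x f = 0 := by
  by_contra h
  simpa using hI.le_lengthIdeal hf x x _ h

end PathAlgebra

open PathAlgebra

theorem isPresentation_of_algEquiv (I : Ideal (PathAlgebra k Q)) [I.IsTwoSided]
    (Φ : (PathAlgebra k Q ⧸ I) ≃ₐ[k] A) :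
    IsPresentation I (Φ.toAlgHom.comp (Ideal.Quotient.mkₐ k I)) where
  surjective := Φ.surjective.comp (Ideal.Quotient.mkₐ_surjective k I)
  map_eq_zero_iff f := by
    change Φ (Ideal.Quotient.mk I f) = 0 ↔ _
    rw [EmbeddingLike.map_eq_zero_iff, Ideal.Quotient.eq_zero_iff_mem]

namespace IsPresentation

variable {I : Ideal (PathAlgebra k Q)} {π : PathAlgebra k Q →ₐ[k] A}

/-- Conjugating a presentation by a unit gives a presentation. -/
theorem exists_conj (hπ : IsPresentation I π) (u : Aˣ) :
    ∃ π' : PathAlgebra k Q →ₐ[k] A, IsPresentation I π' ∧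
      ∀ f, π' f = (u : A) * π f * (↑u⁻¹ : A) := by
  let π' : PathAlgebra k Q →ₐ[k] A := AlgHom.ofLinearMap
    (LinearMap.mulRight k (↑u⁻¹ : A) ∘ₗ LinearMap.mulLeft k (u : A) ∘ₗ π.toLinearMap)
    (by simp) (fun f g => by
      simp only [LinearMap.comp_apply, AlgHom.toLinearMap_apply, LinearMap.mulLeft_apply,
        LinearMap.mulRight_apply, map_mul]
      simp only [mul_assoc, Units.inv_mul_cancel_left])
  have h : ∀ f, π' f = (u : A) * π f * (↑u⁻¹ : A) := fun f => rfl
  refine ⟨π', ⟨fun a => ?_, fun f => ?_⟩, h⟩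
  · obtain ⟨f, hf⟩ := hπ.surjective (↑u⁻¹ * a * u)
    exact ⟨f, by rw [h, hf]; simp [mul_assoc]⟩
  · rw [h, ← hπ.map_eq_zero_iff, Units.mul_left_eq_zero, Units.mul_right_eq_zero]

theorem isNilpotent_of_mem_arrowIdeal (hπ : IsPresentation I π) (hI : IsAdmissible I)
    {f : PathAlgebra k Q} (hf : f ∈ arrowIdeal k Q) : IsNilpotent (π f) := by
  obtain ⟨n, -, hn, -⟩ := hI
  exact ⟨n, by rw [← map_pow, hπ.map_eq_zero_iff]; exact hn (Ideal.pow_mem_pow hf n)⟩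

theorem completeOrthogonalIdempotents (_ : IsPresentation I π) :
    CompleteOrthogonalIdempotents fun x : Q => π (ofPath k (Quiver.Path.nil : Quiver.Path x x)) :=
  (completeOrthogonalIdempotents_nil (k := k) (Q := Q)).map π.toRingHom

/-- The vertices of a presentation give a split family of idempotents. -/
theorem exists_splitFamily (hπ : IsPresentation I π) (hI : IsAdmissible I) :
    Nonempty (SplitFamily k fun x : Q => π (ofPath k (Quiver.Path.nil : Quiver.Path x x))) := by
  classical
  -- No trivial path occurs in an element of an admissible ideal, so the coefficients of trivial
  -- paths are functions on `A`.
  have hwd : ∀ (x : Q) (f g : PathAlgebra k Q), π f = π g → nilCoeff k x f = nilCoeff k x g := by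
    intro x f g h
    rw [← sub_eq_zero, ← map_sub]
    exact hI.nilCoeff_eq_zero ((hπ.map_eq_zero_iff _).1 (by rw [map_sub, h, sub_self])) x
  choose s hs using hπ.surjective
  let χ : Q → A →ₐ[k] k := fun x =>
    { toFun := fun a => nilCoeff k x (s a)
      map_one' := by rw [← map_one (nilCoeff k x)]; exact hwd x _ _ (by rw [hs, map_one])
      map_mul' := fun a b => by
        rw [← map_mul]; exact hwd x _ _ (by rw [hs, map_mul, hs, hs])
      map_zero' := by rw [← map_zero (nilCoeff k x)]; exact hwd x _ _ (by rw [hs, map_zero])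
      map_add' := fun a b => by
        rw [← map_add]; exact hwd x _ _ (by rw [hs, map_add, hs, hs])
      commutes' := fun c => by
        rw [← AlgHom.commutes (nilCoeff k x)]; exact hwd x _ _ (by rw [hs, AlgHom.commutes]) }
  have hχ : ∀ x f, χ x (π f) = nilCoeff k x f := fun x f => hwd x _ _ (hs _)
  refine ⟨⟨χ, fun x => ?_, fun x y hxy => ?_, ?_⟩⟩
  · rw [hχ, nilCoeff_apply, ofPath, incl_apply_self, Finsupp.single_eq_same]
  · rw [hχ, nilCoeff_apply, ofPath, incl_apply_of_ne _ fun h => hxy h.1, Finsupp.zero_apply]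
  · obtain ⟨n, -, hn, -⟩ := hI
    -- The image of the `m`-th power of the arrow ideal: it contains the `m`-th power of the common
    -- kernel and vanishes for `m = n`.
    let N : ℕ → Ideal A := fun m =>
      { carrier := {a | ∃ f ∈ arrowIdeal k Q ^ m, π f = a}
        add_mem' := by
          rintro _ _ ⟨f, hf, rfl⟩ ⟨g, hg, rfl⟩
          exact ⟨f + g, Ideal.add_mem _ hf hg, map_add _ _ _⟩
        zero_mem' := ⟨0, Ideal.zero_mem _, map_zero _⟩
        smul_mem' := by
          rintro a _ ⟨f, hf, rfl⟩
          exact ⟨s a * f, Ideal.mul_mem_left _ _ hf, by rw [map_mul, hs]; rfl⟩ }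
    have hle : ∀ m, (⨅ x, RingHom.ker (χ x) : Ideal A) ^ m ≤ N m := by
      intro m
      induction m with
      | zero =>
        intro a _
        refine ⟨s a, ?_, hs a⟩
        rw [Submodule.pow_zero, Ideal.one_eq_top]
        exact Submodule.mem_top
      | succ m ih =>
        rw [Submodule.pow_succ, Ideal.mul_le]
        intro a ha b hb
        obtain ⟨f, hf, rfl⟩ := ih ha
        refine ⟨f * s b, ?_, by rw [map_mul, hs]⟩
        rw [Submodule.pow_succ]
        refine Ideal.mul_mem_mul hf (mem_arrowIdeal_iff.2 fun x => ?_)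
        rw [Ideal.mem_iInf] at hb
        exact hb x
    refine ⟨n, le_bot_iff.1 ((hle n).trans ?_)⟩
    rintro _ ⟨f, hf, rfl⟩
    exact (hπ.map_eq_zero_iff f).2 (hn hf)

end IsPresentation

/-! Homogeneity of the ideal of relations. -/

variable {G : Type u} [Group G] (w : ∀ {x y : Q}, (x ⟶ y) → G)

/-- The weight function is constant on each minimal relation of `I`. -/
def IsRelationWeight (I : Ideal (PathAlgebra k Q)) (w : ∀ {x y : Q}, (x ⟶ y) → G) : Prop :=
  ∀ {x y : Q} {r : Quiver.Path x y →₀ k}, IsMinimalRelation I r →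
    ∀ p ∈ r.support, ∀ q ∈ r.support, pathWeight w p = pathWeight w q

open Classical in
/-- The component of weight `g` of an element of the path algebra. -/
noncomputable def weightComponent (g : G) : PathAlgebra k Q →ₗ[k] PathAlgebra k Q where
  toFun f x y := (f x y).filter fun p => pathWeight w p = g
  map_add' _ _ := PathAlgebra.ext fun _ _ => Finsupp.filter_add
  map_smul' _ _ := PathAlgebra.ext fun _ _ => Finsupp.filter_smul

open Classical in
theorem weightComponent_apply (g : G) (f : PathAlgebra k Q) (x y : Q) :
    weightComponent w g f x y = (f x y).filter fun p => pathWeight w p = g := rfl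

open Classical in
theorem weightComponent_incl (g : G) {x y : Q} (r : Quiver.Path x y →₀ k) :
    weightComponent w g (incl r) = incl (r.filter fun p => pathWeight w p = g) := by
  ext1 x' y'
  rw [weightComponent_apply]
  by_cases h : x' = x ∧ y' = y
  · obtain ⟨rfl, rfl⟩ := h
    rw [incl_apply_self, incl_apply_self]
  · rw [incl_apply_of_ne _ h, incl_apply_of_ne _ h, Finsupp.filter_zero]

-- Induction on a bound `n` for the size of the support. On a minimal relation the weight is
-- constant, so the component is all of `r` or zero. Otherwise a proper part `s` of `r` lies in `I`,
-- and both `s` and `r - s` have smaller support.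
open Classical in
theorem IsRelationWeight.incl_filter_mem {I : Ideal (PathAlgebra k Q)}
    (hw : IsRelationWeight I w) (g : G) {x y : Q} :
    ∀ (n : ℕ) (r : Quiver.Path x y →₀ k), r.support.card ≤ n → incl r ∈ I →
      incl (r.filter fun p => pathWeight w p = g) ∈ I := by
  intro n
  induction n with
  | zero =>
    intro r hr _
    have : r = 0 := Finsupp.support_eq_empty.1 (Finset.card_eq_zero.1 (Nat.le_zero.1 hr))
    rw [this, Finsupp.filter_zero, ← inclₗ_apply, map_zero]
    exact I.zero_mem
  | succ n ih =>
    intro r hr hrI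
    by_cases h0 : r = 0
    · rw [h0, Finsupp.filter_zero, ← inclₗ_apply, map_zero]
      exact I.zero_mem
    by_cases hmin : IsMinimalRelation I r
    · by_cases hg : ∃ p ∈ r.support, pathWeight w p = g
      · obtain ⟨p, hp, rfl⟩ := hg
        rw [(Finsupp.filter_eq_self_iff _ _).2 fun q hq =>
          hw hmin q (Finsupp.mem_support_iff.2 hq) p hp]
        exact hrI
      · push Not at hg
        rw [(Finsupp.filter_eq_zero_iff _ _).2 fun q hq => by
          by_contra hne
          exact hg q (Finsupp.mem_support_iff.2 hne) hq, ← inclₗ_apply, map_zero]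
        exact I.zero_mem
    · rw [IsMinimalRelation] at hmin
      push Not at hmin
      obtain ⟨S, hS, hSr, hSI⟩ := hmin h0 hrI
      set s : Quiver.Path x y →₀ k := ∑ p ∈ S, Finsupp.single p (r p) with hs
      have hsr : s = r.filter (· ∈ S) := by
        ext p
        rw [hs, Finsupp.finsetSum_apply, Finsupp.filter_apply]
        simp [Finsupp.single_apply]
      have hssupp : s.support = S := by
        rw [hsr, Finsupp.support_filter]
        ext p
        simp only [Finset.mem_filter]
        exact ⟨fun h => h.2, fun h => ⟨hSr.1 h, h⟩⟩
      have htsupp : (r - s).support ⊆ r.support \ S := by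
        intro p hp
        rw [Finsupp.mem_support_iff, Finsupp.sub_apply, hsr, Finsupp.filter_apply] at hp
        rw [Finset.mem_sdiff, Finsupp.mem_support_iff]
        by_cases hpS : p ∈ S
        · simp [hpS] at hp
        · simp only [hpS, if_false, sub_zero] at hp
          exact ⟨hp, hpS⟩
      have htI : incl (r - s) ∈ I := by
        rw [← inclₗ_apply, map_sub]
        exact I.sub_mem hrI hSI
      have hcard := Finset.card_lt_card hSr
      have h1 := ih s (by rw [hssupp]; omega) hSI
      have h2 := ih (r - s) (by
        have h3 := Finset.card_le_card htsupp
        rw [Finset.card_sdiff_of_subset hSr.1] at h3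
        have := hS.card_pos
        omega) htI
      have h3 := I.add_mem h1 h2
      rwa [← inclₗ_apply, ← inclₗ_apply, ← map_add, ← Finsupp.filter_add, add_sub_cancel] at h3

theorem IsRelationWeight.weightComponent_mem {I : Ideal (PathAlgebra k Q)} [I.IsTwoSided]
    (hw : IsRelationWeight I w) (g : G) {f : PathAlgebra k Q} (hf : f ∈ I) :
    weightComponent w g f ∈ I := by
  rw [← sum_incl f, map_sum]
  refine I.sum_mem fun x _ => ?_
  rw [map_sum]
  refine I.sum_mem fun y _ => ?_
  rw [weightComponent_incl]
  refine hw.incl_filter_mem w g _ _ le_rfl ?_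
  rw [← ofPath_nil_mul_mul_ofPath_nil]
  exact I.mul_mem_right _ (I.mul_mem_left _ hf)

theorem mul_mem_weightSpace {g h : G} {f f' : PathAlgebra k Q} (hf : f ∈ weightSpace k w g)
    (hf' : f' ∈ weightSpace k w h) : f * f' ∈ weightSpace k w (g * h) := by
  intro x y p hp
  rw [mul_apply, Finsupp.finsetSum_apply] at hp
  obtain ⟨z, -, hp⟩ := Finset.exists_ne_zero_of_sum_ne_zero hp
  obtain ⟨p₁, p₂, h₁, h₂, rfl⟩ := exists_of_concat_ne_zero hp
  rw [pathWeight_comp, hf _ _ _ h₂, hf' _ _ _ h₁]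

theorem weightComponent_of_mem_same {g : G} {f : PathAlgebra k Q} (hf : f ∈ weightSpace k w g) :
    weightComponent w g f = f := by
  classical
  ext1 x y
  rw [weightComponent_apply]
  exact (Finsupp.filter_eq_self_iff _ _).2 fun p hp => hf x y p hp

theorem weightComponent_of_mem_ne {g h : G} (hgh : g ≠ h) {f : PathAlgebra k Q}
    (hf : f ∈ weightSpace k w g) : weightComponent w h f = 0 := by
  classical
  ext1 x y
  rw [weightComponent_apply]
  refine (Finsupp.filter_eq_zero_iff _ _).2 fun p hp => ?_
  by_contra hne
  exact hgh ((hf x y p hne).symm.trans hp)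

/-- The weight spaces stay independent modulo `I` because `I` contains the weight components of its
elements. -/
theorem IsPresentation.isGroupGrading {I : Ideal (PathAlgebra k Q)} [I.IsTwoSided]
    {π : PathAlgebra k Q →ₐ[k] A} (hπ : IsPresentation I π) (hw : IsRelationWeight I w) :
    IsGroupGrading fun g => (weightSpace k w g).map π.toLinearMap where
  mul_mem := by
    rintro g h _ _ ⟨f, hf, rfl⟩ ⟨f', hf', rfl⟩
    exact ⟨f * f', mul_mem_weightSpace w hf hf', map_mul π f f'⟩
  iSup_eq_top := by
    rw [eq_top_iff]
    intro a _
    obtain ⟨f, rfl⟩ := hπ.surjective a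
    refine mem_of_forall_ofPath
      ((⨆ g, (weightSpace k w g).map π.toLinearMap).comap π.toLinearMap) f fun x y p _ => ?_
    exact Submodule.mem_iSup_of_mem (pathWeight w p) ⟨_, ofPath_mem_weightSpace w p, rfl⟩
  indep := by
    classical
    rw [iSupIndep_iff_finsetSum_eq_zero_imp_eq_zero]
    intro T c hc hsum g hg
    choose! f hf hfc using hc
    have hF : ∑ g ∈ T, f g ∈ I := by
      rw [← hπ.map_eq_zero_iff, map_sum, ← hsum]
      exact Finset.sum_congr rfl hfc
    have h1 := hw.weightComponent_mem w g hF
    rw [map_sum, Finset.sum_eq_single g, weightComponent_of_mem_same w (hf g hg),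
      ← hπ.map_eq_zero_iff] at h1
    · rw [← hfc g hg]; exact h1
    · exact fun h hh hne => weightComponent_of_mem_ne w hne (hf h hh)
    · exact fun h => absurd hg h

/-- A weight function on a presentation defines a covering grading, provided that all elements of
the group are weights of walks. -/
theorem IsPresentation.isCoveringGrading {I : Ideal (PathAlgebra k Q)} [I.IsTwoSided]
    {π : PathAlgebra k Q →ₐ[k] A} (hπ : IsPresentation I π) (hI : IsAdmissible I)
    (hw : IsRelationWeight I w)
    (hsurj : ∀ (x y : Quiver.Symmetrify Q) (g : G), ∃ p : Walk Q x y, walkWeight w p = g)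
    {ι : Type u} {e : ι → A} (χ : SplitFamily k e) (σ : Q ≃ ι)
    (hσ : ∀ x, π (ofPath k (Quiver.Path.nil : Quiver.Path x x)) = e (σ x)) :
    IsCoveringGrading χ fun g => (weightSpace k w g).map π.toLinearMap where
  toIsGroupGrading := hπ.isGroupGrading w hw
  idem_mem i := by
    obtain ⟨x, rfl⟩ := σ.surjective i
    exact ⟨_, ofPath_mem_weightSpace w (Quiver.Path.nil : Quiver.Path x x), hσ x⟩
  mem_rad := by
    rintro g hg _ ⟨f, hf, rfl⟩
    rw [χ.mem_rad]
    intro i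
    -- Trivial paths have weight `1`, so an element of weight `g ≠ 1` lies in the arrow ideal and
    -- its image is nilpotent.
    refine ((hπ.isNilpotent_of_mem_arrowIdeal hI (mem_arrowIdeal_iff.2 fun x => ?_)).map
      (χ.char i)).eq_zero
    by_contra hne
    exact hg (hf x x _ hne).symm
  connected := by
    have adj : ∀ {x y : Q} (α : x ⟶ y) (g : G), GradingAdj e
        (fun g => (weightSpace k w g).map π.toLinearMap) (σ x, g) (σ y, w α * g) := by
      intro x y α g
      refine ⟨π (arrow α), ?_, ?_, ?_, ?_⟩
      · rw [mul_inv_cancel_right]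
        refine ⟨arrow α, ?_, rfl⟩
        have := ofPath_mem_weightSpace (k := k) w α.toPath
        rwa [show pathWeight w α.toPath = w α from mul_one _] at this
      · rw [← hσ, ← map_mul, arrow_eq_ofPath, ofPath_mul_ofPath, Quiver.Path.comp_nil]
      · rw [← hσ, ← map_mul, arrow_eq_ofPath, ofPath_mul_ofPath, Quiver.Path.nil_comp]
      -- An arrow is nonzero in `A`, since only paths of length at least `2` occur in elements of
      -- `I`.
      · rw [Ne, hπ.map_eq_zero_iff]
        intro hmem
        have h1 := hI.le_lengthIdeal hmem x y α.toPath (by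
          rw [arrow_eq_ofPath, ofPath, incl_apply_self, Finsupp.single_eq_same]
          exact one_ne_zero)
        simp at h1
    have walk : ∀ {x y : Quiver.Symmetrify Q} (p : Walk Q x y) (g : G), Relation.ReflTransGen
        (fun p q => GradingAdj e (fun g => (weightSpace k w g).map π.toLinearMap) p q ∨
          GradingAdj e (fun g => (weightSpace k w g).map π.toLinearMap) q p)
        (σ x, g) (σ y, walkWeight w p * g) := by
      intro x y p g
      induction p with
      | nil =>
        rw [show walkWeight w (Quiver.Path.nil : Walk Q x x) * g = g from one_mul g]
      | @cons y z p α ih =>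
        refine ih.tail ?_
        rw [show walkWeight w (p.cons α) * g = symmWeight w α * (walkWeight w p * g) from
          mul_assoc _ _ _]
        rcases α with α | α
        · exact Or.inl (adj α _)
        · right
          have := adj α ((w α)⁻¹ * (walkWeight w p * g))
          rwa [mul_inv_cancel_left] at this
    rintro ⟨i, g⟩ ⟨j, h⟩
    obtain ⟨x, rfl⟩ := σ.surjective i
    obtain ⟨y, rfl⟩ := σ.surjective j
    obtain ⟨p, hp⟩ := hsurj x y (h * g⁻¹)
    have := walk p g
    rwa [hp, inv_mul_cancel_right] at this

end Presentations

/-! ### The covering attached to a nontrivial fundamental group -/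

section FundamentalGroupWeights

variable {k : Type u} [Field k] {Q : Type u} [Quiver.{u} Q] [Fintype Q]
  {I : Ideal (PathAlgebra k Q)}

theorem Homotopic.reverse_comp (I : Ideal (PathAlgebra k Q)) {x y : Quiver.Symmetrify Q}
    (p : Walk Q x y) : Homotopic I (p.reverse.comp p) (Quiver.Path.nil : Walk Q y y) := by
  have := Homotopic.comp_reverse I p.reverse
  rwa [Quiver.Path.reverse_reverse] at this

theorem Homotopic.comp_nil_comp_reverse (I : Ideal (PathAlgebra k Q)) {b x : Quiver.Symmetrify Q}
    (c : Walk Q b x) : Homotopic I (c.comp ((Quiver.Path.nil : Walk Q x x).comp c.reverse))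
      (Quiver.Path.nil : Walk Q b b) := by
  rw [Quiver.Path.nil_comp]
  exact Homotopic.comp_reverse I _

theorem Homotopic.insert_reverse_comp (I : Ideal (PathAlgebra k Q))
    {b x y z : Quiver.Symmetrify Q} (cx : Walk Q b x) (cy : Walk Q b y) (cz : Walk Q b z)
    (p : Walk Q x y) (q : Walk Q y z) :
    Homotopic I (cx.comp ((p.comp q).comp cz.reverse))
      ((cx.comp (p.comp cy.reverse)).comp (cy.comp (q.comp cz.reverse))) := by
  have h := (Homotopic.refl (I := I) (cx.comp p)).comp
    ((Homotopic.reverse_comp I cy).comp (Homotopic.refl (q.comp cz.reverse)))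
  simp only [Quiver.Path.nil_comp, Quiver.Path.comp_assoc] at h ⊢
  exact h.symm

theorem Homotopic.comp_conj (I : Ideal (PathAlgebra k Q)) {b x y : Quiver.Symmetrify Q}
    (cx : Walk Q b x) (cy : Walk Q b y) (q : Walk Q b b) :
    Homotopic I (cx.comp ((cx.reverse.comp (q.comp cy)).comp cy.reverse)) q := by
  have h := (Homotopic.comp_reverse I cx).comp
    ((Homotopic.refl (I := I) q).comp (Homotopic.comp_reverse I cy))
  simpa only [Quiver.Path.nil_comp, Quiver.Path.comp_nil, Quiver.Path.comp_assoc] using h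

/-- The class of the loop obtained from a walk by joining its ends to the base point. -/
def loopClass (I : Ideal (PathAlgebra k Q)) {x₀ : Q}
    (c : ∀ x : Quiver.Symmetrify Q, Walk Q (x₀ : Quiver.Symmetrify Q) x)
    {x y : Quiver.Symmetrify Q} (p : Walk Q x y) : FundamentalGrp I x₀ :=
  Quotient.mk (homotopySetoid I (x₀ : Quiver.Symmetrify Q) x₀)
    ((c x).comp (p.comp (c y).reverse))

variable {x₀ : Q} (c : ∀ x : Quiver.Symmetrify Q, Walk Q (x₀ : Quiver.Symmetrify Q) x)

theorem loopClass_eq {x y : Quiver.Symmetrify Q} {p q : Walk Q x y} (h : Homotopic I p q) :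
    loopClass I c p = loopClass I c q :=
  Quotient.sound ((Homotopic.refl _).comp (h.comp (Homotopic.refl _)))

theorem loopClass_nil (x : Quiver.Symmetrify Q) :
    loopClass I c (Quiver.Path.nil : Walk Q x x) = 1 :=
  Quotient.sound (Homotopic.comp_nil_comp_reverse I (c x))

theorem loopClass_comp {x y z : Quiver.Symmetrify Q} (p : Walk Q x y) (q : Walk Q y z) :
    loopClass I c (p.comp q) = loopClass I c q * loopClass I c p :=
  Quotient.sound (Homotopic.insert_reverse_comp I (c x) (c y) (c z) p q)

/-- The weight of an arrow in the fundamental group. -/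
def loopWeight (I : Ideal (PathAlgebra k Q)) {x₀ : Q}
    (c : ∀ x : Quiver.Symmetrify Q, Walk Q (x₀ : Quiver.Symmetrify Q) x) {x y : Q} (α : x ⟶ y) :
    FundamentalGrp I x₀ :=
  loopClass I c (Quiver.Hom.toPath α.toPos)

theorem symmWeight_loopWeight {x y : Quiver.Symmetrify Q} (α : x ⟶ y) :
    symmWeight (loopWeight I c) α = loopClass I c (Quiver.Hom.toPath α) := by
  rcases α with α | α
  · rfl
  · change (loopClass I c (Quiver.Hom.toPath α.toPos))⁻¹ =
      loopClass I c (Quiver.Hom.toPath α.toNeg)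
    rw [inv_eq_iff_mul_eq_one, ← loopClass_comp, loopClass_eq c (Homotopic.inv_arrow α),
      loopClass_nil]

/-- The connecting walks at the intermediate vertices cancel. -/
theorem walkWeight_loopWeight {x y : Quiver.Symmetrify Q} (p : Walk Q x y) :
    walkWeight (loopWeight I c) p = loopClass I c p := by
  induction p with
  | nil => exact (loopClass_nil c x).symm
  | cons p α ih =>
    have h : loopClass I c (p.cons α) = loopClass I c (Quiver.Hom.toPath α) * loopClass I c p :=
      loopClass_comp c p (Quiver.Hom.toPath α)
    rw [h, ← ih, ← symmWeight_loopWeight]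
    rfl

theorem isRelationWeight_loopWeight : IsRelationWeight I (loopWeight I c) := by
  intro x y r hr p hp q hq
  rw [← walkWeight_toWalk, ← walkWeight_toWalk]
  exact (walkWeight_loopWeight c p.toWalk).trans
    ((loopClass_eq c (Homotopic.minimal hr hp hq)).trans (walkWeight_loopWeight c q.toWalk).symm)

theorem exists_walkWeight_loopWeight_eq (x y : Quiver.Symmetrify Q) (g : FundamentalGrp I x₀) :
    ∃ p : Walk Q x y, walkWeight (loopWeight I c) p = g := by
  obtain ⟨q, rfl⟩ := Quotient.exists_rep g
  -- The walks added here cancel those that `loopClass` adds, leaving the loop `q`.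
  refine ⟨(c x).reverse.comp (q.comp (c y)), ?_⟩
  rw [walkWeight_loopWeight]
  exact Quotient.sound (Homotopic.comp_conj I (c x) (c y) q)

end FundamentalGroupWeights

/-! ### Connectedness of the quiver of a presentation, and the resulting covering -/

section ConnectedQuiver

open PathAlgebra

variable {k : Type u} [Field k] {Q : Type u} [Quiver.{u} Q] [Fintype Q]
  {A : Type u} [Ring A] [Algebra k A]

open Classical in
/-- The sum of the trivial paths at the vertices of a set. -/
noncomputable def vertexSum (k : Type u) [Field k] {Q : Type u} [Quiver.{u} Q] (S : Set Q) :
    PathAlgebra k Q :=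
  fun x y => if x ∈ S then (1 : PathAlgebra k Q) x y else 0

open Classical in
theorem vertexSum_mul_apply (S : Set Q) (f : PathAlgebra k Q) (x y : Q) :
    (vertexSum k S * f) x y = if y ∈ S then f x y else 0 := by
  rw [PathAlgebra.mul_apply, Finset.sum_eq_single y, vertexSum]
  · split_ifs
    · rw [one_apply_self, concat_nil]
    · rw [map_zero]
  · intro z _ hz
    rw [vertexSum, one_apply_of_ne hz, ite_self, map_zero]
  · simp

open Classical in
theorem mul_vertexSum_apply (S : Set Q) (f : PathAlgebra k Q) (x y : Q) :
    (f * vertexSum k S) x y = if x ∈ S then f x y else 0 := by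
  rw [PathAlgebra.mul_apply, Finset.sum_eq_single x, vertexSum]
  · split_ifs
    · rw [one_apply_self, nil_concat]
    · rw [map_zero, LinearMap.zero_apply]
  · intro z _ hz
    rw [vertexSum, one_apply_of_ne hz.symm, ite_self, map_zero, LinearMap.zero_apply]
  · simp

theorem vertexSum_isIdempotentElem (S : Set Q) : IsIdempotentElem (vertexSum k S) := by
  classical
  ext1 x y
  rw [mul_vertexSum_apply, vertexSum]
  split_ifs <;> rfl

theorem vertexSum_comm (S : Set Q) (hS : ∀ {x y : Q}, Quiver.Path x y → (x ∈ S ↔ y ∈ S))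
    (f : PathAlgebra k Q) : vertexSum k S * f = f * vertexSum k S := by
  classical
  ext1 x y
  rw [vertexSum_mul_apply, mul_vertexSum_apply]
  by_cases h0 : f x y = 0
  · rw [h0, ite_self, ite_self]
  · obtain ⟨p, -⟩ := Finsupp.ne_iff.1 h0
    simp only [hS p]

theorem nilCoeff_vertexSum (S : Set Q) {x : Q} (hx : x ∈ S) : nilCoeff k x (vertexSum k S) = 1 := by
  classical
  rw [nilCoeff_apply, vertexSum, if_pos hx, one_apply_self, Finsupp.single_eq_same]

theorem nilCoeff_vertexSum_of_notMem (S : Set Q) {x : Q} (hx : x ∉ S) :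
    nilCoeff k x (vertexSum k S) = 0 := by
  classical
  rw [nilCoeff_apply, vertexSum, if_neg hx, Finsupp.zero_apply]

/-- The quiver of a presentation of a connected algebra is connected. -/
theorem IsPresentation.nonempty_walk {I : Ideal (PathAlgebra k Q)} {π : PathAlgebra k Q →ₐ[k] A}
    (hπ : IsPresentation I π) (hI : IsAdmissible I) (hA : IsConnectedAlg A)
    (x₀ x : Quiver.Symmetrify Q) : Nonempty (Walk Q x₀ x) := by
  -- The sum of the trivial paths over a connected component is a central idempotent of `A`. It is
  -- not `0` because of `x₀`, so it is `1`, and no vertex is left out.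
  let S : Set Q := {x | Nonempty (Walk Q x₀ x)}
  have hS : ∀ {x y : Q}, Quiver.Path x y → (x ∈ S ↔ y ∈ S) := fun {x y} p =>
    ⟨fun ⟨q⟩ => ⟨q.comp p.toWalk⟩, fun ⟨q⟩ => ⟨q.comp p.toWalk.reverse⟩⟩
  have hx₀ : (x₀ : Q) ∈ S := ⟨Quiver.Path.nil⟩
  have hcenter : π (vertexSum k S) ∈ Subring.center A := by
    rw [Subring.mem_center_iff]
    intro a
    obtain ⟨f, rfl⟩ := hπ.surjective a
    rw [← map_mul, ← map_mul, vertexSum_comm S hS]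
  rcases hA.2 _ hcenter ((vertexSum_isIdempotentElem S).map π) with h | h
  · have := hI.nilCoeff_eq_zero ((hπ.map_eq_zero_iff _).1 h) x₀
    rw [nilCoeff_vertexSum S hx₀] at this
    exact absurd this one_ne_zero
  · have h1 : π (1 - vertexSum k S) = 0 := by rw [map_sub, map_one, h, sub_self]
    have h2 := hI.nilCoeff_eq_zero ((hπ.map_eq_zero_iff _).1 h1) x
    by_contra hx
    rw [map_sub, map_one, nilCoeff_vertexSum_of_notMem S hx, sub_zero] at h2
    exact one_ne_zero h2

/-- A presentation with nontrivial fundamental group defines a proper Galois covering. -/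
theorem IsPresentation.hasProperGaloisCovering [FiniteDimensional k A]
    {I : Ideal (PathAlgebra k Q)} [I.IsTwoSided] {π : PathAlgebra k Q →ₐ[k] A}
    (hπ : IsPresentation I π) (hI : IsAdmissible I) (hA : IsConnectedAlg A)
    {ι : Type u} [Fintype ι] {e : ι → A} (he : CompleteOrthogonalIdempotents e)
    (χ : SplitFamily k e) (x₀ : Q) (hπ₁ : ¬ Subsingleton (FundamentalGrp I x₀)) :
    HasProperGaloisCovering k (IdemCat k he) := by
  obtain ⟨ψ⟩ := hπ.exists_splitFamily hI
  obtain ⟨σ, u, hu⟩ := χ.exists_conj he hπ.completeOrthogonalIdempotents ψ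
  -- Conjugation takes the vertices exactly to the given `e i` without changing `I`, so the
  -- fundamental group stays the same.
  obtain ⟨π', hπ', hconj⟩ := hπ.exists_conj u
  have hσ : ∀ x, π' (ofPath k (Quiver.Path.nil : Quiver.Path x x)) = e (σ x) := fun x => by
    rw [hconj, hu, mul_assoc, Units.mul_inv, mul_one]
  let c : ∀ x : Quiver.Symmetrify Q, Walk Q (x₀ : Quiver.Symmetrify Q) x := fun x =>
    (hπ.nonempty_walk hI hA x₀ x).some
  have hD := hπ'.isCoveringGrading (loopWeight I c) hI (isRelationWeight_loopWeight c)
    (exists_walkWeight_loopWeight_eq c) χ σ hσ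
  have : Nontrivial (FundamentalGrp I x₀) := not_subsingleton_iff_nontrivial.1 hπ₁
  have : Nonempty ι := ⟨σ x₀⟩
  exact hD.hasProperGaloisCovering he

end ConnectedQuiver

/-! ### Homogeneous presentations -/

section HomogeneousPresentations

open PathAlgebra

variable {k : Type u} [Field k] {A : Type u} [Ring A] [Algebra k A] {ι : Type u} [Fintype ι]
  {e : ι → A} {χ : SplitFamily k e} {G : Type u} [Group G] {D : G → Submodule k A}

/-- Elements associated with the arrows of a quiver which form bases of the radical modulo its
square. -/
structure IsArrowSystem [Quiver.{u} ι] (χ : SplitFamily k e)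
    (a : ∀ {x y : ι}, (x ⟶ y) → A) : Prop where
  mem_rad : ∀ {x y : ι} (α : x ⟶ y), a α ∈ χ.rad
  idem_mul : ∀ {x y : ι} (α : x ⟶ y), e y * a α = a α
  mul_idem : ∀ {x y : ι} (α : x ⟶ y), a α * e x = a α
  span : ∀ {x y : ι} {b : A}, b ∈ χ.rad → e y * b = b → b * e x = b →
    ∃ t ∈ Submodule.span k (Set.range (a : (x ⟶ y) → A)), b - t ∈ χ.rad * χ.rad
  linearIndependent : ∀ x y : ι, LinearIndependent k
    fun α : x ⟶ y => ((χ.rad * χ.rad).restrictScalars k).mkQ (a α)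

namespace IsArrowSystem

variable [Quiver.{u} ι] {a : ∀ {x y : ι}, (x ⟶ y) → A}

/-- The morphism from the path algebra defined by an arrow system. -/
noncomputable def hom (ha : IsArrowSystem χ a) (he : CompleteOrthogonalIdempotents e) :
    PathAlgebra k ι →ₐ[k] A :=
  liftHom he ha.idem_mul

theorem hom_incl (ha : IsArrowSystem χ a) (he : CompleteOrthogonalIdempotents e) {x y : ι}
    (r : Quiver.Path x y →₀ k) :
    ha.hom he (incl r) = Finsupp.linearCombination k (pathValue e a) r :=
  liftHom_incl he ha.idem_mul r

theorem hom_ofPath (ha : IsArrowSystem χ a) (he : CompleteOrthogonalIdempotents e) {x y : ι}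
    (p : Quiver.Path x y) : ha.hom he (ofPath k p) = pathValue e a p :=
  liftHom_ofPath he ha.idem_mul p

theorem pathValue_toPath (ha : IsArrowSystem χ a) {x y : ι} (α : x ⟶ y) :
    pathValue e a α.toPath = a α := ha.mul_idem α

theorem hom_arrow (ha : IsArrowSystem χ a) (he : CompleteOrthogonalIdempotents e) {x y : ι}
    (α : x ⟶ y) : ha.hom he (arrow α) = a α := by
  rw [arrow_eq_ofPath, hom_ofPath, ha.pathValue_toPath]

theorem exists_sub_mem (ha : IsArrowSystem χ a) (he : CompleteOrthogonalIdempotents e) {b : A}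
    (hb : b ∈ χ.rad) : ∃ f, b - ha.hom he f ∈ χ.rad * χ.rad := by
  have key : ∀ x y, ∃ f, e y * b * e x - ha.hom he f ∈ χ.rad * χ.rad := by
    intro x y
    obtain ⟨t, ht, hbt⟩ := ha.span (x := x) (y := y) (b := e y * b * e x)
      (Ideal.mul_mem_right _ _ (Ideal.mul_mem_left _ _ hb))
      (by simp only [← mul_assoc, (he.idem y).eq]) (by rw [mul_assoc, (he.idem x).eq])
    have hle : Submodule.span k (Set.range (a : (x ⟶ y) → A)) ≤
        LinearMap.range (ha.hom he).toLinearMap := by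
      rw [Submodule.span_le]
      rintro _ ⟨α, rfl⟩
      exact ⟨arrow α, ha.hom_arrow he α⟩
    obtain ⟨f, rfl⟩ := hle ht
    exact ⟨f, hbt⟩
  choose f hf using key
  refine ⟨∑ x, ∑ y, f x y, ?_⟩
  have hsum : b - ha.hom he (∑ x, ∑ y, f x y) =
      ∑ x, ∑ y, (e y * b * e x - ha.hom he (f x y)) := by
    simp only [map_sum, Finset.sum_sub_distrib, SectionedGaloisCovering.sum_corners he b]
  rw [hsum]
  exact Ideal.sum_mem _ fun x _ => Ideal.sum_mem _ fun y _ => hf x y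

/-- Approximations multiply: `r * s - f * g = (r - f) * s + f * (s - g)`, and both terms lie one
power deeper than `r * s`. -/
theorem exists_sub_mem_pow (ha : IsArrowSystem χ a) (he : CompleteOrthogonalIdempotents e)
    (m : ℕ) : ∀ b ∈ χ.rad ^ (m + 1), ∃ f, b - ha.hom he f ∈ χ.rad ^ (m + 2) := by
  induction m with
  | zero =>
    intro b hb
    rw [zero_add, Submodule.pow_one] at hb
    have h2 : χ.rad ^ (0 + 2) = χ.rad * χ.rad := by
      rw [zero_add, ← one_add_one_eq_two, Submodule.pow_succ, Submodule.pow_one]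
    rw [h2]
    exact ha.exists_sub_mem he hb
  | succ m ih =>
    intro b hb
    rw [Submodule.pow_succ] at hb
    refine Submodule.smul_induction_on hb ?_ ?_
    · intro r hr s hs
      obtain ⟨f, hf⟩ := ih r hr
      obtain ⟨g, hg⟩ := ha.exists_sub_mem he hs
      refine ⟨f * g, ?_⟩
      have hfm : ha.hom he f ∈ χ.rad ^ (m + 1) := by
        have h1 : r - ha.hom he f ∈ χ.rad ^ (m + 1) := by
          rw [show m + 2 = (m + 1) + 1 from rfl, Submodule.pow_succ] at hf
          exact Ideal.mul_le_left hf
        have := Ideal.sub_mem _ hr h1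
        rwa [sub_sub_cancel] at this
      have hsplit : r • s - ha.hom he (f * g) =
          (r - ha.hom he f) * s + ha.hom he f * (s - ha.hom he g) := by
        rw [map_mul, smul_eq_mul]; noncomm_ring
      rw [hsplit]
      refine Ideal.add_mem _ ?_ ?_
      · rw [show m + 1 + 2 = (m + 2) + 1 from rfl, Submodule.pow_succ]
        exact Ideal.mul_mem_mul hf hs
      · have h2 : χ.rad ^ 2 = χ.rad * χ.rad := by
          rw [← one_add_one_eq_two, Submodule.pow_succ, Submodule.pow_one]
        rw [Submodule.pow_add _ two_ne_zero, h2]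
        exact Ideal.mul_mem_mul hfm hg
    · rintro b b' ⟨f, hf⟩ ⟨f', hf'⟩
      refine ⟨f + f', ?_⟩
      rw [map_add, add_sub_add_comm]
      exact Ideal.add_mem _ hf hf'

/-- Successive approximation along the powers of the radical, which stops because the radical is
nilpotent. Modulo the radical, trivial paths suffice. -/
theorem hom_surjective (ha : IsArrowSystem χ a) (he : CompleteOrthogonalIdempotents e) :
    Function.Surjective (ha.hom he) := by
  have key : ∀ m, ∀ b ∈ χ.rad, ∃ f, b - ha.hom he f ∈ χ.rad ^ (m + 1) := by
    intro m b hb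
    induction m with
    | zero => exact ⟨0, by rwa [map_zero, sub_zero, zero_add, Submodule.pow_one]⟩
    | succ m ih =>
      obtain ⟨f, hf⟩ := ih
      obtain ⟨g, hg⟩ := ha.exists_sub_mem_pow he m _ hf
      exact ⟨f + g, by rwa [map_add, ← sub_sub]⟩
  intro b
  obtain ⟨n, hn⟩ := χ.exists_rad_pow_eq_bot
  obtain ⟨f, hf⟩ := key n _ (χ.sub_sum_mem_rad b)
  rw [Submodule.pow_succ, hn, Submodule.bot_mul, Submodule.mem_bot, sub_eq_zero] at hf
  refine ⟨f + ∑ i, χ.char i b • ofPath k (Quiver.Path.nil : Quiver.Path i i), ?_⟩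
  rw [map_add, ← hf, map_sum]
  simp only [map_smul, hom_ofPath, pathValue]
  rw [sub_add_cancel]

instance (ha : IsArrowSystem χ a) (he : CompleteOrthogonalIdempotents e) :
    (Ideal.comap (ha.hom he) χ.rad).IsTwoSided :=
  ⟨fun b hb => by
    rw [Ideal.mem_comap, map_mul]
    exact Ideal.mul_mem_right _ _ hb⟩

theorem hom_mem_rad (ha : IsArrowSystem χ a) (he : CompleteOrthogonalIdempotents e)
    {f : PathAlgebra k ι} (hf : f ∈ arrowIdeal k ι) : ha.hom he f ∈ χ.rad :=
  arrowIdeal_le (J := Ideal.comap (ha.hom he) χ.rad)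
    (fun x y α => by rw [Ideal.mem_comap, hom_arrow]; exact ha.mem_rad α) hf

theorem hom_mem_rad_pow (ha : IsArrowSystem χ a) (he : CompleteOrthogonalIdempotents e) (m : ℕ) :
    ∀ f ∈ arrowIdeal k ι ^ m, ha.hom he f ∈ χ.rad ^ m := by
  induction m with
  | zero =>
    intro f _
    rw [Submodule.pow_zero, Ideal.one_eq_top]
    exact Submodule.mem_top
  | succ m ih =>
    intro f hf
    rw [Submodule.pow_succ] at hf ⊢
    refine Submodule.smul_induction_on hf ?_ ?_
    · intro r hr s hs
      rw [smul_eq_mul, map_mul]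
      exact Ideal.mul_mem_mul (ih r hr) (ha.hom_mem_rad he hs)
    · intro f g hf hg
      rw [map_add]
      exact Ideal.add_mem _ hf hg

theorem char_hom (ha : IsArrowSystem χ a) (he : CompleteOrthogonalIdempotents e) (y : ι)
    (f : PathAlgebra k ι) : χ.char y (ha.hom he f) = nilCoeff k y f := by
  classical
  have nilCoeff_nil : ∀ y x : ι, nilCoeff k y (ofPath k (Quiver.Path.nil : Quiver.Path x x)) =
      if y = x then 1 else 0 := by
    intro y x
    split_ifs with h
    · subst h
      rw [nilCoeff_apply, ofPath, incl_apply_self, Finsupp.single_eq_same]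
    · rw [nilCoeff_apply, ofPath, incl_apply_of_ne _ fun h' => h h'.1, Finsupp.zero_apply]
  have hmem : f - ∑ x, nilCoeff k x f • ofPath k (Quiver.Path.nil : Quiver.Path x x) ∈
      arrowIdeal k ι := by
    rw [mem_arrowIdeal_iff]
    intro y
    simp [map_sub, map_sum, nilCoeff_nil]
  have h := χ.mem_rad.1 (ha.hom_mem_rad he hmem) y
  rw [map_sub, map_sub, sub_eq_zero] at h
  rw [h, map_sum, map_sum, Finset.sum_eq_single y]
  · rw [map_smul, map_smul, hom_ofPath, pathValue, χ.char_self, smul_eq_mul, mul_one]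
  · intro x _ hx
    rw [map_smul, map_smul, hom_ofPath, pathValue, χ.char_of_ne _ _ hx.symm, smul_zero]
  · simp

theorem hom_incl_apply_eq_zero (ha : IsArrowSystem χ a) (he : CompleteOrthogonalIdempotents e)
    {f : PathAlgebra k ι} (hf : ha.hom he f = 0) (x y : ι) : ha.hom he (incl (f x y)) = 0 := by
  rw [← ofPath_nil_mul_mul_ofPath_nil, map_mul, map_mul, hf, mul_zero, zero_mul]

theorem pathValue_mem_rad_mul_rad (ha : IsArrowSystem χ a) (he : CompleteOrthogonalIdempotents e)
    {x y : ι} {p : Quiver.Path x y} (hp : 2 ≤ p.length) : pathValue e a p ∈ χ.rad * χ.rad := by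
  cases p with
  | nil => simp at hp
  | cons p α =>
    refine Ideal.mul_mem_mul (ha.mem_rad α) ?_
    rw [← ha.hom_ofPath he]
    exact ha.hom_mem_rad he (ofPath_mem_arrowIdeal (by simpa using hp))

/-- For a pair of vertices, write the element as a combination `s` of arrows plus a combination `t`
of longer paths. As `t` is sent to the square of the radical, so is `s`, and independence of the
arrows modulo that square forces `s = 0`. This gives the inclusion of the kernel in the square of
the arrow ideal. -/
theorem apply_toPath_eq_zero (ha : IsArrowSystem χ a) (he : CompleteOrthogonalIdempotents e)
    {f : PathAlgebra k ι} (hf : ha.hom he f = 0) {x y : ι} (α : x ⟶ y) :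
    f x y α.toPath = 0 := by
  classical
  have hinj : Function.Injective (Quiver.Hom.toPath : (x ⟶ y) → Quiver.Path x y) := by
    intro α β h
    exact eq_of_heq (Quiver.Path.hom_heq_of_cons_eq_cons h)
  have hnil : ∀ {z : ι} (p : Quiver.Path x z), p.length = 0 → f x z p = 0 := by
    intro z p hp
    cases p with
    | nil => rw [← nilCoeff_apply, ← ha.char_hom he, hf, map_zero]
    | cons p β => simp at hp
  have hone : ∀ {z : ι} (p : Quiver.Path x z), p.length = 1 → ∃ β, p = Quiver.Hom.toPath β := by
    intro z p hp
    match p, hp with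
    | .cons .nil β, _ => exact ⟨β, rfl⟩
    | .cons (.cons p γ) β, hp => simp at hp
  let r := f x y
  let s : (x ⟶ y) →₀ k := r.comapDomain Quiver.Hom.toPath hinj.injOn
  let t : Quiver.Path x y →₀ k := r - s.mapDomain Quiver.Hom.toPath
  have ht : ∀ p ∈ t.support, 2 ≤ p.length := by
    intro p hp
    rw [Finsupp.mem_support_iff] at hp
    by_contra hlen
    refine hp ?_
    rw [Finsupp.sub_apply]
    rcases Nat.lt_succ_iff.1 (not_le.1 hlen) |>.lt_or_eq with hlen | hlen
    · rw [hnil p (Nat.lt_one_iff.1 hlen), Finsupp.mapDomain_of_notMem_range, sub_zero]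
      rintro ⟨β, rfl⟩
      simp at hlen
    · obtain ⟨β, rfl⟩ := hone p hlen
      rw [Finsupp.mapDomain_apply hinj, Finsupp.comapDomain_apply]
      exact sub_self _
  have hsum : r = s.mapDomain Quiver.Hom.toPath + t := by simp [t]
  have h0 : Finsupp.linearCombination k (pathValue e a) r = 0 := by
    rw [← ha.hom_incl he]
    exact ha.hom_incl_apply_eq_zero he hf x y
  have h1 : Finsupp.linearCombination k (pathValue e a) t ∈
      (χ.rad * χ.rad).restrictScalars k := by
    rw [Finsupp.linearCombination_apply]
    exact Submodule.sum_mem _ fun p hp =>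
      Submodule.smul_mem _ _ (ha.pathValue_mem_rad_mul_rad he (ht p hp))
  have h2 : Finsupp.linearCombination k
      (fun α : x ⟶ y => ((χ.rad * χ.rad).restrictScalars k).mkQ (a α)) s = 0 := by
    have h3 : Finsupp.linearCombination k (fun α : x ⟶ y => a α) s ∈
        (χ.rad * χ.rad).restrictScalars k := by
      rw [hsum, map_add, Finsupp.linearCombination_mapDomain] at h0
      have h4 : (pathValue e a ∘ Quiver.Hom.toPath : (x ⟶ y) → A) = fun α => a α :=
        funext fun α => ha.pathValue_toPath α
      rw [h4] at h0
      rw [eq_neg_of_add_eq_zero_left h0]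
      exact Submodule.neg_mem _ h1
    rw [← Submodule.Quotient.mk_eq_zero, ← Submodule.mkQ_apply, Finsupp.apply_linearCombination]
      at h3
    exact h3
  have h3 := linearIndependent_iff.1 (ha.linearIndependent x y) s h2
  have h4 : s α = 0 := by rw [h3]; rfl
  exact h4

/-- The kernel of the morphism defined by an arrow system is admissible. -/
theorem isAdmissible_ker (ha : IsArrowSystem χ a) (he : CompleteOrthogonalIdempotents e) :
    IsAdmissible (RingHom.ker (ha.hom he)) := by
  obtain ⟨n, hn⟩ := χ.exists_rad_pow_eq_bot
  -- The `n`-th power of the radical is already zero; `+ 2` meets the lower bound in the definition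
  -- of admissibility.
  refine ⟨n + 2, Nat.le_add_left 2 n, fun f hf => ?_, fun f hf => ?_⟩
  · have := ha.hom_mem_rad_pow he _ f hf
    rw [show n + 2 = n + 1 + 1 from rfl, Submodule.pow_succ, Submodule.pow_succ, hn,
      Submodule.bot_mul, Submodule.bot_mul, Submodule.mem_bot] at this
    exact this
  · rw [arrowIdeal_sq_eq]
    have hf0 : ha.hom he f = 0 := hf
    intro x y p hp
    by_contra hlen
    refine hp ?_
    match p, hlen with
    | .nil, _ => rw [← nilCoeff_apply, ← ha.char_hom he, hf0, map_zero]
    | .cons .nil β, _ => exact ha.apply_toPath_eq_zero he hf0 β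
    | .cons (.cons p γ) β, hlen => simp at hlen

variable {w : ∀ {x y : ι}, (x ⟶ y) → G}

theorem pathValue_mem (hD : IsCoveringGrading χ D)
    (hw : ∀ {x y : ι} (α : x ⟶ y), a α ∈ D (w α)) {x y : ι} (p : Quiver.Path x y) :
    pathValue e a p ∈ D (pathWeight w p) := by
  induction p with
  | nil => exact hD.idem_mem x
  | cons p α ih => exact hD.mul_mem (hw α) ih

open Classical in
theorem sum_filter_mem (hD : IsCoveringGrading χ D)
    (hw : ∀ {x y : ι} (α : x ⟶ y), a α ∈ D (w α)) {x y : ι} (r : Quiver.Path x y →₀ k) (g : G) :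
    ∑ p ∈ r.support.filter (fun p => pathWeight w p = g), r p • pathValue e a p ∈ D g := by
  refine Submodule.sum_mem _ fun p hp => Submodule.smul_mem _ _ ?_
  have := pathValue_mem hD hw p
  rwa [(Finset.mem_filter.1 hp).2] at this

open Classical in
theorem sum_sum_filter {x y : ι} (r : Quiver.Path x y →₀ k) :
    ∑ g ∈ r.support.image (fun p => pathWeight w p),
      ∑ p ∈ r.support.filter (fun p => pathWeight w p = g), r p • pathValue e a p =
    Finsupp.linearCombination k (pathValue e a) r := by
  rw [Finsupp.linearCombination_apply, Finsupp.sum]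
  exact Finset.sum_fiberwise_of_maps_to (fun p hp => Finset.mem_image_of_mem _ hp) _

/-- The weights of homogeneous arrows are constant on minimal relations. -/
theorem isRelationWeight (ha : IsArrowSystem χ a) (he : CompleteOrthogonalIdempotents e)
    (hD : IsCoveringGrading χ D) (hw : ∀ {x y : ι} (α : x ⟶ y), a α ∈ D (w α)) :
    IsRelationWeight (RingHom.ker (ha.hom he)) w := by
  classical
  intro x y r hr p hp q hq
  by_contra hne
  have h0 : Finsupp.linearCombination k (pathValue e a) r = 0 := by
    rw [← ha.hom_incl he]; exact hr.2.1
  rw [← sum_sum_filter (w := w)] at h0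
  -- Each homogeneous part of a relation is a relation. The part with the weight of `p` is proper
  -- because it omits `q`, which contradicts minimality.
  have hz := hD.eq_zero_of_sum (t := id) Function.injective_id _ _
    (fun g _ => sum_filter_mem hD hw r g) h0 (pathWeight w p) (Finset.mem_image_of_mem _ hp)
  refine hr.2.2 (r.support.filter fun p' => pathWeight w p' = pathWeight w p)
    ⟨p, Finset.mem_filter.2 ⟨hp, rfl⟩⟩ ?_ ?_
  · refine Finset.filter_ssubset.2 ⟨q, hq, fun h => hne h.symm⟩
  · change ha.hom he _ = 0
    rw [ha.hom_incl he, map_sum, ← hz]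
    exact Finset.sum_congr rfl fun p' _ => Finsupp.linearCombination_single _ _ _

/-- A nonzero homogeneous element of a corner is a combination of path values, and its degree must
be the weight of one of these paths. -/
theorem exists_path_of_gradingAdj (ha : IsArrowSystem χ a)
    (he : CompleteOrthogonalIdempotents e) (hD : IsCoveringGrading χ D)
    (hw : ∀ {x y : ι} (α : x ⟶ y), a α ∈ D (w α)) {p q : ι × G} (h : GradingAdj e D p q) :
    ∃ c : Quiver.Path p.1 q.1, pathWeight w c = q.2 * p.2⁻¹ := by
  classical
  obtain ⟨b, hb, h1, h2, h0⟩ := h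
  obtain ⟨f, rfl⟩ := ha.hom_surjective he b
  have hsum : Finsupp.linearCombination k (pathValue e a) (f p.1 q.1) = ha.hom he f := by
    rw [← ha.hom_incl he, ← ofPath_nil_mul_mul_ofPath_nil, map_mul, map_mul, hom_ofPath,
      hom_ofPath, pathValue, pathValue, h1, h2]
  rw [← sum_sum_filter (w := w)] at hsum
  obtain ⟨g, hg, rfl, -⟩ := hD.eq_of_sum_eq (t := id) Function.injective_id _ _
    (fun g _ => sum_filter_mem hD hw (f p.1 q.1) g) hb hsum h0
  obtain ⟨c, -, hc⟩ := Finset.mem_image.1 hg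
  exact ⟨c, hc⟩

theorem exists_walk (ha : IsArrowSystem χ a)
    (he : CompleteOrthogonalIdempotents e) (hD : IsCoveringGrading χ D)
    (hw : ∀ {x y : ι} (α : x ⟶ y), a α ∈ D (w α)) {p q : ι × G}
    (h : Relation.ReflTransGen (fun p q => GradingAdj e D p q ∨ GradingAdj e D q p) p q) :
    ∃ c : Walk ι (p.1 : Quiver.Symmetrify ι) q.1, walkWeight w c = q.2 * p.2⁻¹ := by
  induction h with
  | refl => exact ⟨Quiver.Path.nil, (mul_inv_cancel _).symm⟩
  | @tail q q' _ hq ih =>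
    obtain ⟨c, hc⟩ := ih
    have step : ∃ d : Walk ι (q.1 : Quiver.Symmetrify ι) q'.1,
        walkWeight w d = q'.2 * q.2⁻¹ := by
      rcases hq with hq | hq
      · obtain ⟨d, hd⟩ := ha.exists_path_of_gradingAdj he hD hw hq
        exact ⟨d.toWalk, (walkWeight_toWalk w d).trans hd⟩
      · obtain ⟨d, hd⟩ := ha.exists_path_of_gradingAdj he hD hw hq
        refine ⟨d.toWalk.reverse, ?_⟩
        -- A walk followed by its reverse is homotopic to a trivial walk, so their weights are
        -- inverse to each other.
        have h1 := (Homotopic.comp_reverse (RingHom.ker (ha.hom he)) d.toWalk).walkWeight_eq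
          (w := w) (ha.isRelationWeight he hD hw)
        have h2 : walkWeight w d.toWalk.reverse * walkWeight w d.toWalk = 1 :=
          (pathWeight_comp _ _ _).symm.trans h1
        rw [walkWeight_toWalk, hd] at h2
        rw [eq_inv_of_mul_eq_one_left h2, mul_inv_rev, inv_inv]
    obtain ⟨d, hd⟩ := step
    refine ⟨c.comp d, (pathWeight_comp _ _ _).trans ?_⟩
    refine (congrArg₂ (· * ·) hd hc).trans ?_
    rw [mul_assoc, inv_mul_cancel_left]

/-- If the arrows are homogeneous for a covering grading by a nontrivial group, the fundamental
group is not trivial. -/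
theorem not_subsingleton_fundamentalGrp (ha : IsArrowSystem χ a)
    (he : CompleteOrthogonalIdempotents e) (hD : IsCoveringGrading χ D)
    (hw : ∀ {x y : ι} (α : x ⟶ y), a α ∈ D (w α)) [Nontrivial G] (x₀ : ι) :
    ¬ Subsingleton (FundamentalGrp (RingHom.ker (ha.hom he)) x₀) := by
  intro hss
  obtain ⟨g, hg⟩ := exists_ne (1 : G)
  -- A closed walk at `x₀` of weight `g ≠ 1`; it cannot be homotopic to the trivial walk.
  obtain ⟨c, hc⟩ := ha.exists_walk he hD hw (hD.connected (x₀, 1) (x₀, g))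
  rw [inv_one, mul_one] at hc
  have h : Homotopic (RingHom.ker (ha.hom he)) c Quiver.Path.nil :=
    Quotient.exact (hss.elim (Quotient.mk _ c) (Quotient.mk _ Quiver.Path.nil))
  have := h.walkWeight_eq (w := w) (ha.isRelationWeight he hD hw)
  rw [hc] at this
  exact hg this

end IsArrowSystem

/-- The radical is spanned by homogeneous elements. -/
theorem IsCoveringGrading.mem_span_homogeneous (he : CompleteOrthogonalIdempotents e)
    (hD : IsCoveringGrading χ D) {x y : ι} {b : A} (hb : b ∈ χ.rad) (h1 : e y * b = b)
    (h2 : b * e x = b) :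
    b ∈ Submodule.span k {a : A | a ∈ χ.rad ∧ e y * a = a ∧ a * e x = a ∧ ∃ g, a ∈ D g} := by
  classical
  obtain ⟨c, hc, hsum⟩ := hD.exists_sum b
  have hcD : ∀ g, e y * c g * e x ∈ D g := fun g => by
    simpa using hD.mul_mem (hD.mul_mem (hD.idem_mem y) (hc g)) (hD.idem_mem x)
  have hsum' : ∑ g ∈ c.support, e y * c g * e x = b := by
    rw [← Finset.sum_mul, ← Finset.mul_sum, hsum, h1, h2]
  have hne : ∀ g, g ≠ 1 → e y * c g * e x ∈ χ.rad := fun g hg => hD.mem_rad hg (hcD g)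
  -- The components of degree other than `1` lie in the radical by assumption, and the one of degree
  -- `1` is the difference between `b` and their sum.
  have hrad : ∀ g ∈ c.support, e y * c g * e x ∈ χ.rad := by
    intro g hg
    by_cases hg1 : g = 1
    · subst hg1
      rw [← Finset.add_sum_erase _ _ hg] at hsum'
      rw [eq_sub_of_add_eq hsum']
      exact Ideal.sub_mem _ hb
        (Ideal.sum_mem _ fun h hh => hne h (Finset.ne_of_mem_erase hh))
    · exact hne g hg1
  rw [← hsum']
  refine Submodule.sum_mem _ fun g hg => Submodule.subset_span ⟨hrad g hg, ?_, ?_, g, hcD g⟩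
  · simp only [← mul_assoc, (he.idem y).eq]
  · rw [mul_assoc, (he.idem x).eq]

/-- There is a quiver with an arrow system formed of homogeneous elements. -/
theorem IsCoveringGrading.exists_isArrowSystem [FiniteDimensional k A]
    (he : CompleteOrthogonalIdempotents e) (hD : IsCoveringGrading χ D) :
    ∃ (_ : Quiver.{u} ι) (_ : ∀ x y : ι, Finite (x ⟶ y)) (a : ∀ {x y : ι}, (x ⟶ y) → A)
      (w : ∀ {x y : ι}, (x ⟶ y) → G),
      IsArrowSystem χ a ∧ ∀ {x y : ι} (α : x ⟶ y), a α ∈ D (w α) := by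
  let H : ι → ι → Set A := fun x y =>
    {a : A | a ∈ χ.rad ∧ e y * a = a ∧ a * e x = a ∧ ∃ g, a ∈ D g}
  let N : Submodule k A := (χ.rad * χ.rad).restrictScalars k
  -- The arrows `x ⟶ y` are homogeneous elements of the radical chosen so that their classes modulo
  -- its square are independent and span the same subspace as the classes of all such elements.
  choose κ s hinj hspan hli using fun x y : ι =>
    exists_linearIndependent' k fun b : H x y => N.mkQ b.1
  let q : Quiver.{u} ι := ⟨κ⟩
  let a : ∀ {x y : ι}, (x ⟶ y) → A := fun {x y} α => (s x y α).1
  choose w hw using fun (x y : ι) (α : κ x y) => (s x y α).2.2.2.2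
  have hfin : ∀ x y : ι, Finite (x ⟶ y) := fun x y => (hli x y).finite
  refine ⟨q, hfin, a, fun {x y} α => w x y α, ⟨fun {x y} α => (s x y α).2.1,
    fun {x y} α => (s x y α).2.2.1, fun {x y} α => (s x y α).2.2.2.1, ?_, hli⟩,
    fun {x y} α => hw x y α⟩
  intro x y b hb h1 h2
  have hmem : N.mkQ b ∈ Submodule.span k (Set.range fun b : H x y => N.mkQ b.1) := by
    have := Submodule.mem_map_of_mem (f := N.mkQ) (hD.mem_span_homogeneous he hb h1 h2)
    rw [Submodule.map_span] at this
    refine Submodule.span_mono ?_ this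
    rintro _ ⟨c, hc, rfl⟩
    exact ⟨⟨c, hc⟩, rfl⟩
  rw [← hspan x y] at hmem
  have heq : Set.range ((fun b : H x y => N.mkQ b.1) ∘ s x y) =
      N.mkQ '' Set.range (a : (x ⟶ y) → A) := by
    rw [← Set.range_comp]; rfl
  rw [heq, ← Submodule.map_span] at hmem
  obtain ⟨t, ht, hbt⟩ := hmem
  refine ⟨t, ht, ?_⟩
  have h3 : N.mkQ (b - t) = 0 := by rw [map_sub, hbt, sub_self]
  exact (Submodule.Quotient.mk_eq_zero N).1 h3

end HomogeneousPresentations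

/-! ### The equivalence -/

theorem mainTheorem7 {k : Type u} [Field k] [IsAlgClosed k]
    {A : Type u} [Ring A] [Algebra k A] [FiniteDimensional k A]
    (hbasic : IsBasicAlg A) (hconn : IsConnectedAlg A)
    {ι : Type u} [Fintype ι] {e : ι → A} (he : CompleteOrthogonalIdempotents e)
    (hprim : ∀ i, IsPrimitiveIdempotent (e i)) :
    (∀ (Q : Type u) [Fintype Q] [Quiver.{u} Q] [∀ x y : Q, Finite (x ⟶ y)]
        (I : Ideal (PathAlgebra k Q)) [I.IsTwoSided],
        PathAlgebra.IsAdmissible I → Nonempty ((PathAlgebra k Q ⧸ I) ≃ₐ[k] A) →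
          ∀ x₀ : Q, Subsingleton (FundamentalGrp I x₀)) ↔
      ¬ HasProperGaloisCovering k (IdemCat k he) := by
  obtain ⟨χ⟩ := hbasic.exists_splitFamily (k := k) he hprim
  constructor
  · intro hsc hcov
    obtain ⟨⟨x₀⟩, G, _, _, D, hD⟩ := hcov.exists_isCoveringGrading χ
    obtain ⟨_, _, a, w, ha, hw⟩ := hD.exists_isArrowSystem he
    exact ha.not_subsingleton_fundamentalGrp he hD hw x₀
      (hsc ι (RingHom.ker (ha.hom he)) (ha.isAdmissible_ker he)
        ⟨Ideal.quotientKerAlgEquivOfSurjective (ha.hom_surjective he)⟩ x₀)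
  · intro hcov Q _ _ _ I _ hI ⟨Φ⟩ x₀
    by_contra hπ₁
    exact hcov ((isPresentation_of_algEquiv I Φ).hasProperGaloisCovering hI hconn he χ x₀ hπ₁)
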